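/- **Setting.** Let $n\ge 1$. A manifold $M^n$ with center $o$ (i.e. $\exp_o:T_oM\to M$ is a diffeomorphism) is identified with $\mathbb R^n$ through $\exp_o$, with $o=0$, so that $M-\{o\}=\mathbb S^{n-1}\times\mathbb R^+$; $r$ is the distance to $o$ and $B_a$ is the open ball of radius $a$ centered at $o$. Let $\sigma_{\mathbb S^{n-1}}$ be the round metric. For a metric $g=g_r+dr^2$ the *spherical cut* at $r_0$ is the metric $\hat g_{r_0}=g_{r_0}/\sinh^2 r_0$ on $\mathbb S^{n-1}$. Fix smooth functions $\rho',\rho:\mathbb R\to[0,1]$ such that, for some $\delta>0$, $\rho'=0$ on $(-\infty,\delta]$ and $\rho'=1$ on $[\frac12-\delta,\infty)$, and such that $\rho=0$ on $(-\infty,0]$ and $\rho=1$ on $[1,\infty)$. *Hyperbolic forcing* is $\mathcal H_{r_0,d}\,g=\mathcal T_{r_0-d,d}(\mathcal W_{r_0}g)$, where $\mathcal W_{r_0}g=(1-\rho'(r-r_0))(\sinh^2(r)\,\hat g_{r_0}+dr^2)+\rho'(r-r_0)\,g$ and where $\mathcal T_{a,d}$ changes $\sinh^2(r)h+dr^2$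 to $\sinh^2(r)\big((1-\rho_{a,d}(r))\sigma_{\mathbb S^{n-1}}+\rho_{a,d}(r)h\big)+dr^2$ with $\rho_{a,d}(r)=\rho(2\frac{r-a}d)$, and changes nothing where $r\ge a+\frac d2$. For $\xi>0$ let $\mathbb T_\xi=\mathbb B\times(-(1+\xi),1+\xi)$, $\mathbb B\subset\mathbb R^{n-1}$ the open unit ball, with the metric $\sigma=e^{2t}\sigma_{\mathbb R^{n-1}}+dt^2$. A metric $g$ is *radially $\epsilon$-close to hyperbolic on $S$ with charts of excess $\xi$* if every $p\in S$ is the center $\phi(0,0)=p$ of a chart $\phi$ from $\mathbb T_\xi$ into the part of $M-\{o\}$ where $g$ is defined, of the form $\phi(x,t)=(\phi_1(x),t+a)$, such that $|\phi^*g-\sigma|<\epsilon$. Here $|\cdot|$ is the uniform $C^2$ norm on $\mathbb T_\xi$, the supremum of the absolute values of the coefficients and of their partial derivatives of order at most $2$. A metric $h$ on $M$ is *$(B_a,\epsilon)$-close to hyperbolic with charts of excess $\xi$* if $h=\sinh^2(r)\sigma_{\mathbb S^{n-1}}+dr^2$ on $B_a-\{o\}$ and $h=h_r+dr^2$ is radially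 $\epsilon$-close to hyperbolic outside $B_{a-1-\xi}$ with charts of excess $\xi$. Fix a finite atlas of $\mathbb S^{n-1}$ whose charts extend to neighborhoods of the compact closures of their coordinate domains; $C^2$ norms of tensors on $\mathbb S^{n-1}$ are taken in it. For $c>1$ a metric on $\mathbb S^{n-1}$ is *$c$-bounded* if its $C^2$ norm is less than $c$ and its determinants in the charts are everywhere greater than $1/c$ in absolute value. Fix $\xi$ and let $\lambda_0>1+\xi$. A *$\odot$-family* is a family $\{g_\lambda\}_{\lambda\ge\lambda_0}$ of metrics $g_\lambda=(g_\lambda)_r+dr^2$, smooth in $\lambda$ and the point, with $g_\lambda$ defined at least for $r>\lambda-(1+\xi)$. It has *cut limit at $b=0$* if the spherical cuts $\widehat{(g_\lambda)}_\lambda$ converge in $C^2$, as $\lambda\to\infty$, to a $C^2$ metric $\hat g_\infty$ on $\mathbb S^{n-1}$. It is *radially $\epsilon$-close to hyperbolic with charts of excess $\xi$* if every $g_\lambda$ is radially $\epsilon$-close to hyperbolic outside $B_{\lambda-(1+\xi)}$ with charts of excess $\xi$. **Theorem 2.** Let $\xi>1$. There are a constant $C_2=C_2(\xi)>0$ and,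 for every $n$, constants $C_1=C_1(c,n,\xi)>0$ (which depend also on the atlas; all constants depend on the fixed $\rho,\rho'$) with the following property. Let $\{g_\lambda\}_{\lambda\ge\lambda_0}$ be a $\odot$-family on $M^n$ that has cut limit at $b=0$ and is radially $\epsilon$-close to hyperbolic, with charts of excess $\xi$. Then there is $c>1$ such that all spherical cuts $\widehat{(g_\lambda)}_\lambda$, $\lambda\ge\lambda_0$, are $c$-bounded, and for every such $c$, every $\lambda\ge\lambda_0$ and every $d$ with $d\ge4(1+\xi)$ and $\lambda-d\ge2\xi$, the metric $\mathcal H_d\,g_\lambda=\mathcal H_{\lambda,d}\,g_\lambda$ is $(B_{\lambda-d},\eta)$-close to hyperbolic, with charts of excess $\xi-1$, for every $$\eta\ \ge\ C_1\Big(e^{-(\lambda-d)}+\frac1d\Big)+C_2\,\epsilon .$$ In particular the constants do not depend on $\lambda$. -/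

import Mathlib

open Set Filter Topology
open scoped ContDiff ENNReal

noncomputable section

namespace HypForcing

/-- `ℝᵐ`. -/
abbrev Eu (m : ℕ) : Type := EuclideanSpace ℝ (Fin m)

/-- Fields of bilinear forms on `ℝ^{m+1}`.  Two kinds of objects are written this way.

* A metric on an open subset of `M = ℝ^{m+1}` with center `o = 0`.
* A symmetric 2-tensor `h` on the unit sphere `Sᵐ ⊂ ℝ^{m+1}`: then only the values `h x v w` with
  `‖x‖ = 1` and `v, w ⊥ x` matter. -/
abbrev FormField (m : ℕ) : Type := Eu (m + 1) → Eu (m + 1) →L[ℝ] Eu (m + 1) →L[ℝ] ℝ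

/-! ### Uniform `C²` norms -/

/-- Uniform `C²` norm on `S` of a real function, with respect to the partial derivatives in the
directions `b k`. -/
def c2Norm {V κ : Type*} [NormedAddCommGroup V] [NormedSpace ℝ V] (b : κ → V) (S : Set V)
    (f : V → ℝ) : ℝ≥0∞ :=
  ⨆ z ∈ S, ‖f z‖ₑ ⊔ (⨆ k, ‖fderiv ℝ f z (b k)‖ₑ) ⊔
    (⨆ k, ⨆ l, ‖fderiv ℝ (fun y => fderiv ℝ f y (b k)) z (b l)‖ₑ)

/-- Uniform `C²` norm of a matrix valued function: the maximum over the entries. -/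
def c2NormMat {V κ : Type*} [NormedAddCommGroup V] [NormedSpace ℝ V] (b : κ → V) (S : Set V)
    (f : κ → κ → V → ℝ) : ℝ≥0∞ :=
  ⨆ i, ⨆ j, c2Norm b S (f i j)

/-- The coefficients `(φ^* g)(b i, b j)` of the pull-back of `g` by `φ`. -/
def pullCoeff {m : ℕ} {V κ : Type*} [NormedAddCommGroup V] [NormedSpace ℝ V] (b : κ → V)
    (g : FormField m) (φ : V → Eu (m + 1)) (i j : κ) (z : V) : ℝ :=
  g (φ z) (fderiv ℝ φ z (b i)) (fderiv ℝ φ z (b j))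

/-! ### Metrics on `M = ℝ^{m+1}` in polar form -/

/-- `g` is a smooth Riemannian metric on `U`. -/
def IsMetricOn {m : ℕ} (U : Set (Eu (m + 1))) (g : FormField m) : Prop :=
  ContDiffOn ℝ ∞ g U ∧ (∀ y ∈ U, ∀ v w, g y v w = g y w v) ∧ ∀ y ∈ U, ∀ v, v ≠ 0 → 0 < g y v v

/-- `g = g_r + dr²` on `U ⊂ M - {o}`: for the unit radial vector `∂_r = y / ‖y‖` at `y` one has
`g (∂_r, v) = dr v = ⟪∂_r, v⟫` (stated after multiplication with `‖y‖`). -/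
def IsPolarOn {m : ℕ} (U : Set (Eu (m + 1))) (g : FormField m) : Prop :=
  ∀ y ∈ U, ∀ v, g y y v = inner ℝ y v

/-- The part `r > a` of `M - {o} = Sᵐ × ℝ⁺`. -/
def outerRegion (m : ℕ) (a : ℝ) : Set (Eu (m + 1)) := {y | y ≠ 0 ∧ a < ‖y‖}

/-- The round metric of the unit sphere. -/
def roundMetric (m : ℕ) : FormField m := fun _ => innerSL ℝ

/-- The (unwarped) spherical cut `ĝ_r = g_r / sinh² r`, a tensor on the sphere.  A vector `v`
tangent to the unit sphere at `x` is the vector `r v` tangent to the sphere of radius `r` at `r x`,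
so `g_r (v, w) = r² g (r x) (v, w)`. -/
def sphericalCut {m : ℕ} (g : FormField m) (r : ℝ) : FormField m :=
  fun x => (r ^ 2 / Real.sinh r ^ 2) • g (r • x)

/-- The warped metric `sinh² r h + dr²` on `M - {o}`, for a tensor `h` on the sphere.  A vector `v`
at `y = r x`, `‖x‖ = 1`, has the spherical component `(v - ⟪x, v⟫ x) / r`. -/
def warpedMetric {m : ℕ} (h : FormField m) : FormField m := fun y =>
  let x : Eu (m + 1) := ‖y‖⁻¹ • y
  let L : Eu (m + 1) →L[ℝ] Eu (m + 1) :=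
    ‖y‖⁻¹ • (ContinuousLinearMap.id ℝ (Eu (m + 1)) - (innerSL ℝ x).smulRight x)
  Real.sinh ‖y‖ ^ 2 • (h x).bilinearComp L L + (innerSL ℝ x).smulRight (innerSL ℝ x)

open Classical in
/-- The hyperbolic metric `sinh² r σ_{Sᵐ} + dr²` on `M`; its value at the center is the
Euclidean inner product. -/
def hyperbolicMetric (m : ℕ) : FormField m := fun y =>
  if y = 0 then innerSL ℝ else warpedMetric (roundMetric m) y

/-! ### Warp forcing, the two variable warping trick, hyperbolic forcing -/

/-- Gluing functions for warp forcing. -/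
def IsWarpCutoff (ρ : ℝ → ℝ) : Prop :=
  ContDiff ℝ ∞ ρ ∧ (∀ t, ρ t ∈ Icc (0 : ℝ) 1) ∧
    ∃ δ > 0, (∀ t ≤ δ, ρ t = 0) ∧ ∀ t ≥ 1 / 2 - δ, ρ t = 1

/-- Gluing functions for the two variable warping trick. -/
def IsTrickCutoff (ρ : ℝ → ℝ) : Prop :=
  ContDiff ℝ ∞ ρ ∧ (∀ t, ρ t ∈ Icc (0 : ℝ) 1) ∧ (∀ t ≤ 0, ρ t = 0) ∧ ∀ t ≥ 1, ρ t = 1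

/-- Warp forcing `𝒲_{r₀} g = (1 - ρ (r - r₀)) (sinh² r ĝ_{r₀} + dr²) + ρ (r - r₀) g`. -/
def warpForcing {m : ℕ} (ρ : ℝ → ℝ) (r₀ : ℝ) (g : FormField m) : FormField m := fun y =>
  (1 - ρ (‖y‖ - r₀)) • warpedMetric (sphericalCut g r₀) y + ρ (‖y‖ - r₀) • g y

/-- The two variable warping trick `𝒯_{a,d}`.  With `ρ_{a,d} r = ρ (2 (r - a) / d)`, the metric
`sinh² r h + dr²` is sent to `sinh² r ((1 - ρ_{a,d} r) σ + ρ_{a,d} r h) + dr²`.  This is the convex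
combination, with weights `1 - ρ_{a,d}` and `ρ_{a,d}`, of the hyperbolic metric and the given
metric; in this form it applies to metrics that are warped only for `r < a + d / 2 + δ`, and
leaves them unchanged for `r ≥ a + d / 2`. -/
def warpingTrick {m : ℕ} (ρ : ℝ → ℝ) (a d : ℝ) (g : FormField m) : FormField m := fun y =>
  (1 - ρ (2 * ((‖y‖ - a) / d))) • hyperbolicMetric m y + ρ (2 * ((‖y‖ - a) / d)) • g y

/-- Hyperbolic forcing `ℋ_{r₀,d} g = 𝒯_{r₀ - d, d} (𝒲_{r₀} g)`. -/
def hyperbolicForcing {m : ℕ} (ρW ρT : ℝ → ℝ) (r₀ d : ℝ) (g : FormField m) : FormField m :=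
  warpingTrick ρT (r₀ - d) d (warpForcing ρW r₀ g)

/-! ### Metrics close to hyperbolic -/

/-- The vector space `ℝᵐ × ℝ` that contains the model spaces. -/
abbrev Model (m : ℕ) : Type := Eu m × ℝ

/-- The canonical basis vectors of `ℝᵐ × ℝ`; `none` stands for the last one. -/
def modelBasis (m : ℕ) : Option (Fin m) → Model m
  | some i => (EuclideanSpace.single i 1, 0)
  | none => (0, 1)

/-- The model space `𝕋_ξ = 𝔹 × (-(1 + ξ), 1 + ξ)` of excess `ξ`. -/
def modelSet (m : ℕ) (ξ : ℝ) : Set (Model m) := Metric.ball 0 1 ×ˢ Ioo (-(1 + ξ)) (1 + ξ)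

/-- The coefficients of the hyperbolic metric `σ = e^{2t} σ_{ℝᵐ} + dt²` on the model space. -/
def modelCoeff (m : ℕ) (i j : Option (Fin m)) (z : Model m) : ℝ :=
  Real.exp (2 * z.2) * inner ℝ (modelBasis m i).1 (modelBasis m j).1
    + (modelBasis m i).2 * (modelBasis m j).2

/-- `φ : 𝕋_ξ → U ⊂ M - {o}` is a chart (a smooth embedding onto an open set) with center `p` that
respects the product structures: `φ (x, t) = (φ₁ x, t + a) ∈ Sᵐ × ℝ⁺`. -/
def IsRadialChart {m : ℕ} (U : Set (Eu (m + 1))) (ξ : ℝ) (p : Eu (m + 1))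
    (φ : Model m → Eu (m + 1)) : Prop :=
  ContDiffOn ℝ ∞ φ (modelSet m ξ) ∧ InjOn φ (modelSet m ξ) ∧
  (∀ z ∈ modelSet m ξ, Function.Injective (fderiv ℝ φ z)) ∧
  MapsTo φ (modelSet m ξ) U ∧ φ 0 = p ∧
  ∃ (φ₁ : Eu m → Eu (m + 1)) (a : ℝ), ∀ x t, (x, t) ∈ modelSet m ξ →
    ‖φ₁ x‖ = 1 ∧ 0 < t + a ∧ φ (x, t) = (t + a) • φ₁ x

/-- The metric `g`, defined on `U ⊂ M - {o}`, is radially `ε`-close to hyperbolic on `S`, with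
charts of excess `ξ`. -/
def RadiallyCloseOn {m : ℕ} (U : Set (Eu (m + 1))) (g : FormField m) (ε ξ : ℝ)
    (S : Set (Eu (m + 1))) : Prop :=
  ∀ p ∈ S, ∃ φ : Model m → Eu (m + 1), IsRadialChart U ξ p φ ∧
    c2NormMat (modelBasis m) (modelSet m ξ)
      (fun i j z => pullCoeff (modelBasis m) g φ i j z - modelCoeff m i j z) < ENNReal.ofReal ε

/-- The metric `h` on `M` is `(B_a, ε)`-close to hyperbolic, with charts of excess `ξ`. -/
def BallCloseToHyperbolic {m : ℕ} (h : FormField m) (a ε ξ : ℝ) : Prop :=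
  IsMetricOn {0}ᶜ h ∧ IsPolarOn {0}ᶜ h ∧
  (∀ y ∈ Metric.ball (0 : Eu (m + 1)) a, h y = hyperbolicMetric m y) ∧
  RadiallyCloseOn {0}ᶜ h ε ξ (Metric.ball 0 (a - 1 - ξ))ᶜ

/-! ### Tensors on the sphere -/

/-- The canonical basis of `ℝᵐ`. -/
def stdVec (m : ℕ) (i : Fin m) : Eu m := EuclideanSpace.single i 1

/-- A finite atlas of the unit sphere `Sᵐ ⊂ ℝ^{m+1}` with extendable charts.  The charts are given
by their inverses `ψ i : dom i → Sᵐ`, which are smooth embeddings of a neighborhood `ext i` of the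
compact closure of `dom i`. -/
structure SphereAtlas (m : ℕ) where
  /-- number of charts -/
  N : ℕ
  /-- the inverse charts -/
  ψ : Fin N → Eu m → Eu (m + 1)
  /-- the coordinate domains -/
  dom : Fin N → Set (Eu m)
  /-- the domains of the extended charts -/
  ext : Fin N → Set (Eu m)
  isOpen_dom : ∀ i, IsOpen (dom i)
  isOpen_ext : ∀ i, IsOpen (ext i)
  isCompact_closure : ∀ i, IsCompact (closure (dom i))
  closure_subset : ∀ i, closure (dom i) ⊆ ext i
  smooth : ∀ i, ContDiffOn ℝ ∞ (ψ i) (ext i)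
  injOn : ∀ i, InjOn (ψ i) (ext i)
  immersion : ∀ i, ∀ z ∈ ext i, Function.Injective (fderiv ℝ (ψ i) z)
  mapsTo : ∀ i, MapsTo (ψ i) (ext i) (Metric.sphere 0 1)
  isOpen_image : ∀ i, ∃ O : Set (Eu (m + 1)), IsOpen O ∧ ψ i '' dom i = O ∩ Metric.sphere 0 1
  cover : Metric.sphere (0 : Eu (m + 1)) 1 ⊆ ⋃ i, ψ i '' dom i

/-- Uniform `C²` norm of a tensor on the sphere with respect to an atlas. -/
def sphereNorm {m : ℕ} (A : SphereAtlas m) (h : FormField m) : ℝ≥0∞ :=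
  ⨆ i, c2NormMat (stdVec m) (A.dom i) (pullCoeff (stdVec m) h (A.ψ i))

/-- The tensor `h` on the sphere is `c`-bounded: its `C²` norm is less than `c`, and the
determinants of its coefficient matrices are everywhere greater than `1 / c`. -/
def CBounded {m : ℕ} (A : SphereAtlas m) (c : ℝ) (h : FormField m) : Prop :=
  sphereNorm A h < ENNReal.ofReal c ∧
  ∀ i, ∀ z ∈ A.dom i,
    1 / c < |(Matrix.of fun k l => pullCoeff (stdVec m) h (A.ψ i) k l z).det|

/-- `h` is a `C²` Riemannian metric on the sphere.  (`C²` means: the coefficients of the pull-back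
by every smooth map from an open subset of `ℝᵐ` to the sphere are `C²`.) -/
def IsC2SphereMetric {m : ℕ} (h : FormField m) : Prop :=
  (∀ x, ‖x‖ = 1 → ∀ v w, inner ℝ x v = 0 → inner ℝ x w = 0 → h x v w = h x w v) ∧
  (∀ x, ‖x‖ = 1 → ∀ v, inner ℝ x v = 0 → v ≠ 0 → 0 < h x v v) ∧
  ∀ (W : Set (Eu m)) (ψ : Eu m → Eu (m + 1)), IsOpen W → ContDiffOn ℝ ∞ ψ W →
    MapsTo ψ W (Metric.sphere 0 1) → ∀ i j, ContDiffOn ℝ 2 (pullCoeff (stdVec m) h ψ i j) W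

/-! ### `⊙`-families -/

/-- A `⊙`-family `{g_l}`, `l ≥ l₀`: each `g_l` is a metric of the form `(g_l)_r + dr²` defined for
`r > inn l`, where `inn l ≤ l - (1 + ξ)`, and `g_l` depends smoothly on `l`. -/
structure IsOdotFamily {m : ℕ} (ξ l₀ : ℝ) (inn : ℝ → ℝ) (g : ℝ → FormField m) : Prop where
  lt_l₀ : 1 + ξ < l₀
  inn_le : ∀ l ≥ l₀, inn l ≤ l - (1 + ξ)
  metric : ∀ l ≥ l₀, IsMetricOn (outerRegion m (inn l)) (g l)
  polar : ∀ l ≥ l₀, IsPolarOn (outerRegion m (inn l)) (g l)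
  smooth : ContDiffOn ℝ ∞ (fun q : ℝ × Eu (m + 1) => g q.1 q.2)
    {q | l₀ ≤ q.1 ∧ q.1 - (1 + ξ) < ‖q.2‖}

/-- The `⊙`-family has the cut limit `ginf` at `b`: the spherical cuts of `g_l` at `l + b`
converge to `ginf` in the `C²` norm, as `l → ∞`. -/
def HasCutLimit {m : ℕ} (A : SphereAtlas m) (g : ℝ → FormField m) (b : ℝ)
    (ginf : FormField m) : Prop :=
  IsC2SphereMetric ginf ∧
  Tendsto (fun l => sphereNorm A (sphericalCut (g l) (l + b) - ginf)) atTop (𝓝 0)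

/-- The `⊙`-family is radially `ε`-close to hyperbolic, with charts of excess `ξ`. -/
def OdotRadiallyClose {m : ℕ} (l₀ : ℝ) (inn : ℝ → ℝ) (g : ℝ → FormField m) (ε ξ : ℝ) : Prop :=
  ∀ l ≥ l₀, RadiallyCloseOn (outerRegion m (inn l)) (g l) ε ξ (Metric.ball 0 (l - (1 + ξ)))ᶜ

end HypForcing

end

namespace HypForcing

/-! ### Calculus of uniform `C²` bounds -/

/-! The forced metric is polar and smooth off the center. In a radial chart the coefficients of a
polar metric involving the radial direction agree with those of the model, so only the spherical
coefficients need estimates (`IsRadialMap.c2NormMat_le`). Three kinds of centers `p` occur,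
according to `‖p‖`. A chart of excess `ξ - 1` has radial half-length `ξ`, one less than the given
charts. This lost unit leaves room for an overlap: a chart centered at least `ξ` below the level `l`
does not reach it, while every given chart centered within `ξ + 1 / 2` of the level contains the
whole slice `r = l`.

Below the level (`exists_trick_bound`), the forced metric is `sinh² r ((1 - ρ) σ + ρ h) + dr²`, with
`h` the spherical cut at `l`, and charts must be constructed. At the center, a linear frame
orthonormalizes the convex combination of `σ` and `h`; the frame is bounded in terms of `c` and the
atlas (`exists_frame`, `SphereAtlas.exists_adapted_chart`). The sphere chart is then contracted by a
factor `τ`, about `1 / sinh r`. Four errors remain: the variation of the two tensors over the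
contracted chart is `O(τ) = O(exp (-r))`; the variation of `ρ` is `O(1 / d)`; `sinh² (r + t) / sinh²
r` differs from `exp (2 t)` by `O(exp (-r))`; and `τ² sinh² r` differs from `1` by `O(exp (-r))`.
Since `r ≥ l - d - ξ`, the total is `O(exp (-(l - d)) + 1 / d)`.

Near the level (`exists_warp_bound`), the given chart is kept. The warping trick is the identity
there because `d ≥ 4 (1 + ξ)`. The cut is read off from the slice `t₀ = l - ‖p‖` of the same chart,
where the metric is `ε`-close to `exp (2 t₀)` times the flat one. Warping multiplies this slice by
`sinh² r / sinh² l`, which is `exp (2 (t - t₀))` up to `O(exp (-l))`. Only functions of `t` and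
slices of the error enter, so no dimension appears in the constants; this is why `C₂` can be chosen
before `m` and the atlas.

Above the level the metric is unchanged on the chart, and the bound `ε` persists
(`c2NormMat_hyperbolicForcing_of_far`).

The existence of `c` (`IsOdotFamily.exists_cBounded`) is compactness on bounded ranges of `l`
together with convergence to a nondegenerate limit for large `l`. -/

/-- `f` is `C²` on `S`, and `K` bounds its absolute value and those of its partial derivatives of
order at most two in the directions `b k`. -/
structure C2Bound {V κ : Type*} [NormedAddCommGroup V] [NormedSpace ℝ V] (b : κ → V) (S : Set V)
    (f : V → ℝ) (K : ℝ) : Prop where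
  contDiffOn : ContDiffOn ℝ 2 f S
  val : ∀ z ∈ S, |f z| ≤ K
  d1 : ∀ z ∈ S, ∀ k, |fderiv ℝ f z (b k)| ≤ K
  d2 : ∀ z ∈ S, ∀ k l, |fderiv ℝ (fun y => fderiv ℝ f y (b k)) z (b l)| ≤ K

section Calculus

variable {V W κ κ' : Type*} [NormedAddCommGroup V] [NormedSpace ℝ V] [NormedAddCommGroup W]
  [NormedSpace ℝ W] {b : κ → V} {b' : κ' → W} {S : Set V} {S' : Set W} {f g : V → ℝ} {K L : ℝ}

theorem differentiableAt_of_contDiffOn_two (hS : IsOpen S) (hf : ContDiffOn ℝ 2 f S) {z : V}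
    (hz : z ∈ S) : DifferentiableAt ℝ f z :=
  (hf.differentiableOn (by norm_num)).differentiableAt (hS.mem_nhds hz)

theorem differentiableAt_fderiv_apply (hS : IsOpen S) (hf : ContDiffOn ℝ 2 f S) {z : V}
    (hz : z ∈ S) (v : V) : DifferentiableAt ℝ (fun y => fderiv ℝ f y v) z := by
  have h1 : ContDiffOn ℝ 1 (fderiv ℝ f) S := hf.fderiv_of_isOpen hS (by norm_num)
  have h2 : DifferentiableAt ℝ (fderiv ℝ f) z :=
    (h1.differentiableOn (by norm_num)).differentiableAt (hS.mem_nhds hz)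
  exact h2.clm_apply (differentiableAt_const v)

theorem C2Bound.mono (h : C2Bound b S f K) (hKL : K ≤ L) : C2Bound b S f L :=
  ⟨h.contDiffOn, fun z hz => (h.val z hz).trans hKL, fun z hz k => (h.d1 z hz k).trans hKL,
    fun z hz k l => (h.d2 z hz k l).trans hKL⟩

theorem C2Bound.subset {T : Set V} (h : C2Bound b S f K) (hT : T ⊆ S) : C2Bound b T f K :=
  ⟨h.contDiffOn.mono hT, fun z hz => h.val z (hT hz), fun z hz => h.d1 z (hT hz),
    fun z hz => h.d2 z (hT hz)⟩

theorem fderiv_congr_of_eqOn (hS : IsOpen S) (hfg : EqOn f g S) {z : V} (hz : z ∈ S) :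
    fderiv ℝ f z = fderiv ℝ g z :=
  Filter.EventuallyEq.fderiv_eq (hfg.eventuallyEq_of_mem (hS.mem_nhds hz))

theorem C2Bound.congr (hS : IsOpen S) (h : C2Bound b S f K) (hfg : EqOn g f S) :
    C2Bound b S g K := by
  refine ⟨h.contDiffOn.congr hfg, fun z hz => ?_, fun z hz k => ?_, fun z hz k l => ?_⟩
  · rw [hfg hz]; exact h.val z hz
  · rw [fderiv_congr_of_eqOn hS hfg hz]; exact h.d1 z hz k
  · have : EqOn (fun y => fderiv ℝ g y (b k)) (fun y => fderiv ℝ f y (b k)) S := fun y hy => by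
      simp only [fderiv_congr_of_eqOn hS hfg hy]
    rw [fderiv_congr_of_eqOn hS this hz]
    exact h.d2 z hz k l

theorem C2Bound.const {c : ℝ} (hc : |c| ≤ K) : C2Bound b S (fun _ => c) K := by
  have h0 : 0 ≤ K := (abs_nonneg c).trans hc
  exact ⟨contDiffOn_const, fun z _ => hc, fun z _ k => by simpa using h0,
    fun z _ k l => by simpa using h0⟩

theorem C2Bound.add (hS : IsOpen S) (hf : C2Bound b S f K) (hg : C2Bound b S g L) :
    C2Bound b S (fun z => f z + g z) (K + L) := by
  have hD : ∀ z ∈ S, fderiv ℝ (fun z => f z + g z) z = fderiv ℝ f z + fderiv ℝ g z := fun z hz =>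
    fderiv_fun_add (differentiableAt_of_contDiffOn_two hS hf.contDiffOn hz)
      (differentiableAt_of_contDiffOn_two hS hg.contDiffOn hz)
  refine ⟨hf.contDiffOn.add hg.contDiffOn, fun z hz => ?_, fun z hz k => ?_, fun z hz k l => ?_⟩
  · exact (abs_add_le _ _).trans (add_le_add (hf.val z hz) (hg.val z hz))
  · rw [hD z hz]
    exact (abs_add_le _ _).trans (add_le_add (hf.d1 z hz k) (hg.d1 z hz k))
  · have : EqOn (fun y => fderiv ℝ (fun z => f z + g z) y (b k))
        (fun y => fderiv ℝ f y (b k) + fderiv ℝ g y (b k)) S := fun y hy => by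
      simp only [hD y hy, add_apply]
    rw [fderiv_congr_of_eqOn hS this hz,
      fderiv_fun_add (differentiableAt_fderiv_apply hS hf.contDiffOn hz _)
        (differentiableAt_fderiv_apply hS hg.contDiffOn hz _)]
    exact (abs_add_le _ _).trans (add_le_add (hf.d2 z hz k l) (hg.d2 z hz k l))

theorem C2Bound.mul (hS : IsOpen S) (hf : C2Bound b S f K) (hg : C2Bound b S g L) :
    C2Bound b S (fun z => f z * g z) (4 * (K * L)) := by
  have hD : ∀ z ∈ S, fderiv ℝ (fun z => f z * g z) z = f z • fderiv ℝ g z + g z • fderiv ℝ f z :=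
    fun z hz => fderiv_fun_mul (differentiableAt_of_contDiffOn_two hS hf.contDiffOn hz)
      (differentiableAt_of_contDiffOn_two hS hg.contDiffOn hz)
  have key : ∀ {x y : ℝ}, |x| ≤ K → |y| ≤ L → |x * y| ≤ K * L := fun hx hy => by
    rw [abs_mul]; exact mul_le_mul hx hy (abs_nonneg _) ((abs_nonneg _).trans hx)
  refine ⟨hf.contDiffOn.mul hg.contDiffOn, fun z hz => ?_, fun z hz k => ?_, fun z hz k l => ?_⟩
  · have h1 := key (hf.val z hz) (hg.val z hz)
    linarith [(abs_nonneg _).trans h1]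
  · have h1 := key (hf.val z hz) (hg.d1 z hz k)
    have h2 := key (hf.d1 z hz k) (hg.val z hz)
    rw [hD z hz]
    simp only [add_apply, smul_apply, smul_eq_mul]
    rw [mul_comm (g z)]
    linarith [abs_add_le (f z * fderiv ℝ g z (b k)) (fderiv ℝ f z (b k) * g z),
      (abs_nonneg _).trans h1]
  · have : EqOn (fun y => fderiv ℝ (fun z => f z * g z) y (b k))
        (fun y => f y * fderiv ℝ g y (b k) + g y * fderiv ℝ f y (b k)) S := fun y hy => by
      simp only [hD y hy, add_apply, smul_apply,
        smul_eq_mul]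
    have df := differentiableAt_of_contDiffOn_two hS hf.contDiffOn hz
    have dg := differentiableAt_of_contDiffOn_two hS hg.contDiffOn hz
    have df' := differentiableAt_fderiv_apply hS hf.contDiffOn hz (b k)
    have dg' := differentiableAt_fderiv_apply hS hg.contDiffOn hz (b k)
    rw [fderiv_congr_of_eqOn hS this hz, fderiv_fun_add (df.fun_mul dg') (dg.fun_mul df'),
      fderiv_fun_mul df dg', fderiv_fun_mul dg df']
    simp only [add_apply, smul_apply, smul_eq_mul]
    have h1 := abs_le.1 (key (hf.val z hz) (hg.d2 z hz k l))
    have h2 := abs_le.1 (key (hf.d1 z hz l) (hg.d1 z hz k))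
    have h3 := abs_le.1 (key (hf.d1 z hz k) (hg.d1 z hz l))
    have h4 := abs_le.1 (key (hf.d2 z hz k l) (hg.val z hz))
    -- The second derivative of a product has four terms, each at most `K * L`; this is the source
    -- of the factor `4`.
    rw [abs_le]
    constructor <;> linarith [h1.1, h1.2, h2.1, h2.2, h3.1, h3.2, h4.1, h4.2]

/-- A constant factor commutes with differentiation, so the factor `4` of `C2Bound.mul` is avoided.
-/
theorem C2Bound.const_mul (hS : IsOpen S) (hf : C2Bound b S f K) (a : ℝ) :
    C2Bound b S (fun z => a * f z) (|a| * K) := by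
  have hD : ∀ z ∈ S, fderiv ℝ (fun z => a * f z) z = a • fderiv ℝ f z :=
    fun z hz => fderiv_const_mul (differentiableAt_of_contDiffOn_two hS hf.contDiffOn hz) a
  have key : ∀ {x : ℝ}, |x| ≤ K → |a * x| ≤ |a| * K := fun hx => by
    rw [abs_mul]; exact mul_le_mul_of_nonneg_left hx (abs_nonneg _)
  refine ⟨contDiffOn_const.mul hf.contDiffOn, fun z hz => key (hf.val z hz), fun z hz k => ?_,
    fun z hz k l => ?_⟩
  · rw [hD z hz]; exact key (hf.d1 z hz k)
  · have : EqOn (fun y => fderiv ℝ (fun z => a * f z) y (b k))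
        (fun y => a * fderiv ℝ f y (b k)) S := fun y hy => by
      simp only [hD y hy, smul_apply, smul_eq_mul]
    rw [fderiv_congr_of_eqOn hS this hz,
      fderiv_const_mul (differentiableAt_fderiv_apply hS hf.contDiffOn hz _)]
    exact key (hf.d2 z hz k l)

theorem C2Bound.sub (hS : IsOpen S) (hf : C2Bound b S f K) (hg : C2Bound b S g L) :
    C2Bound b S (fun z => f z - g z) (K + L) := by
  have := hf.add hS (hg.const_mul hS (-1))
  simp only [abs_neg, abs_one, one_mul, neg_mul] at this
  simpa only [sub_eq_add_neg] using this

theorem C2Bound.sum {ι : Type*} (hS : IsOpen S) (s : Finset ι) {F : ι → V → ℝ}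
    (h : ∀ i ∈ s, C2Bound b S (F i) K) : C2Bound b S (fun z => ∑ i ∈ s, F i z) (s.card * K) := by
  classical
  induction s using Finset.induction_on with
  | empty => simpa using C2Bound.const (b := b) (S := S) (c := 0) (K := 0) (by simp)
  | insert i s hi ih =>
    have h1 := (h i (Finset.mem_insert_self i s)).add hS
      (ih fun j hj => h j (Finset.mem_insert_of_mem hj))
    simp only [Finset.sum_insert hi, Finset.card_insert_of_notMem hi]
    exact h1.mono (by push_cast; linarith)

end Calculus

/-! ### Affine changes of variables. -/

section Affine

variable {V W κ κ' : Type*} [NormedAddCommGroup V] [NormedSpace ℝ V] [NormedAddCommGroup W]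
  [NormedSpace ℝ W] [Fintype κ'] {b : κ → V} {b' : κ' → W} {S : Set V} {S' : Set W}
  {f : W → ℝ} {K θ : ℝ}

theorem abs_sum_mul_le {M x : κ' → ℝ} (hM : ∑ j, |M j| ≤ θ) (hx : ∀ j, |x j| ≤ K) (hK : 0 ≤ K) :
    |∑ j, M j * x j| ≤ θ * K := by
  calc |∑ j, M j * x j| ≤ ∑ j, |M j| * K := by
        refine (Finset.abs_sum_le_sum_abs _ _).trans (Finset.sum_le_sum fun j _ => ?_)
        rw [abs_mul]; exact mul_le_mul_of_nonneg_left (hx j) (abs_nonneg _)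
    _ ≤ θ * K := by rw [← Finset.sum_mul]; exact mul_le_mul_of_nonneg_right hM hK

/-- Derivative bounds for the composition of a function with an affine map. -/
theorem C2Bound.comp_affine_aux (hS : IsOpen S) (hS' : IsOpen S') (hf : C2Bound b' S' f K)
    (w₀ : W) (T : V →L[ℝ] W) (hT : ∀ y ∈ S, w₀ + T y ∈ S') (M : κ → κ' → ℝ)
    (hM : ∀ k, T (b k) = ∑ j, M k j • b' j) (hθ : ∀ k, ∑ j, |M k j| ≤ θ) :
    ContDiffOn ℝ 2 (fun y => f (w₀ + T y)) S ∧
    (∀ z ∈ S, ∀ k, |fderiv ℝ (fun y => f (w₀ + T y)) z (b k)| ≤ θ * K) ∧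
    ∀ z ∈ S, ∀ k l, |fderiv ℝ (fun y => fderiv ℝ (fun y => f (w₀ + T y)) y (b k)) z (b l)| ≤
      θ * (θ * K) := by
  have hA : ∀ y, HasFDerivAt (fun y => w₀ + T y) T y := fun y => T.hasFDerivAt.const_add w₀
  -- By the chain rule, a partial derivative along `b k` is a combination of those along `b' j`
  -- whose coefficients have `ℓ¹` norm at most `θ`; each differentiation costs one factor `θ`.
  have hD : ∀ z ∈ S, ∀ k, fderiv ℝ (fun y => f (w₀ + T y)) z (b k) =
      ∑ j, M k j * fderiv ℝ f (w₀ + T z) (b' j) := fun z hz k => by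
    have h1 := ((differentiableAt_of_contDiffOn_two hS' hf.contDiffOn
      (hT z hz)).hasFDerivAt.comp z (hA z)).fderiv
    rw [Function.comp_def] at h1
    rw [h1]
    simp [hM, map_sum]
  have hKz : ∀ z ∈ S, 0 ≤ K := fun z hz => (abs_nonneg _).trans (hf.val _ (hT z hz))
  refine ⟨hf.contDiffOn.comp (contDiff_const.add T.contDiff).contDiffOn hT, fun z hz k => ?_,
    fun z hz k l => ?_⟩
  · rw [hD z hz]
    exact abs_sum_mul_le (hθ k) (fun j => hf.d1 _ (hT z hz) j) (hKz z hz)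
  · have : EqOn (fun y => fderiv ℝ (fun y => f (w₀ + T y)) y (b k))
        (fun y => ∑ j, M k j * fderiv ℝ f (w₀ + T y) (b' j)) S := fun y hy => hD y hy k
    have h2 : ∀ j, HasFDerivAt (fun y => fderiv ℝ f (w₀ + T y) (b' j))
        ((fderiv ℝ (fun w => fderiv ℝ f w (b' j)) (w₀ + T z)).comp T) z := fun j =>
      (differentiableAt_fderiv_apply hS' hf.contDiffOn (hT z hz) (b' j)).hasFDerivAt.comp
        (f := fun y => w₀ + T y) z (hA z)
    have h3 := (HasFDerivAt.fun_sum (u := Finset.univ) fun j _ => (h2 j).const_mul (M k j)).fderiv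
    rw [fderiv_congr_of_eqOn hS this hz, h3]
    simp only [sum_apply, smul_apply, smul_eq_mul,
      ContinuousLinearMap.comp_apply, hM, map_sum, map_smul]
    have hθ0 : 0 ≤ θ := (Finset.sum_nonneg fun j _ => abs_nonneg _).trans (hθ k)
    exact abs_sum_mul_le (hθ k) (fun j => abs_sum_mul_le (hθ l)
      (fun i => hf.d2 _ (hT z hz) j i) (hKz z hz)) (mul_nonneg hθ0 (hKz z hz))

theorem C2Bound.comp_affine (hS : IsOpen S) (hS' : IsOpen S') (hf : C2Bound b' S' f K)
    (w₀ : W) (T : V →L[ℝ] W) (hT : ∀ y ∈ S, w₀ + T y ∈ S') (M : κ → κ' → ℝ)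
    (hM : ∀ k, T (b k) = ∑ j, M k j • b' j) (hθ : ∀ k, ∑ j, |M k j| ≤ 1) :
    C2Bound b S (fun y => f (w₀ + T y)) K := by
  obtain ⟨h1, h2, h3⟩ := hf.comp_affine_aux hS hS' w₀ T hT M hM hθ
  exact ⟨h1, fun z hz => hf.val _ (hT z hz), by simpa using h2, by simpa using h3⟩

/-- A contraction of the variables by the factor `θ` makes the function `θ`-close to a constant. -/
theorem C2Bound.comp_affine_sub_const [Fintype κ] (hS : IsOpen S) (hS' : IsOpen S')
    (hf : C2Bound b' S' f K)
    (w₀ : W) (T : V →L[ℝ] W) (hT : ∀ y ∈ S, w₀ + T y ∈ S') (M : κ → κ' → ℝ)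
    (hM : ∀ k, T (b k) = ∑ j, M k j • b' j) (hθ : ∀ k, ∑ j, |M k j| ≤ θ) (hθ1 : θ ≤ 1)
    (hθ0 : 0 ≤ θ) {C : ℝ} (hC : 1 ≤ C) (hstar : ∀ z ∈ S, ∀ s ∈ Icc (0 : ℝ) 1, s • z ∈ S)
    (hcoord : ∀ z ∈ S, ∃ a : κ → ℝ, z = ∑ k, a k • b k ∧ ∑ k, |a k| ≤ C) :
    C2Bound b S (fun y => f (w₀ + T y) - f w₀) (C * (θ * K)) := by
  obtain ⟨h1, h2, h3⟩ := hf.comp_affine_aux hS hS' w₀ T hT M hM hθ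
  have hKz : ∀ z ∈ S, 0 ≤ θ * K := fun z hz =>
    mul_nonneg hθ0 ((abs_nonneg _).trans (hf.val _ (hT z hz)))
  have hle : ∀ z ∈ S, θ * K ≤ C * (θ * K) := fun z hz =>
    le_mul_of_one_le_left (hKz z hz) hC
  have hsub : ∀ z, fderiv ℝ (fun y => f (w₀ + T y) - f w₀) z =
      fderiv ℝ (fun y => f (w₀ + T y)) z := fun z => fderiv_sub_const _
  refine ⟨h1.sub contDiffOn_const, fun z hz => ?_, fun z hz k => ?_, fun z hz k l => ?_⟩
  · obtain ⟨a, ha, haC⟩ := hcoord z hz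
    -- Mean value inequality on the segment from `0` to `z`. The derivative along `z` is bounded
    -- through the coordinates of `z`, whose `ℓ¹` norm is at most `C`.
    have hu : ∀ s ∈ Icc (0 : ℝ) 1, HasDerivWithinAt (fun s : ℝ => f (w₀ + T (s • z)))
        (fderiv ℝ (fun y => f (w₀ + T y)) (s • z) z) (Icc 0 1) s := fun s hs => by
      have e1 := (differentiableAt_of_contDiffOn_two hS h1 (hstar z hz s hs)).hasFDerivAt
      have e2 : HasDerivAt (fun s : ℝ => s • z) z s := by
        simpa using (hasDerivAt_id s).smul_const z
      exact (e1.comp_hasDerivAt s e2).hasDerivWithinAt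
    have hb : ∀ s ∈ Ico (0 : ℝ) 1, ‖fderiv ℝ (fun y => f (w₀ + T y)) (s • z) z‖ ≤ C * (θ * K) :=
      fun s hs => by
        have hsz := hstar z hz s ⟨hs.1, hs.2.le⟩
        rw [Real.norm_eq_abs]
        have : fderiv ℝ (fun y => f (w₀ + T y)) (s • z) z =
            ∑ k, a k * fderiv ℝ (fun y => f (w₀ + T y)) (s • z) (b k) := by
          conv_lhs => rw [ha, map_sum]
          simp only [← ha, map_smul, smul_eq_mul]
        rw [this]
        exact abs_sum_mul_le haC (fun k => h2 _ hsz k) (hKz z hz)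
    simpa using norm_image_sub_le_of_norm_deriv_le_segment_01' hu hb
  · rw [hsub]; exact (h2 z hz k).trans (hle z hz)
  · simp only [hsub]
    refine (h3 z hz k l).trans (le_trans ?_ (hle z hz))
    -- Second derivatives carry `θ²`, which is at most `θ` because `θ ≤ 1`.
    exact mul_le_of_le_one_left (hKz z hz) hθ1

end Affine

/-! ### `C²` bounds by compactness, and comparison with the `C²` norm. -/

section Existence

variable {V κ : Type*} [NormedAddCommGroup V] [NormedSpace ℝ V] {b : κ → V} {S : Set V}
  {f : V → ℝ} {K : ℝ}

theorem _root_.IsCompact.exists_abs_le {X : Type*} [TopologicalSpace X] {Q : Set X}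
    (hQ : IsCompact Q) {u : X → ℝ} (hu : ContinuousOn u Q) : ∃ C, ∀ z ∈ Q, |u z| ≤ C := by
  obtain ⟨C, hC⟩ := hQ.exists_bound_of_continuousOn hu
  exact ⟨C, hC⟩

/-- A function of class `C²` on a neighborhood of a compact set is `C²` bounded there. -/
theorem exists_c2Bound [Finite κ] (hS : IsOpen S) (hf : ContDiffOn ℝ 2 f S) {Q : Set V}
    (hQ : IsCompact Q) (hQS : Q ⊆ S) : ∃ K, 0 < K ∧ C2Bound b Q f K := by
  have := Fintype.ofFinite κ
  have c1 : ContDiffOn ℝ 1 (fderiv ℝ f) S := hf.fderiv_of_isOpen hS (by norm_num)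
  have c1' : ∀ k, ContDiffOn ℝ 1 (fun y => fderiv ℝ f y (b k)) S := fun k =>
    c1.clm_apply contDiffOn_const
  have c2 : ∀ k l, ContinuousOn (fun z => fderiv ℝ (fun y => fderiv ℝ f y (b k)) z (b l)) S :=
    fun k l => (((c1' k).continuousOn_fderiv_of_isOpen hS (by norm_num)).clm_apply
      continuousOn_const)
  obtain ⟨K0, h0⟩ := hQ.exists_abs_le (hf.continuousOn.mono hQS)
  choose K1 h1 using fun k => hQ.exists_abs_le ((c1' k).continuousOn.mono hQS)
  choose K2 h2 using fun k l => hQ.exists_abs_le ((c2 k l).mono hQS)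
  refine ⟨1 + |K0| + ∑ k, |K1 k| + ∑ k, ∑ l, |K2 k l|, by positivity, hf.mono hQS,
    fun z hz => ?_, fun z hz k => ?_, fun z hz k l => ?_⟩
  · have := (h0 z hz).trans (le_abs_self _)
    have : 0 ≤ ∑ k, |K1 k| + ∑ k, ∑ l, |K2 k l| := by positivity
    linarith
  · have e1 := (h1 k z hz).trans (le_abs_self _)
    have e2 := Finset.single_le_sum (f := fun k => |K1 k|) (fun k _ => abs_nonneg _)
      (Finset.mem_univ k)
    have : 0 ≤ |K0| + ∑ k, ∑ l, |K2 k l| := by positivity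
    linarith
  · have e1 := (h2 k l z hz).trans (le_abs_self _)
    have e2 := Finset.single_le_sum (f := fun l => |K2 k l|) (fun k _ => abs_nonneg _)
      (Finset.mem_univ l)
    have e3 := Finset.single_le_sum (f := fun k => ∑ l, |K2 k l|)
      (fun k _ => Finset.sum_nonneg fun _ _ => abs_nonneg _) (Finset.mem_univ k)
    have : 0 ≤ |K0| + ∑ k, |K1 k| := by positivity
    linarith

theorem C2Bound.c2Norm_le (h : C2Bound b S f K) : c2Norm b S f ≤ ENNReal.ofReal K := by
  have key : ∀ {x : ℝ}, |x| ≤ K → ‖x‖ₑ ≤ ENNReal.ofReal K := fun hx => by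
    rw [← ofReal_norm]; exact ENNReal.ofReal_le_ofReal hx
  refine iSup₂_le fun z hz => sup_le (sup_le (key (h.val z hz)) ?_) ?_
  · exact iSup_le fun k => key (h.d1 z hz k)
  · exact iSup_le fun k => iSup_le fun l => key (h.d2 z hz k l)

/-- Regularity is a separate hypothesis: `fderiv` vanishes by convention at points of
nondifferentiability, so a finite norm does not imply it. -/
theorem C2Bound.of_c2Norm_le (hf : ContDiffOn ℝ 2 f S) (hK : 0 ≤ K)
    (h : c2Norm b S f ≤ ENNReal.ofReal K) : C2Bound b S f K := by
  have key : ∀ {x : ℝ}, ‖x‖ₑ ≤ ENNReal.ofReal K → |x| ≤ K := fun hx => by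
    rw [← ofReal_norm] at hx
    exact (ENNReal.ofReal_le_ofReal_iff hK).1 hx
  have h' : ∀ z ∈ S, _ := fun z hz => (iSup₂_le_iff.1 h) z hz
  refine ⟨hf, fun z hz => key ?_, fun z hz k => key ?_, fun z hz k l => key ?_⟩
  · exact (le_sup_left.trans le_sup_left).trans (h' z hz)
  · exact ((le_iSup (fun k => ‖fderiv ℝ f z (b k)‖ₑ) k).trans
      (le_sup_right.trans le_sup_left)).trans (h' z hz)
  · exact ((le_iSup₂ (f := fun k l => ‖fderiv ℝ (fun y => fderiv ℝ f y (b k)) z (b l)‖ₑ)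
      k l).trans le_sup_right).trans (h' z hz)

theorem c2NormMat_le {F : κ → κ → V → ℝ} (h : ∀ i j, C2Bound b S (F i j) K) :
    c2NormMat b S F ≤ ENNReal.ofReal K :=
  iSup_le fun i => iSup_le fun j => (h i j).c2Norm_le

theorem C2Bound.of_c2NormMat_le {F : κ → κ → V → ℝ} {i j : κ} (hf : ContDiffOn ℝ 2 (F i j) S)
    (hK : 0 ≤ K) (h : c2NormMat b S F ≤ ENNReal.ofReal K) : C2Bound b S (F i j) K :=
  C2Bound.of_c2Norm_le hf hK
    ((le_iSup₂ (f := fun i j => c2Norm b S (F i j)) i j).trans h)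

end Existence

/-! ### Pull-backs -/

section Pull

variable {m : ℕ} {V κ : Type*} [NormedAddCommGroup V] [NormedSpace ℝ V]

theorem contDiffOn_pullCoeff {b : κ → V} {g : FormField m} {U : Set (Eu (m + 1))} {S : Set V}
    {φ : V → Eu (m + 1)} (hS : IsOpen S) (hg : ContDiffOn ℝ ∞ g U) (hφ : ContDiffOn ℝ ∞ φ S)
    (hm : MapsTo φ S U) (i j : κ) : ContDiffOn ℝ ∞ (pullCoeff b g φ i j) S := by
  have h1 : ContDiffOn ℝ ∞ (fderiv ℝ φ) S := hφ.fderiv_of_isOpen hS (by simp)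
  exact ((hg.comp hφ hm).clm_apply (h1.clm_apply contDiffOn_const)).clm_apply
    (h1.clm_apply contDiffOn_const)

theorem pullCoeff_congr {b : κ → V} {g g' : FormField m} {φ : V → Eu (m + 1)} {i j : κ} {z : V}
    (h : g (φ z) = g' (φ z)) : pullCoeff b g φ i j z = pullCoeff b g' φ i j z := by
  simp only [pullCoeff, h]

/-- Differentiate `‖φ₁‖² = 1`. -/
theorem inner_fderiv_eq_zero {W : Set V} (hW : IsOpen W) {φ₁ : V → Eu (m + 1)}
    (hφ₁ : ContDiffOn ℝ ∞ φ₁ W) (h1 : ∀ x ∈ W, ‖φ₁ x‖ = 1) {x : V} (hx : x ∈ W) (v : V) :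
    inner ℝ (φ₁ x) (fderiv ℝ φ₁ x v) = 0 := by
  have hd := (hφ₁.differentiableOn (by simp)).differentiableAt (hW.mem_nhds hx)
  have e : EqOn (fun y => inner ℝ (φ₁ y) (φ₁ y)) (fun _ => (1 : ℝ)) W := fun y hy => by
    simp [h1 y hy]
  have h2 : fderiv ℝ (fun y => inner ℝ (φ₁ y) (φ₁ y)) x = 0 := by
    rw [(e.eventuallyEq_of_mem (hW.mem_nhds hx)).fderiv_eq]; simp
  have h3 := fderiv_inner_apply ℝ hd hd v
  rw [h2, real_inner_comm (φ₁ x)] at h3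
  simp only [zero_apply] at h3
  linarith

end Pull

theorem isOpen_modelSet (m : ℕ) (ξ : ℝ) : IsOpen (modelSet m ξ) :=
  Metric.isOpen_ball.prod isOpen_Ioo

theorem modelSet_mono (m : ℕ) {ξ ξ' : ℝ} (h : ξ' ≤ ξ) : modelSet m ξ' ⊆ modelSet m ξ :=
  prod_mono le_rfl (Ioo_subset_Ioo (by linarith) (by linarith))

theorem warpedMetric_apply {m : ℕ} (h : FormField m) {x : Eu (m + 1)} (hx : ‖x‖ = 1) {s : ℝ}
    (hs : 0 < s) (v w : Eu (m + 1)) :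
    warpedMetric h (s • x) v w =
      Real.sinh s ^ 2 * h x (s⁻¹ • (v - inner ℝ x v • x)) (s⁻¹ • (w - inner ℝ x w • x)) +
        inner ℝ x v * inner ℝ x w := by
  have hn : ‖s • x‖ = s := by rw [norm_smul, hx, Real.norm_of_nonneg hs.le, mul_one]
  have hx' : s⁻¹ • s • x = x := by rw [smul_smul, inv_mul_cancel₀ hs.ne', one_smul]
  simp [warpedMetric, hn, hx']

/-! ### Coefficients of metrics in radial charts. -/

section Radial

variable {m : ℕ} {ξ a : ℝ} {φ : Model m → Eu (m + 1)} {φ₁ : Eu m → Eu (m + 1)}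

/-- The map `φ` on `𝕋_ξ` has the form `φ (x, t) = (t + a) φ₁ x` with `φ₁` a smooth map to the
unit sphere and `t + a` positive. -/
structure IsRadialMap (ξ a : ℝ) (φ : Model m → Eu (m + 1)) (φ₁ : Eu m → Eu (m + 1)) : Prop where
  contDiffOn : ContDiffOn ℝ ∞ φ₁ (Metric.ball 0 1)
  norm_eq : ∀ x ∈ Metric.ball (0 : Eu m) 1, ‖φ₁ x‖ = 1
  pos : ∀ t ∈ Ioo (-(1 + ξ)) (1 + ξ), 0 < t + a
  eq : ∀ x t, (x, t) ∈ modelSet m ξ → φ (x, t) = (t + a) • φ₁ x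

theorem IsRadialMap.mono {ξ' : ℝ} (h : IsRadialMap ξ a φ φ₁) (hξ : ξ' ≤ ξ) :
    IsRadialMap ξ' a φ φ₁ :=
  ⟨h.contDiffOn, h.norm_eq, fun t ht => h.pos t (Ioo_subset_Ioo (by linarith) (by linarith) ht),
    fun x t hz => h.eq x t (modelSet_mono m hξ hz)⟩

theorem IsRadialMap.norm (h : IsRadialMap ξ a φ φ₁) {x : Eu m} {t : ℝ}
    (hz : (x, t) ∈ modelSet m ξ) : ‖φ (x, t)‖ = t + a := by
  rw [h.eq x t hz, norm_smul, h.norm_eq x hz.1, mul_one, Real.norm_of_nonneg (h.pos t hz.2).le]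

theorem IsRadialMap.hasFDerivAt (h : IsRadialMap ξ a φ φ₁) {x : Eu m} {t : ℝ}
    (hz : (x, t) ∈ modelSet m ξ) :
    HasFDerivAt φ ((t + a) • (fderiv ℝ φ₁ x).comp (ContinuousLinearMap.fst ℝ (Eu m) ℝ) +
      (ContinuousLinearMap.snd ℝ (Eu m) ℝ).smulRight (φ₁ x)) (x, t) := by
  have hd := ((h.contDiffOn.differentiableOn (by simp)).differentiableAt
    (Metric.isOpen_ball.mem_nhds hz.1)).hasFDerivAt
  have e1 : HasFDerivAt (fun z : Model m => φ₁ z.1)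
      ((fderiv ℝ φ₁ x).comp (ContinuousLinearMap.fst ℝ (Eu m) ℝ)) (x, t) :=
    HasFDerivAt.comp (f := Prod.fst) (x, t) hd hasFDerivAt_fst
  have e2 : HasFDerivAt (fun z : Model m => z.2 + a) (ContinuousLinearMap.snd ℝ (Eu m) ℝ) (x, t) :=
    hasFDerivAt_snd.add_const a
  refine (e2.smul e1).congr_of_eventuallyEq ?_
  filter_upwards [(isOpen_modelSet m ξ).mem_nhds hz] with z hz
  exact h.eq z.1 z.2 hz

theorem IsRadialMap.fderiv_some (h : IsRadialMap ξ a φ φ₁) {x : Eu m} {t : ℝ}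
    (hz : (x, t) ∈ modelSet m ξ) (i : Fin m) :
    fderiv ℝ φ (x, t) (modelBasis m (some i)) = (t + a) • fderiv ℝ φ₁ x (stdVec m i) := by
  rw [(h.hasFDerivAt hz).fderiv]
  simp [modelBasis, stdVec]

theorem IsRadialMap.fderiv_none (h : IsRadialMap ξ a φ φ₁) {x : Eu m} {t : ℝ}
    (hz : (x, t) ∈ modelSet m ξ) : fderiv ℝ φ (x, t) (modelBasis m none) = φ₁ x := by
  rw [(h.hasFDerivAt hz).fderiv]
  simp [modelBasis]

theorem IsRadialMap.inner_fderiv (h : IsRadialMap ξ a φ φ₁) {x : Eu m}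
    (hx : x ∈ Metric.ball (0 : Eu m) 1) (v : Eu m) : inner ℝ (φ₁ x) (fderiv ℝ φ₁ x v) = 0 :=
  inner_fderiv_eq_zero Metric.isOpen_ball h.contDiffOn h.norm_eq hx v

theorem IsRadialMap.pullCoeff_some_some (h : IsRadialMap ξ a φ φ₁) (g : FormField m) {x : Eu m}
    {t : ℝ} (hz : (x, t) ∈ modelSet m ξ) (i j : Fin m) :
    pullCoeff (modelBasis m) g φ (some i) (some j) (x, t) =
      (t + a) ^ 2 * g ((t + a) • φ₁ x) (fderiv ℝ φ₁ x (stdVec m i))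
        (fderiv ℝ φ₁ x (stdVec m j)) := by
  simp only [pullCoeff, h.fderiv_some hz, h.eq x t hz, map_smul, smul_apply, smul_eq_mul]
  ring

/-- The images of the first `m` basis vectors are tangent to the sphere of radius `t + a`, so the
radial term drops out and the factors `t + a` cancel; the coefficient splits into a function of `t`
and a function of `x`. -/
theorem IsRadialMap.pullCoeff_warpedMetric (h : IsRadialMap ξ a φ φ₁) (k : FormField m) {x : Eu m}
    {t : ℝ} (hz : (x, t) ∈ modelSet m ξ) (i j : Fin m) :
    pullCoeff (modelBasis m) (warpedMetric k) φ (some i) (some j) (x, t) =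
      Real.sinh (t + a) ^ 2 * pullCoeff (stdVec m) k φ₁ i j x := by
  have hp := h.pos t hz.2
  rw [h.pullCoeff_some_some _ hz, warpedMetric_apply _ (h.norm_eq x hz.1) hp,
    h.inner_fderiv hz.1, h.inner_fderiv hz.1]
  simp only [zero_smul, sub_zero, map_smul, smul_apply, smul_eq_mul, pullCoeff]
  field_simp
  ring

theorem IsRadialMap.pullCoeff_sphericalCut (h : IsRadialMap ξ a φ φ₁) (g : FormField m) {x : Eu m}
    {l : ℝ} (hz : (x, l - a) ∈ modelSet m ξ) (i j : Fin m) :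
    pullCoeff (stdVec m) (sphericalCut g l) φ₁ i j x =
      (Real.sinh l ^ 2)⁻¹ * pullCoeff (modelBasis m) g φ (some i) (some j) (x, l - a) := by
  rw [h.pullCoeff_some_some _ hz, sub_add_cancel]
  simp only [pullCoeff, sphericalCut, smul_apply, smul_eq_mul]
  ring

/-- The coefficients of a polar metric in a radial chart that involve the radial direction are
those of the model. -/
theorem IsRadialMap.pullCoeff_eq_modelCoeff (h : IsRadialMap ξ a φ φ₁) {g : FormField m}
    {U : Set (Eu (m + 1))} (hU : MapsTo φ (modelSet m ξ) U) (hpol : IsPolarOn U g)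
    (hsymm : ∀ y ∈ U, ∀ v w, g y v w = g y w v) {i j : Option (Fin m)} (hij : i = none ∨ j = none)
    {z : Model m} (hz : z ∈ modelSet m ξ) :
    pullCoeff (modelBasis m) g φ i j z = modelCoeff m i j z := by
  obtain ⟨x, t⟩ := z
  have hp := h.pos t hz.2
  have key : ∀ v, g (φ (x, t)) (φ₁ x) v = inner ℝ (φ₁ x) v := fun v => by
    have h1 := hpol _ (hU hz) v
    have h2 : φ₁ x = (t + a)⁻¹ • φ (x, t) := by
      rw [h.eq x t hz, smul_smul, inv_mul_cancel₀ hp.ne', one_smul]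
    rw [h2, map_smul, smul_apply, h1, inner_smul_left]
    simp
  have hnn : ∀ j, g (φ (x, t)) (φ₁ x) (fderiv ℝ φ (x, t) (modelBasis m j)) =
      modelCoeff m none j (x, t) := fun j => by
    rw [key]
    cases j with
    | none =>
      rw [h.fderiv_none hz, real_inner_self_eq_norm_sq, h.norm_eq x hz.1]
      simp [modelCoeff, modelBasis]
    | some j =>
      rw [h.fderiv_some hz, inner_smul_right, h.inner_fderiv hz.1]
      simp [modelCoeff, modelBasis]
  have hms : ∀ i j, modelCoeff m i j (x, t) = modelCoeff m j i (x, t) := fun i j => by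
    simp only [modelCoeff, real_inner_comm (modelBasis m i).1, mul_comm (modelBasis m i).2]
  rcases hij with rfl | rfl
  · rw [← hnn, pullCoeff, h.fderiv_none hz]
  · rw [hms, ← hnn, pullCoeff, h.fderiv_none hz, hsymm _ (hU hz)]

/-- Taking norms at `φ 0 = p` identifies the radial shift with `‖p‖`. The definition of a chart does
not ask `φ₁` to be smooth; this is recovered from the slice `t = 0`, where `φ₁ = ‖p‖⁻¹ • φ`. -/
theorem IsRadialChart.exists_isRadialMap {U : Set (Eu (m + 1))} {p : Eu (m + 1)} (hξ : -1 < ξ)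
    (h : IsRadialChart U ξ p φ) : ∃ φ₁, IsRadialMap ξ ‖p‖ φ φ₁ := by
  obtain ⟨hs, -, -, -, hp, φ₁, a, ha⟩ := h
  have h0 : (0 : ℝ) ∈ Ioo (-(1 + ξ)) (1 + ξ) := ⟨by linarith, by linarith⟩
  have hx0 : (0 : Eu m) ∈ Metric.ball (0 : Eu m) 1 := by simp
  obtain ⟨e1, e2, e3⟩ := ha 0 0 ⟨hx0, h0⟩
  have hap : a = ‖p‖ := by
    rw [← hp, show (0 : Model m) = (0, 0) from rfl, e3, norm_smul, e1, Real.norm_of_nonneg e2.le]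
    simp
  subst hap
  rw [zero_add] at e2
  refine ⟨φ₁, ?_, fun x hx => (ha x 0 ⟨hx, h0⟩).1, fun t ht => (ha 0 t ⟨hx0, ht⟩).2.1,
    fun x t hz => (ha x t hz).2.2⟩
  have : ContDiffOn ℝ ∞ (fun x => ‖p‖⁻¹ • φ (x, 0)) (Metric.ball (0 : Eu m) 1) :=
    contDiffOn_const.fun_smul (hs.comp (f := fun x => (x, (0 : ℝ)))
      (contDiff_id.prodMk contDiff_const).contDiffOn fun x hx => ⟨hx, h0⟩)
  refine this.congr fun x hx => ?_
  rw [(ha x 0 ⟨hx, h0⟩).2.2, zero_add, smul_smul, inv_mul_cancel₀ e2.ne', one_smul]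

theorem IsRadialChart.restrict {U U' : Set (Eu (m + 1))} {p : Eu (m + 1)} {ξ' : ℝ} (hξ : ξ' ≤ ξ)
    (hU : U ⊆ U') (h : IsRadialChart U ξ p φ) : IsRadialChart U' ξ' p φ := by
  have hs := modelSet_mono m hξ
  obtain ⟨h1, h2, h3, h4, h5, φ₁, a, ha⟩ := h
  exact ⟨h1.mono hs, h2.mono hs, fun z hz => h3 z (hs hz), fun z hz => hU (h4 (hs hz)), h5, φ₁, a,
    fun x t hz => ha x t (hs hz)⟩

end Radial

/-! ### Hyperbolic forcing produces polar metrics -/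

section Forms

variable {m : ℕ}

/-- `B` is a value at `y` of a polar Riemannian metric. -/
structure IsPolarForm (y : Eu (m + 1)) (B : Eu (m + 1) →L[ℝ] Eu (m + 1) →L[ℝ] ℝ) : Prop where
  symm : ∀ v w, B v w = B w v
  pos : ∀ v, v ≠ 0 → 0 < B v v
  polar : ∀ v, B y v = inner ℝ y v

/-- `B` restricts to an inner product on the orthogonal complement of `x`. -/
structure IsTangentForm (x : Eu (m + 1)) (B : Eu (m + 1) →L[ℝ] Eu (m + 1) →L[ℝ] ℝ) : Prop where
  symm : ∀ v w, inner ℝ x v = 0 → inner ℝ x w = 0 → B v w = B w v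
  pos : ∀ v, inner ℝ x v = 0 → v ≠ 0 → 0 < B v v

theorem sub_smul_add_smul_zero {s : ℝ} (hs : s = 0)
    (A B : Eu (m + 1) →L[ℝ] Eu (m + 1) →L[ℝ] ℝ) : (1 - s) • A + s • B = A := by
  ext; simp [hs]

theorem sub_smul_add_smul_one {s : ℝ} (hs : s = 1)
    (A B : Eu (m + 1) →L[ℝ] Eu (m + 1) →L[ℝ] ℝ) : (1 - s) • A + s • B = B := by
  ext; simp [hs]

theorem convexCombination_pos {s p q : ℝ} (hs : s ∈ Icc (0 : ℝ) 1) (hp : 0 < p)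
    (hq : s ≠ 0 → 0 < q) : 0 < (1 - s) * p + s * q := by
  rcases hs.1.eq_or_lt' with rfl | h0
  · simpa using hp
  · have h1 := mul_pos h0 (hq h0.ne')
    have h2 := mul_nonneg (sub_nonneg.2 hs.2) hp.le
    linarith

/-- The second form is only assumed polar where its weight is nonzero, since `g` is uncontrolled
near the center, where the cutoff vanishes. -/
theorem IsPolarForm.convexCombination {y : Eu (m + 1)}
    {A B : Eu (m + 1) →L[ℝ] Eu (m + 1) →L[ℝ] ℝ} {s : ℝ} (hs : s ∈ Icc (0 : ℝ) 1)
    (hA : IsPolarForm y A) (hB : s ≠ 0 → IsPolarForm y B) :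
    IsPolarForm y ((1 - s) • A + s • B) := by
  refine ⟨fun v w => ?_, fun v hv => ?_, fun v => ?_⟩
  · simp only [add_apply, smul_apply, smul_eq_mul, hA.symm v w]
    rcases eq_or_ne s 0 with rfl | h0
    · simp
    · rw [(hB h0).symm v w]
  · exact convexCombination_pos hs (hA.pos v hv) fun h0 => (hB h0).pos v hv
  · simp only [add_apply, smul_apply, smul_eq_mul, hA.polar]
    rcases eq_or_ne s 0 with rfl | h0
    · simp
    · rw [(hB h0).polar]; ring

theorem exists_polar_coordinates {y : Eu (m + 1)} (hy : y ≠ 0) :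
    ∃ x : Eu (m + 1), ‖x‖ = 1 ∧ y = ‖y‖ • x := by
  have h := norm_pos_iff.2 hy
  refine ⟨‖y‖⁻¹ • y, ?_, ?_⟩
  · rw [norm_smul, norm_inv, norm_norm, inv_mul_cancel₀ h.ne']
  · rw [smul_smul, mul_inv_cancel₀ h.ne', one_smul]

theorem isPolarForm_warpedMetric {k : FormField m} (hk : ∀ x, ‖x‖ = 1 → IsTangentForm x (k x))
    {y : Eu (m + 1)} (hy : y ≠ 0) : IsPolarForm y (warpedMetric k y) := by
  obtain ⟨x, hx, hyx⟩ := exists_polar_coordinates hy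
  have hs := norm_pos_iff.2 hy
  set s := ‖y‖
  have hxx : inner ℝ x x = (1 : ℝ) := by rw [real_inner_self_eq_norm_sq, hx, one_pow]
  have ht : ∀ v, inner ℝ x (s⁻¹ • (v - inner ℝ x v • x)) = (0 : ℝ) := fun v => by
    rw [inner_smul_right, inner_sub_right, inner_smul_right, hxx]; simp
  rw [hyx]
  refine ⟨fun v w => ?_, fun v hv => ?_, fun v => ?_⟩
  · rw [warpedMetric_apply _ hx hs, warpedMetric_apply _ hx hs, (hk x hx).symm _ _ (ht v) (ht w),
      mul_comm (inner ℝ x v)]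
  · rw [warpedMetric_apply _ hx hs]
    have h2 : 0 < Real.sinh s ^ 2 := pow_pos (Real.sinh_pos_iff.2 hs) 2
    -- If the tangential part vanishes, `v` is a nonzero multiple of `x` and the radial term is
    -- positive; otherwise the spherical term is.
    by_cases h : s⁻¹ • (v - inner ℝ x v • x) = 0
    · rw [h]
      have h3 : v = inner ℝ x v • x :=
        sub_eq_zero.1 ((smul_eq_zero.1 h).resolve_left (inv_ne_zero hs.ne'))
      have h4 : inner ℝ x v ≠ (0 : ℝ) := fun h0 => hv (by rw [h3, h0, zero_smul])
      have := mul_self_pos.2 h4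
      simpa using this
    · have := mul_pos h2 ((hk x hx).pos _ (ht v) h)
      have := mul_self_nonneg (inner ℝ x v : ℝ)
      linarith
  · rw [warpedMetric_apply _ hx hs]
    simp [inner_smul_left, inner_smul_right, hx]

theorem isTangentForm_round (x : Eu (m + 1)) : IsTangentForm x (roundMetric m x) := by
  refine ⟨fun v w _ _ => ?_, fun v _ hv => ?_⟩
  · exact real_inner_comm w v
  · exact real_inner_self_pos.2 hv

theorem isTangentForm_sphericalCut {g : FormField m} {x : Eu (m + 1)} {l : ℝ} (hl : 0 < l)
    (hsymm : ∀ v w, g (l • x) v w = g (l • x) w v) (hpos : ∀ v, v ≠ 0 → 0 < g (l • x) v v) :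
    IsTangentForm x (sphericalCut g l x) := by
  have h : 0 < l ^ 2 / Real.sinh l ^ 2 := div_pos (pow_pos hl 2) (pow_pos (Real.sinh_pos_iff.2 hl) 2)
  refine ⟨fun v w _ _ => ?_, fun v _ hv => ?_⟩
  · simp only [sphericalCut, smul_apply, hsymm v w]
  · simp only [sphericalCut, smul_apply, smul_eq_mul]
    exact mul_pos h (hpos v hv)

theorem smul_mem_outerRegion {x : Eu (m + 1)} (hx : ‖x‖ = 1) {a l : ℝ} (hl : 0 < l) (hal : a < l) :
    l • x ∈ outerRegion m a := by
  have : ‖l • x‖ = l := by rw [norm_smul, hx, mul_one, Real.norm_of_nonneg hl.le]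
  exact ⟨norm_pos_iff.1 (by rw [this]; exact hl), by rw [this]; exact hal⟩

theorem IsMetricOn.isTangentForm_sphericalCut {g : FormField m} {a l : ℝ} (hl : 0 < l)
    (hal : a < l) (hg : IsMetricOn (outerRegion m a) g) {x : Eu (m + 1)} (hx : ‖x‖ = 1) :
    IsTangentForm x (sphericalCut g l x) :=
  HypForcing.isTangentForm_sphericalCut hl (hg.2.1 _ (smul_mem_outerRegion hx hl hal))
    (hg.2.2 _ (smul_mem_outerRegion hx hl hal))

theorem isOpen_outerRegion (a : ℝ) : IsOpen (outerRegion m a) :=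
  isOpen_ne.inter (isOpen_lt continuous_const continuous_norm)

end Forms

/-! ### Smoothness away from the center. -/

section Smoothness

variable {m : ℕ}

theorem contDiffOn_real_smul {V F : Type*} [NormedAddCommGroup V] [NormedSpace ℝ V]
    [NormedAddCommGroup F] [NormedSpace ℝ F] {u : V → ℝ} {f : V → F} {S : Set V}
    (hu : ContDiffOn ℝ ∞ u S) (hf : ContDiffOn ℝ ∞ f S) :
    ContDiffOn ℝ ∞ (fun y => u y • f y) S := hu.fun_smul hf

theorem contDiffAt_convexCombination {V F : Type*} [NormedAddCommGroup V] [NormedSpace ℝ V]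
    [NormedAddCommGroup F] [NormedSpace ℝ F] {u : V → ℝ} {f g : V → F} {y : V}
    (hu : ContDiffAt ℝ ∞ u y) (hf : ContDiffAt ℝ ∞ f y) (hg : ContDiffAt ℝ ∞ g y) :
    ContDiffAt ℝ ∞ (fun y => (1 - u y) • f y + u y • g y) y :=
  ((contDiffAt_const.sub hu).fun_smul hf).add (hu.fun_smul hg)

theorem contDiffOn_norm_compl : ContDiffOn ℝ ∞ (fun y : Eu (m + 1) => ‖y‖) {0}ᶜ :=
  fun _ hy => (contDiffAt_norm ℝ hy).contDiffWithinAt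

theorem contDiffOn_normalize :
    ContDiffOn ℝ ∞ (fun y : Eu (m + 1) => ‖y‖⁻¹ • y) {0}ᶜ :=
  (contDiffOn_norm_compl.inv fun _ hy => norm_ne_zero_iff.2 hy).fun_smul contDiffOn_id

theorem contDiffOn_warpedMetric {k : FormField m}
    (hk : ContDiffOn ℝ ∞ (fun y => k (‖y‖⁻¹ • y)) {0}ᶜ) :
    ContDiffOn ℝ ∞ (warpedMetric k) {0}ᶜ := by
  have hn := contDiffOn_norm_compl (m := m)
  have hx := contDiffOn_normalize (m := m)
  have hi : ContDiffOn ℝ ∞ (fun y : Eu (m + 1) => ‖y‖⁻¹) {0}ᶜ :=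
    hn.inv fun _ hy => norm_ne_zero_iff.2 hy
  rw [contDiffOn_clm_apply]
  intro v
  rw [contDiffOn_clm_apply]
  intro w
  have hin : ∀ v : Eu (m + 1), ContDiffOn ℝ ∞ (fun y : Eu (m + 1) => inner ℝ (‖y‖⁻¹ • y) v) {0}ᶜ :=
    fun v => hx.inner ℝ contDiffOn_const
  have hL : ∀ v : Eu (m + 1), ContDiffOn ℝ ∞
      (fun y : Eu (m + 1) => ‖y‖⁻¹ • (v - (inner ℝ (‖y‖⁻¹ • y) v : ℝ) • ‖y‖⁻¹ • y)) {0}ᶜ := fun v =>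
    hi.fun_smul (contDiffOn_const.sub ((hin v).fun_smul hx))
  have hs : ContDiffOn ℝ ∞ (fun y : Eu (m + 1) => Real.sinh ‖y‖ ^ 2) {0}ᶜ :=
    (Real.contDiff_sinh.comp_contDiffOn hn).pow 2
  have := (hs.mul ((hk.clm_apply (hL v)).clm_apply (hL w))).add ((hin v).mul (hin w))
  exact this

theorem contDiffOn_sphericalCut_normalize {g : FormField m} {a l : ℝ} (hl : 0 < l) (hal : a < l)
    (hg : ContDiffOn ℝ ∞ g (outerRegion m a)) :
    ContDiffOn ℝ ∞ (fun y => sphericalCut g l (‖y‖⁻¹ • y)) {0}ᶜ := by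
  refine contDiffOn_real_smul contDiffOn_const (hg.comp (contDiffOn_const.fun_smul contDiffOn_normalize)
    fun y hy => smul_mem_outerRegion ?_ hl hal)
  rw [norm_smul, norm_inv, norm_norm, inv_mul_cancel₀ (norm_ne_zero_iff.2 hy)]

theorem hyperbolicMetric_of_ne {y : Eu (m + 1)} (hy : y ≠ 0) :
    hyperbolicMetric m y = warpedMetric (roundMetric m) y := if_neg hy

theorem contDiffOn_hyperbolicMetric : ContDiffOn ℝ ∞ (hyperbolicMetric m) {0}ᶜ :=
  (contDiffOn_warpedMetric (k := roundMetric m) contDiffOn_const).congr fun _ hy =>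
    hyperbolicMetric_of_ne hy

end Smoothness

/-! ### Regions where forcing is explicit; polarity and smoothness of the result. -/

section Forcing

variable {m : ℕ} {ρW ρT : ℝ → ℝ} {g : FormField m} {a l d : ℝ}

theorem warpForcing_of_le (hρ : IsWarpCutoff ρW) {y : Eu (m + 1)} (hy : ‖y‖ ≤ l) :
    warpForcing ρW l g y = warpedMetric (sphericalCut g l) y := by
  obtain ⟨-, -, δ, hδ, h0, -⟩ := hρ
  rw [warpForcing]
  exact sub_smul_add_smul_zero (h0 (‖y‖ - l) (by linarith)) _ _

theorem warpForcing_of_ge (hρ : IsWarpCutoff ρW) {y : Eu (m + 1)} (hy : l + 1 / 2 ≤ ‖y‖) :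
    warpForcing ρW l g y = g y := by
  obtain ⟨-, -, δ, hδ, -, h1⟩ := hρ
  rw [warpForcing]
  exact sub_smul_add_smul_one (h1 (‖y‖ - l) (by linarith)) _ _

theorem warpingTrick_of_le (hρ : IsTrickCutoff ρT) (hd : 0 < d) {y : Eu (m + 1)} (hy : ‖y‖ ≤ a) :
    warpingTrick ρT a d g y = hyperbolicMetric m y := by
  have : 2 * ((‖y‖ - a) / d) ≤ 0 :=
    mul_nonpos_of_nonneg_of_nonpos (by norm_num) (div_nonpos_of_nonpos_of_nonneg (by linarith) hd.le)
  rw [warpingTrick]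
  exact sub_smul_add_smul_zero (hρ.2.2.1 _ this) _ _

theorem warpingTrick_of_ge (hρ : IsTrickCutoff ρT) (hd : 0 < d) {y : Eu (m + 1)}
    (hy : a + d / 2 ≤ ‖y‖) : warpingTrick ρT a d g y = g y := by
  have : 1 ≤ 2 * ((‖y‖ - a) / d) := by
    rw [← mul_div_assoc, le_div_iff₀ hd]; linarith
  rw [warpingTrick]
  exact sub_smul_add_smul_one (hρ.2.2.2 _ this) _ _

theorem isPolarForm_warpForcing (hρ : IsWarpCutoff ρW) (hl : 0 < l) (hal : a < l)
    (hg : IsMetricOn (outerRegion m a) g) (hp : IsPolarOn (outerRegion m a) g) {y : Eu (m + 1)}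
    (hy : y ≠ 0) : IsPolarForm y (warpForcing ρW l g y) := by
  refine IsPolarForm.convexCombination (hρ.2.1 _)
    (isPolarForm_warpedMetric (fun x hx => hg.isTangentForm_sphericalCut hl hal hx) hy)
    fun h0 => ?_
  obtain ⟨-, -, δ, hδ, h1, -⟩ := hρ
  have hly : l < ‖y‖ := by
    by_contra h
    exact h0 (h1 _ (by linarith))
  have hyU : y ∈ outerRegion m a := ⟨hy, hal.trans hly⟩
  exact ⟨hg.2.1 y hyU, hg.2.2 y hyU, hp y hyU⟩

theorem isPolarForm_hyperbolicForcing (hρW : IsWarpCutoff ρW) (hρT : IsTrickCutoff ρT)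
    (hl : 0 < l) (hal : a < l) (hg : IsMetricOn (outerRegion m a) g)
    (hp : IsPolarOn (outerRegion m a) g) {y : Eu (m + 1)} (hy : y ≠ 0) :
    IsPolarForm y (hyperbolicForcing ρW ρT l d g y) := by
  refine IsPolarForm.convexCombination (hρT.2.1 _) ?_
    fun _ => isPolarForm_warpForcing hρW hl hal hg hp hy
  rw [hyperbolicMetric_of_ne hy]
  exact isPolarForm_warpedMetric (fun x _ => isTangentForm_round x) hy

theorem contDiffOn_warpForcing (hρ : IsWarpCutoff ρW) (hl : 0 < l) (hal : a < l)
    (hg : ContDiffOn ℝ ∞ g (outerRegion m a)) : ContDiffOn ℝ ∞ (warpForcing ρW l g) {0}ᶜ := by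
  have hw := contDiffOn_warpedMetric (contDiffOn_sphericalCut_normalize hl hal hg)
  have hρ' : ContDiffOn ℝ ∞ (fun y : Eu (m + 1) => ρW (‖y‖ - l)) {0}ᶜ :=
    hρ.1.comp_contDiffOn (contDiffOn_norm_compl.sub contDiffOn_const)
  obtain ⟨-, -, δ, hδ, h0, -⟩ := hρ
  intro y hy
  have hopen : IsOpen ({0}ᶜ : Set (Eu (m + 1))) := isOpen_compl_singleton
  have hnhds := hopen.mem_nhds hy
  refine ContDiffAt.contDiffWithinAt ?_
  -- The cutoff vanishes up to `l + δ`, so the open set `‖y‖ < l + δ` sees only the warped metric;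
  -- elsewhere `y` lies in the region where `g` is smooth.
  rcases lt_or_ge ‖y‖ (l + δ) with h | h
  · refine (hw.contDiffAt hnhds).congr_of_eventuallyEq ?_
    filter_upwards [(isOpen_lt continuous_norm continuous_const).mem_nhds h] with z hz
    have hz' : ‖z‖ < l + δ := hz
    rw [warpForcing]
    exact sub_smul_add_smul_zero (h0 (‖z‖ - l) (by linarith)) _ _
  · have hyU : y ∈ outerRegion m a := ⟨hy, by linarith⟩
    have c1 := hρ'.contDiffAt hnhds
    exact contDiffAt_convexCombination c1 (hw.contDiffAt hnhds)
      (hg.contDiffAt ((isOpen_outerRegion a).mem_nhds hyU))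

theorem contDiffOn_hyperbolicForcing (hρW : IsWarpCutoff ρW) (hρT : IsTrickCutoff ρT) (hl : 0 < l)
    (hal : a < l) (hg : ContDiffOn ℝ ∞ g (outerRegion m a)) :
    ContDiffOn ℝ ∞ (hyperbolicForcing ρW ρT l d g) {0}ᶜ := by
  have c1 : ContDiffOn ℝ ∞ (fun y : Eu (m + 1) => ρT (2 * ((‖y‖ - (l - d)) / d))) {0}ᶜ :=
    hρT.1.comp_contDiffOn
      (contDiffOn_const.mul ((contDiffOn_norm_compl.sub contDiffOn_const).div_const d))
  intro y hy
  have hnhds := isOpen_compl_singleton.mem_nhds hy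
  exact (contDiffAt_convexCombination (c1.contDiffAt hnhds)
    (contDiffOn_hyperbolicMetric.contDiffAt hnhds)
    ((contDiffOn_warpForcing hρW hl hal hg).contDiffAt hnhds)).contDiffWithinAt

theorem isMetricOn_hyperbolicForcing (hρW : IsWarpCutoff ρW) (hρT : IsTrickCutoff ρT)
    (hl : 0 < l) (hal : a < l) (hg : IsMetricOn (outerRegion m a) g)
    (hp : IsPolarOn (outerRegion m a) g) :
    IsMetricOn {0}ᶜ (hyperbolicForcing ρW ρT l d g) ∧
      IsPolarOn {0}ᶜ (hyperbolicForcing ρW ρT l d g) :=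
  ⟨⟨contDiffOn_hyperbolicForcing hρW hρT hl hal hg.1,
    fun _ hy => (isPolarForm_hyperbolicForcing hρW hρT hl hal hg hp hy).symm,
    fun _ hy => (isPolarForm_hyperbolicForcing hρW hρT hl hal hg hp hy).pos⟩,
    fun _ hy => (isPolarForm_hyperbolicForcing hρW hρT hl hal hg hp hy).polar⟩

end Forcing

/-! ### Gram matrices and coercivity -/

section Gram

variable {m : ℕ}

theorem exists_uniform {ι : Type*} [Finite ι] {P : ι → ℝ → Prop}
    (hmono : ∀ i a b, a ≤ b → P i a → P i b) (h : ∀ i, ∃ c, P i c) : ∃ c, 0 < c ∧ ∀ i, P i c := by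
  have := Fintype.ofFinite ι
  choose c hc using h
  refine ⟨1 + ∑ i, |c i|, by positivity, fun i => hmono i _ _ ?_ (hc i)⟩
  have := Finset.single_le_sum (f := fun i => |c i|) (fun i _ => abs_nonneg _) (Finset.mem_univ i)
  linarith [le_abs_self (c i)]

/-- The matrix of the pull-back of `h` by `ψ` at `z`. -/
noncomputable def gram (h : FormField m) (ψ : Eu m → Eu (m + 1)) (z : Eu m) : Matrix (Fin m) (Fin m) ℝ :=
  Matrix.of fun k l => pullCoeff (stdVec m) h ψ k l z

theorem toLp_eq_sum (x : Fin m → ℝ) : WithLp.toLp 2 x = ∑ k, x k • stdVec m k := by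
  ext i
  simp [stdVec, Pi.single_apply]

open Matrix in
theorem dotProduct_gram_mulVec (h : FormField m) (ψ : Eu m → Eu (m + 1)) (z : Eu m)
    (x : Fin m → ℝ) : x ⬝ᵥ (gram h ψ z *ᵥ x) =
      h (ψ z) (fderiv ℝ ψ z (WithLp.toLp 2 x)) (fderiv ℝ ψ z (WithLp.toLp 2 x)) := by
  rw [toLp_eq_sum]
  simp only [map_sum, map_smul, _root_.sum_apply, _root_.smul_apply, smul_eq_mul, dotProduct, mulVec, gram,
    Matrix.of_apply, pullCoeff]
  simp only [Finset.mul_sum]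
  rw [Finset.sum_comm]
  exact Finset.sum_congr rfl fun k _ => Finset.sum_congr rfl fun l _ => by ring

/-- The derivative of `ψ` maps injectively into the tangent space of the sphere, on which `h` is an
inner product. -/
theorem posDef_gram {h : FormField m} {W : Set (Eu m)} {ψ : Eu m → Eu (m + 1)} (hW : IsOpen W)
    (hψ : ContDiffOn ℝ ∞ ψ W) (hm : MapsTo ψ W (Metric.sphere 0 1)) {z : Eu m} (hz : z ∈ W)
    (hinj : Function.Injective (fderiv ℝ ψ z)) (hh : IsTangentForm (ψ z) (h (ψ z))) :
    (gram h ψ z).PosDef := by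
  have ht : ∀ v, inner ℝ (ψ z) (fderiv ℝ ψ z v) = (0 : ℝ) := fun v =>
    inner_fderiv_eq_zero hW hψ (fun x hx => by simpa using hm hx) hz v
  refine Matrix.PosDef.of_dotProduct_mulVec_pos ?_ fun x hx => ?_
  · ext k l
    exact hh.symm _ _ (ht _) (ht _)
  · rw [show star x = x from rfl, dotProduct_gram_mulVec]
    refine hh.pos _ (ht _) fun h0 => hx ?_
    have := hinj (h0.trans (map_zero _).symm)
    simpa using this

theorem isClosed_setOf_forall {X ι : Type*} [TopologicalSpace X] {P : ι → X → Prop}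
    (h : ∀ i, IsClosed {x | P i x}) : IsClosed {x | ∀ i, P i x} := by
  rw [show {x | ∀ i, P i x} = ⋂ i, {x | P i x} by ext; simp]
  exact isClosed_iInter h

open Matrix in
/-- Positive semidefinite matrices with bounded entries, whose determinants are bounded away from
zero, are uniformly coercive. -/
theorem exists_coercive (m : ℕ) {c : ℝ} (hc : 0 < c) : ∃ κ, 0 < κ ∧
    ∀ M : Matrix (Fin m) (Fin m) ℝ, M.PosSemidef → (∀ i j, |M i j| ≤ c) → 1 / c ≤ |M.det| →
      ∀ x : Fin m → ℝ, κ * (x ⬝ᵥ x) ≤ x ⬝ᵥ (M *ᵥ x) := by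
  -- Pairs of an admissible matrix and a unit vector. Semidefiniteness is a closed condition, unlike
  -- definiteness, so `Q` is compact; the determinant bound then upgrades it to definiteness, and
  -- the quadratic form has a positive minimum on `Q`.
  let Q : Set ((Fin m → Fin m → ℝ) × (Fin m → ℝ)) :=
    {p | (∀ i j, |p.1 i j| ≤ c) ∧ (∀ i j, p.1 i j = p.1 j i) ∧
      (∀ x : Fin m → ℝ, 0 ≤ x ⬝ᵥ (Matrix.of p.1 *ᵥ x)) ∧ 1 / c ≤ |(Matrix.of p.1).det| ∧
      p.2 ⬝ᵥ p.2 = 1}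
  have hcM : Continuous fun p : (Fin m → Fin m → ℝ) × (Fin m → ℝ) => Matrix.of p.1 :=
    continuous_fst
  have hclosed : IsClosed Q := by
    refine IsClosed.inter ?_ (IsClosed.inter ?_ (IsClosed.inter ?_ (IsClosed.inter ?_ ?_)))
    · exact isClosed_setOf_forall fun i => isClosed_setOf_forall fun j =>
        isClosed_le (by fun_prop) continuous_const
    · exact isClosed_setOf_forall fun i => isClosed_setOf_forall fun j =>
        isClosed_eq (by fun_prop) (by fun_prop)
    · exact isClosed_setOf_forall fun x => isClosed_le continuous_const
        (continuous_const.dotProduct (hcM.matrix_mulVec continuous_const))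
    · exact isClosed_le continuous_const hcM.matrix_det.abs
    · exact isClosed_eq (continuous_snd.dotProduct continuous_snd) continuous_const
  have hbdd : Bornology.IsBounded Q := by
    refine (Metric.isBounded_closedBall (x := (0 : (Fin m → Fin m → ℝ) × (Fin m → ℝ)))
      (r := c + 1)).subset fun p hp => ?_
    rw [mem_closedBall_zero_iff]
    refine norm_prod_le_iff.2 ⟨?_, ?_⟩
    · refine (pi_norm_le_iff_of_nonneg (by positivity)).2 fun i =>
        (pi_norm_le_iff_of_nonneg (by positivity)).2 fun j => ?_
      have := hp.1 i j
      rw [Real.norm_eq_abs]; linarith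
    · refine (pi_norm_le_iff_of_nonneg (by positivity)).2 fun i => ?_
      have h1 : p.2 i * p.2 i ≤ 1 := by
        rw [← hp.2.2.2.2]
        exact Finset.single_le_sum (f := fun i => p.2 i * p.2 i) (fun i _ => mul_self_nonneg _)
          (Finset.mem_univ i)
      have h2 : |p.2 i| ≤ 1 := abs_le_one_iff_mul_self_le_one.2 h1
      rw [Real.norm_eq_abs]; linarith
  have hcomp : IsCompact Q := Metric.isCompact_of_isClosed_isBounded hclosed hbdd
  have hcont : Continuous fun p : (Fin m → Fin m → ℝ) × (Fin m → ℝ) =>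
      p.2 ⬝ᵥ (Matrix.of p.1 *ᵥ p.2) :=
    continuous_snd.dotProduct (hcM.matrix_mulVec continuous_snd)
  obtain ⟨κ, hκ, hmin⟩ : ∃ κ : ℝ, 0 < κ ∧ ∀ p ∈ Q, κ ≤ p.2 ⬝ᵥ (Matrix.of p.1 *ᵥ p.2) := by
    -- `Q` can be empty, for instance when `m = 0` and there is no unit vector.
    rcases Q.eq_empty_or_nonempty with he | hne
    · exact ⟨1, one_pos, by simp [he]⟩
    · obtain ⟨p, hp, hmin⟩ := hcomp.exists_isMinOn hne hcont.continuousOn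
      refine ⟨_, ?_, hmin⟩
      have hsd : (Matrix.of p.1).PosSemidef :=
        Matrix.PosSemidef.of_dotProduct_mulVec_nonneg (by ext i j; exact hp.2.1 j i) hp.2.2.1
      have hpd : (Matrix.of p.1).PosDef := hsd.posDef_iff_det_ne_zero.2 fun h0 => by
        have := hp.2.2.2.1
        rw [h0, abs_zero] at this
        exact absurd this (not_le.2 (by positivity))
      refine hpd.dotProduct_mulVec_pos (x := p.2) fun h0 => ?_
      have := hp.2.2.2.2
      simp [h0] at this
  refine ⟨κ, hκ, fun M hM hMc hdet x => ?_⟩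
  rcases eq_or_ne x 0 with rfl | hx
  · simp
  have hxx : 0 < x ⬝ᵥ x := by
    obtain ⟨i, hi⟩ := Function.ne_iff.1 hx
    exact Finset.sum_pos' (fun i _ => mul_self_nonneg _) ⟨i, Finset.mem_univ i, mul_self_pos.2 hi⟩
  set s := Real.sqrt (x ⬝ᵥ x) with hs
  have hs0 : 0 < s := Real.sqrt_pos.2 hxx
  have hss : s * s = x ⬝ᵥ x := Real.mul_self_sqrt hxx.le
  have hmem : ((M : Fin m → Fin m → ℝ), s⁻¹ • x) ∈ Q := by
    refine ⟨hMc, fun i j => (hM.1.apply i j).symm, hM.dotProduct_mulVec_nonneg, hdet, ?_⟩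
    rw [dotProduct_smul, smul_dotProduct, ← hss, smul_eq_mul, smul_eq_mul]
    field_simp
  have h1 : κ ≤ (s⁻¹ • x) ⬝ᵥ (M *ᵥ (s⁻¹ • x)) := hmin _ hmem
  rw [mulVec_smul, dotProduct_smul, smul_dotProduct, smul_eq_mul, smul_eq_mul, ← mul_assoc,
    ← mul_inv, hss, inv_mul_eq_div, le_div_iff₀ hxx] at h1
  exact h1

open scoped MatrixOrder Matrix.Norms.L2Operator in
open Matrix in
/-- A coercive positive definite matrix has an orthonormalizing matrix with bounded entries. -/
theorem exists_orthonormalizing {M : Matrix (Fin m) (Fin m) ℝ} (hM : M.PosDef) {κ : ℝ} (hκ : 0 < κ)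
    (hco : ∀ x : Fin m → ℝ, κ * (x ⬝ᵥ x) ≤ x ⬝ᵥ (M *ᵥ x)) :
    ∃ T : Matrix (Fin m) (Fin m) ℝ, IsUnit T ∧ Tᵀ * M * T = 1 ∧ ∀ i j, |T i j| ≤ (Real.sqrt κ)⁻¹ := by
  -- Factor `M = Bᵀ B` with `B` invertible and take `T = B⁻¹`.
  obtain ⟨B, hB, hMB⟩ :=
    CStarAlgebra.isStrictlyPositive_iff_eq_star_mul_self.1 hM.isStrictlyPositive
  have hdet : IsUnit B.det := (Matrix.isUnit_iff_isUnit_det B).1 hB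
  have hT : (B⁻¹)ᵀ * M * B⁻¹ = 1 := by
    have h1 : star B = Bᵀ := by rw [star_eq_conjTranspose, conjTranspose_eq_transpose_of_trivial]
    rw [hMB, h1, Matrix.mul_assoc, Matrix.mul_assoc, Matrix.mul_nonsing_inv B hdet, Matrix.mul_one,
      ← Matrix.transpose_mul, Matrix.mul_nonsing_inv B hdet, Matrix.transpose_one]
  refine ⟨B⁻¹, (Matrix.isUnit_nonsing_inv_iff).2 hB, hT, fun i j => ?_⟩
  -- Each column of `T` has `M`-length one; by coercivity its squared Euclidean length is at most `1
  -- / κ`, which bounds every entry.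
  have h1 : (fun k => B⁻¹ k j) ⬝ᵥ (M *ᵥ fun k => B⁻¹ k j) = 1 := by
    have := congrFun (congrFun hT j) j
    rw [Matrix.mul_assoc, Matrix.one_apply_eq] at this
    exact this
  have h2 := hco fun k => B⁻¹ k j
  rw [h1] at h2
  have h3 : B⁻¹ i j * B⁻¹ i j ≤ (fun k => B⁻¹ k j) ⬝ᵥ (fun k => B⁻¹ k j) :=
    Finset.single_le_sum (f := fun k => B⁻¹ k j * B⁻¹ k j) (fun i _ => mul_self_nonneg _)
      (Finset.mem_univ i)
  have h4 : B⁻¹ i j ^ 2 ≤ ((Real.sqrt κ)⁻¹) ^ 2 := by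
    rw [inv_pow, Real.sq_sqrt hκ.le, inv_eq_one_div κ, le_div_iff₀ hκ]
    nlinarith
  exact abs_le_of_sq_le_sq h4 (by positivity)

end Gram

/-! ### Atlases of the sphere -/

section Atlas

variable {m : ℕ}

theorem SphereAtlas.dom_subset_ext (A : SphereAtlas m) (i : Fin A.N) : A.dom i ⊆ A.ext i :=
  subset_closure.trans (A.closure_subset i)

theorem SphereAtlas.norm_ψ (A : SphereAtlas m) {i : Fin A.N} {z : Eu m} (hz : z ∈ A.ext i) :
    ‖A.ψ i z‖ = 1 := by simpa using A.mapsTo i hz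

/-- Every point of the sphere lies in a chart domain at a distance bounded away from its
boundary. -/
theorem SphereAtlas.exists_lebesgue (A : SphereAtlas m) : ∃ δ, 0 < δ ∧
    ∀ x : Eu (m + 1), ‖x‖ = 1 → ∃ i z, A.ψ i z = x ∧ Metric.ball z δ ⊆ A.dom i := by
  let P : Set (Eu (m + 1)) → Prop := fun s => ∃ δ, 0 < δ ∧
    ∀ x ∈ s, ∃ i z, A.ψ i z = x ∧ Metric.ball z δ ⊆ A.dom i
  have hP : P (Metric.sphere 0 1) := by
    refine (isCompact_sphere _ _).induction_on (p := P) ⟨1, one_pos, by simp⟩ ?_ ?_ ?_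
    · rintro s t hst ⟨δ, hδ, h⟩
      exact ⟨δ, hδ, fun x hx => h x (hst hx)⟩
    · rintro s t ⟨δ, hδ, h⟩ ⟨δ', hδ', h'⟩
      refine ⟨min δ δ', lt_min hδ hδ', fun x hx => ?_⟩
      rcases hx with hx | hx
      · obtain ⟨i, z, hz, hb⟩ := h x hx
        exact ⟨i, z, hz, (Metric.ball_subset_ball (min_le_left _ _)).trans hb⟩
      · obtain ⟨i, z, hz, hb⟩ := h' x hx
        exact ⟨i, z, hz, (Metric.ball_subset_ball (min_le_right _ _)).trans hb⟩
    · intro x hx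
      obtain ⟨i, z, hz, rfl⟩ := mem_iUnion.1 (A.cover hx)
      obtain ⟨δ, hδ, hb⟩ := Metric.isOpen_iff.1 (A.isOpen_dom i) z hz
      obtain ⟨O, hO, hOd⟩ := A.isOpen_image i
      -- `R` is compact and, since `ψ i` is injective on `ext i`, misses the given point. Hence
      -- chart points near it that avoid `R` have coordinates in the half-size ball about `z`, and
      -- keep a margin `δ / 2`.
      set R : Set (Eu (m + 1)) := A.ψ i '' (closure (A.dom i) \ Metric.ball z (δ / 2)) with hR
      have hRc : IsClosed R := by
        refine (IsCompact.image_of_continuousOn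
          ((A.isCompact_closure i).diff Metric.isOpen_ball) ?_).isClosed
        exact (A.smooth i).continuousOn.mono (sdiff_subset.trans (A.closure_subset i))
      have hzR : A.ψ i z ∉ R := by
        rintro ⟨w, ⟨hw, hw'⟩, hwz⟩
        rw [A.injOn i (A.closure_subset i hw) (A.dom_subset_ext i hz) hwz] at hw'
        exact hw' (Metric.mem_ball_self (half_pos hδ))
      have hzO : A.ψ i z ∈ O := (hOd.subset (mem_image_of_mem _ hz)).1
      refine ⟨(O ∩ Rᶜ) ∩ Metric.sphere 0 1, ?_, δ / 2, half_pos hδ, ?_⟩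
      · rw [inter_comm]
        exact inter_mem_nhdsWithin _ ((hO.inter hRc.isOpen_compl).mem_nhds ⟨hzO, hzR⟩)
      · rintro y ⟨⟨hyO, hyR⟩, hyS⟩
        obtain ⟨w, hw, rfl⟩ := hOd.symm.subset ⟨hyO, hyS⟩
        refine ⟨i, w, rfl, fun v hv => hb ?_⟩
        have hwb : w ∈ Metric.ball z (δ / 2) := by
          by_contra h
          exact hyR ⟨w, ⟨subset_closure hw, h⟩, rfl⟩
        rw [Metric.mem_ball] at *
        linarith [dist_triangle v w z]
  obtain ⟨δ, hδ, h⟩ := hP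
  exact ⟨δ, hδ, fun x hx => h x (by simpa using hx)⟩

/-- `c` bounds the `C²` norm of `h` in the chart `i`, and `1 / c` is a lower bound for the
determinants. -/
def ChartBound (A : SphereAtlas m) (h : FormField m) (i : Fin A.N) (c : ℝ) : Prop :=
  0 < c ∧ (∀ k l, C2Bound (stdVec m) (A.dom i) (pullCoeff (stdVec m) h (A.ψ i) k l) c) ∧
    ∀ z ∈ A.dom i, 1 / c ≤ |(gram h (A.ψ i) z).det|

theorem ChartBound.mono {A : SphereAtlas m} {h : FormField m} {i : Fin A.N} {c c' : ℝ}
    (hb : ChartBound A h i c) (hc : c ≤ c') : ChartBound A h i c' :=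
  ⟨hb.1.trans_le hc, fun k l => (hb.2.1 k l).mono hc,
    fun z hz => (one_div_le_one_div_of_le hb.1 hc).trans (hb.2.2 z hz)⟩

theorem ChartBound.cBounded {A : SphereAtlas m} {h : FormField m} {c c' : ℝ}
    (hc : 0 < c) (hcc : c < c') (hb : ∀ i, ChartBound A h i c) : CBounded A c' h := by
  refine ⟨?_, fun i z hz => ?_⟩
  · refine lt_of_le_of_lt (iSup_le fun i => c2NormMat_le (hb i).2.1) ?_
    exact (ENNReal.ofReal_lt_ofReal_iff (hc.trans hcc)).2 hcc
  · exact (one_div_lt_one_div_of_lt hc hcc).trans_le ((hb i).2.2 z hz)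

theorem CBounded.chartBound {A : SphereAtlas m} {h : FormField m} {c : ℝ} (hc : 0 < c)
    (hs : ∀ i k l, ContDiffOn ℝ 2 (pullCoeff (stdVec m) h (A.ψ i) k l) (A.dom i))
    (hb : CBounded A c h) (i : Fin A.N) : ChartBound A h i c :=
  ⟨hc, fun k l => C2Bound.of_c2NormMat_le (hs i k l) hc.le
    ((le_iSup (fun i => c2NormMat (stdVec m) (A.dom i) (pullCoeff (stdVec m) h (A.ψ i))) i).trans
      hb.1.le), fun z hz => (hb.2 i z hz).le⟩

theorem IsC2SphereMetric.isTangentForm {h : FormField m} (hh : IsC2SphereMetric h)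
    {x : Eu (m + 1)} (hx : ‖x‖ = 1) : IsTangentForm x (h x) :=
  ⟨hh.1 x hx, hh.2.1 x hx⟩

theorem IsC2SphereMetric.exists_c2Bound {h : FormField m} (hh : IsC2SphereMetric h)
    (A : SphereAtlas m) (i : Fin A.N) : ∃ c, 0 < c ∧
      ∀ k l, C2Bound (stdVec m) (A.dom i) (pullCoeff (stdVec m) h (A.ψ i) k l) c := by
  have := exists_uniform (ι := Fin m × Fin m)
    (P := fun kl c => C2Bound (stdVec m) (A.dom i) (pullCoeff (stdVec m) h (A.ψ i) kl.1 kl.2) c)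
    (fun _ _ _ hab hP => hP.mono hab) fun kl => by
      obtain ⟨c, -, hc⟩ := HypForcing.exists_c2Bound (b := stdVec m) (A.isOpen_ext i)
        (hh.2.2 (A.ext i) (A.ψ i) (A.isOpen_ext i) (A.smooth i) (A.mapsTo i) kl.1 kl.2)
        (A.isCompact_closure i) (A.closure_subset i)
      exact ⟨c, hc.subset subset_closure⟩
  obtain ⟨c, hc, h⟩ := this
  exact ⟨c, hc, fun k l => h (k, l)⟩

/-- The determinants of matrices that are close to the Gram matrices of a metric are bounded away
from zero. -/
theorem IsC2SphereMetric.exists_det_bound {h : FormField m} (hh : IsC2SphereMetric h)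
    (A : SphereAtlas m) (i : Fin A.N) : ∃ c, 0 < c ∧ ∃ ε, 0 < ε ∧ ∀ z ∈ A.dom i,
      ∀ M : Matrix (Fin m) (Fin m) ℝ, (∀ k l, |M k l - gram h (A.ψ i) z k l| < ε) →
        c ≤ |M.det| := by
  let F : Eu m → Fin m → Fin m → ℝ := fun z k l => gram h (A.ψ i) z k l
  have hF : ContinuousOn F (closure (A.dom i)) :=
    continuousOn_pi.2 fun k => continuousOn_pi.2 fun l =>
      (hh.2.2 (A.ext i) (A.ψ i) (A.isOpen_ext i) (A.smooth i) (A.mapsTo i) k l).continuousOn.mono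
        (A.closure_subset i)
  have hdet : Continuous fun M : Fin m → Fin m → ℝ => |(Matrix.of M).det| :=
    (Continuous.matrix_det (A := fun M : Fin m → Fin m → ℝ => Matrix.of M) continuous_id).abs
  have hQ : IsCompact (F '' closure (A.dom i)) := (A.isCompact_closure i).image_of_continuousOn hF
  have hpos : ∀ M ∈ F '' closure (A.dom i), 0 < |(Matrix.of M).det| := by
    rintro _ ⟨z, hz, rfl⟩
    have hz' := A.closure_subset i hz
    exact abs_pos.2 ((posDef_gram (A.isOpen_ext i) (A.smooth i) (A.mapsTo i) hz'
      (A.immersion i z hz') (hh.isTangentForm (A.norm_ψ hz'))).det_pos.ne')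
  obtain ⟨c, hc, hmin⟩ : ∃ c : ℝ, 0 < c ∧ ∀ M ∈ F '' closure (A.dom i),
      2 * c ≤ |(Matrix.of M).det| := by
    rcases (F '' closure (A.dom i)).eq_empty_or_nonempty with he | hne
    · exact ⟨1, one_pos, by simp [he]⟩
    · obtain ⟨M, hM, hmin⟩ := hQ.exists_isMinOn hne hdet.continuousOn
      refine ⟨|(Matrix.of M).det| / 2, half_pos (hpos M hM), fun N hN => ?_⟩
      have : |(Matrix.of M).det| ≤ |(Matrix.of N).det| := hmin hN
      linarith
  have hsub : F '' closure (A.dom i) ⊆ {M | c < |(Matrix.of M).det|} := fun M hM => by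
    have := hmin M hM
    rw [mem_ofPred_eq]
    linarith
  -- The Gram matrices over the closed domain form a compact subset of the open set of matrices with
  -- `|det| > c`, so a whole `ε`-thickening stays inside.
  obtain ⟨ε, hε, hth⟩ := hQ.exists_thickening_subset_open
    (isOpen_lt continuous_const hdet : IsOpen {M | c < |(Matrix.of M).det|})
    hsub
  refine ⟨c, hc, ε, hε, fun z hz M hM => ?_⟩
  have hd : dist (fun k l => M k l : Fin m → Fin m → ℝ) (F z) < ε :=
    (dist_pi_lt_iff hε).2 fun k => (dist_pi_lt_iff hε).2 fun l => by
      rw [Real.dist_eq]; exact hM k l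
  have h3 := hth (Metric.mem_thickening_iff.2 ⟨F z, mem_image_of_mem F (subset_closure hz), hd⟩)
  rw [mem_ofPred_eq] at h3
  exact h3.le

theorem IsC2SphereMetric.exists_chartBound {h : FormField m} (hh : IsC2SphereMetric h)
    (A : SphereAtlas m) : ∃ c, 0 < c ∧ ∀ i, ChartBound A h i c := by
  refine exists_uniform (fun i a b hab hP => hP.mono hab) fun i => ?_
  obtain ⟨c, hc, h1⟩ := hh.exists_c2Bound A i
  obtain ⟨c', hc', ε, hε, h2⟩ := hh.exists_det_bound A i
  refine ⟨c + 1 / c', by positivity, fun k l => (h1 k l).mono ?_, fun z hz => ?_⟩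
  · have : 0 < 1 / c' := by positivity
    linarith
  · refine le_trans ?_ (h2 z hz _ fun k l => by simpa using hε)
    rw [div_le_iff₀ (by positivity), mul_add, mul_one_div_cancel hc'.ne']
    nlinarith

theorem isC2SphereMetric_round : IsC2SphereMetric (roundMetric m) := by
  refine ⟨fun x _ => (isTangentForm_round x).symm, fun x _ => (isTangentForm_round x).pos,
    fun W ψ hW hψ hm i j => ?_⟩
  exact (contDiffOn_pullCoeff (U := univ) hW contDiffOn_const hψ (mapsTo_univ _ _) i j).of_le
    (by norm_cast)

end Atlas

/-! ### Uniform bounds for the spherical cuts of a family -/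

section Family

variable {V : Type*} [NormedAddCommGroup V] [NormedSpace ℝ V] {W Q : Set V} {F : ℝ × V → ℝ}
  {l₀ L : ℝ}

theorem contDiffOn_slice (hF : ContDiffOn ℝ ∞ F (Ici l₀ ×ˢ W)) {l : ℝ} (hl : l₀ ≤ l) :
    ContDiffOn ℝ ∞ (fun y => F (l, y)) W :=
  hF.comp (f := fun y => (l, y)) (contDiff_const.prodMk contDiff_id).contDiffOn
    fun _ hy => ⟨hl, hy⟩

/-- The parameter interval has a boundary point, so joint smoothness is obtained from `fderivWithin`
on a set of unique differentiability. Restricting to vectors `(0, v)` gives the spatial derivative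
at fixed parameter; iterating bounds second derivatives uniformly in the parameter. -/
theorem contDiffOn_partial (hW : IsOpen W) (hF : ContDiffOn ℝ ∞ F (Ici l₀ ×ˢ W)) (v : V) :
    ContDiffOn ℝ ∞ (fun q : ℝ × V => fderiv ℝ (fun y => F (q.1, y)) q.2 v) (Ici l₀ ×ˢ W) := by
  have hU : UniqueDiffOn ℝ (Ici l₀ ×ˢ W) := (uniqueDiffOn_Ici l₀).prod hW.uniqueDiffOn
  have h1 : ContDiffOn ℝ ∞ (fderivWithin ℝ F (Ici l₀ ×ˢ W)) (Ici l₀ ×ˢ W) :=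
    hF.fderivWithin hU (by simp)
  refine (h1.clm_apply (contDiffOn_const (c := ((0 : ℝ), v)))).congr fun q hq => ?_
  obtain ⟨l, y⟩ := q
  have h2 := ((hF.differentiableOn (by simp)) (l, y) hq).hasFDerivWithinAt
  have h3 : HasFDerivWithinAt (fun y : V => (l, y)) (ContinuousLinearMap.inr ℝ ℝ V) W y :=
    (hasFDerivAt_prodMk_right l y).hasFDerivWithinAt
  have h4 := (HasFDerivWithinAt.comp (f := fun y : V => (l, y)) y h2 h3
    fun z hz => ⟨hq.1, hz⟩).hasFDerivAt (hW.mem_nhds hq.2)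
  have h5 : HasFDerivAt (fun y => F (l, y)) _ y := h4
  simp only
  rw [h5.fderiv]
  simp

theorem exists_c2Bound_family {κ : Type*} [Finite κ] {b : κ → V} (hW : IsOpen W)
    (hF : ContDiffOn ℝ ∞ F (Ici l₀ ×ˢ W)) (hQ : IsCompact Q) (hQW : Q ⊆ W) :
    ∃ K, 0 < K ∧ ∀ l ∈ Icc l₀ L, C2Bound b Q (fun y => F (l, y)) K := by
  have hcomp : IsCompact (Icc l₀ L ×ˢ Q) := isCompact_Icc.prod hQ
  have hsub : Icc l₀ L ×ˢ Q ⊆ Ici l₀ ×ˢ W := prod_mono Icc_subset_Ici_self hQW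
  have bd : ∀ {u : ℝ × V → ℝ}, ContDiffOn ℝ ∞ u (Ici l₀ ×ˢ W) →
      ∃ K, ∀ q ∈ Icc l₀ L ×ˢ Q, |u q| ≤ K := fun hu =>
    hcomp.exists_abs_le (hu.continuousOn.mono hsub)
  have d1 := fun k => contDiffOn_partial hW hF (b k)
  have d2 := fun k l => contDiffOn_partial hW (d1 k) (b l)
  obtain ⟨K0, h0⟩ := bd hF
  obtain ⟨K1, hK1, h1⟩ := exists_uniform
    (P := fun k c => ∀ q ∈ Icc l₀ L ×ˢ Q, |fderiv ℝ (fun y => F (q.1, y)) q.2 (b k)| ≤ c)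
    (fun _ _ _ hab h q hq => (h q hq).trans hab) (fun k => bd (d1 k))
  obtain ⟨K2, hK2, h2⟩ := exists_uniform (ι := κ × κ)
    (P := fun k c => ∀ q ∈ Icc l₀ L ×ˢ Q,
      |fderiv ℝ (fun y => fderiv ℝ (fun y => F (q.1, y)) y (b k.1)) q.2 (b k.2)| ≤ c)
    (fun _ _ _ hab h q hq => (h q hq).trans hab) (fun k => bd (d2 k.1 k.2))
  refine ⟨|K0| + K1 + K2, by positivity, fun l hl => ⟨?_, fun z hz => ?_, fun z hz k => ?_,
    fun z hz k j => ?_⟩⟩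
  · exact ((contDiffOn_slice hF hl.1).mono hQW).of_le (by norm_cast)
  · linarith [h0 (l, z) ⟨hl, hz⟩, le_abs_self K0]
  · linarith [h1 k (l, z) ⟨hl, hz⟩, abs_nonneg K0]
  · linarith [h2 (k, j) (l, z) ⟨hl, hz⟩, abs_nonneg K0]

end Family

section Cuts

variable {m : ℕ} {ξ l₀ : ℝ} {inn : ℝ → ℝ} {g : ℝ → FormField m}

theorem IsOdotFamily.inn_lt (hg : IsOdotFamily ξ l₀ inn g) (hξ : 0 < ξ) {l : ℝ} (hl : l₀ ≤ l) :
    inn l < l := by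
  linarith [hg.inn_le l hl]

theorem IsOdotFamily.pos (hg : IsOdotFamily ξ l₀ inn g) (hξ : 0 < ξ) {l : ℝ} (hl : l₀ ≤ l) :
    0 < l := by
  linarith [hg.lt_l₀]

theorem IsOdotFamily.contDiffOn_cut (hg : IsOdotFamily ξ l₀ inn g) (hξ : 0 < ξ)
    (A : SphereAtlas m) (i : Fin A.N) (k j : Fin m) :
    ContDiffOn ℝ ∞ (fun q : ℝ × Eu m =>
      pullCoeff (stdVec m) (sphericalCut (g q.1) q.1) (A.ψ i) k j q.2) (Ici l₀ ×ˢ A.ext i) := by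
  have hfst : ContDiffOn ℝ ∞ (fun q : ℝ × Eu m => q.1) (Ici l₀ ×ˢ A.ext i) := contDiffOn_fst
  have hm : MapsTo (fun q : ℝ × Eu m => q.2) (Ici l₀ ×ˢ A.ext i) (A.ext i) := fun q hq => hq.2
  have hψ : ContDiffOn ℝ ∞ (fun q : ℝ × Eu m => A.ψ i q.2) (Ici l₀ ×ˢ A.ext i) :=
    (A.smooth i).comp contDiffOn_snd hm
  have hD : ∀ k, ContDiffOn ℝ ∞ (fun q : ℝ × Eu m => fderiv ℝ (A.ψ i) q.2 (stdVec m k))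
      (Ici l₀ ×ˢ A.ext i) := fun k =>
    (((A.smooth i).fderiv_of_isOpen (A.isOpen_ext i) (m := ∞) (by simp)).comp contDiffOn_snd
      hm).clm_apply contDiffOn_const
  have hsinh : ∀ q ∈ Ici l₀ ×ˢ A.ext i, Real.sinh q.1 ^ 2 ≠ 0 := fun q hq =>
    (pow_pos (Real.sinh_pos_iff.2 (hg.pos hξ hq.1)) 2).ne'
  have hcoef : ContDiffOn ℝ ∞ (fun q : ℝ × Eu m => q.1 ^ 2 / Real.sinh q.1 ^ 2)
      (Ici l₀ ×ˢ A.ext i) :=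
    (hfst.pow 2).div ((Real.contDiff_sinh.comp_contDiffOn hfst).pow 2) hsinh
  have hgc := hg.smooth.comp (f := fun q : ℝ × Eu m => (q.1, q.1 • A.ψ i q.2))
    (hfst.prodMk (hfst.fun_smul hψ)) fun q hq => by
      have hp := hg.pos hξ hq.1
      refine ⟨hq.1, ?_⟩
      simp only [norm_smul, A.norm_ψ hq.2, mul_one, Real.norm_of_nonneg hp.le]
      linarith
  have := hcoef.mul ((hgc.clm_apply (hD k)).clm_apply (hD j))
  refine this.congr fun q _ => ?_
  simp [pullCoeff, sphericalCut]

theorem IsOdotFamily.contDiffOn_pullCoeff_cut (hg : IsOdotFamily ξ l₀ inn g) (hξ : 0 < ξ)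
    (A : SphereAtlas m) (i : Fin A.N) (k j : Fin m) {l : ℝ} (hl : l₀ ≤ l) :
    ContDiffOn ℝ 2 (pullCoeff (stdVec m) (sphericalCut (g l) l) (A.ψ i) k j) (A.ext i) :=
  (contDiffOn_slice (hg.contDiffOn_cut hξ A i k j) hl).of_le (by norm_cast)

theorem IsOdotFamily.posDef_gram (hg : IsOdotFamily ξ l₀ inn g) (hξ : 0 < ξ)
    (A : SphereAtlas m) (i : Fin A.N) {l : ℝ} (hl : l₀ ≤ l) {z : Eu m} (hz : z ∈ A.ext i) :
    (gram (sphericalCut (g l) l) (A.ψ i) z).PosDef :=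
  HypForcing.posDef_gram (A.isOpen_ext i) (A.smooth i) (A.mapsTo i) hz (A.immersion i z hz)
    ((hg.metric l hl).isTangentForm_sphericalCut (hg.pos hξ hl) (hg.inn_lt hξ hl) (A.norm_ψ hz))

theorem IsOdotFamily.exists_chartBound_Icc (hg : IsOdotFamily ξ l₀ inn g) (hξ : 0 < ξ)
    (A : SphereAtlas m) (i : Fin A.N) (L : ℝ) :
    ∃ c, 0 < c ∧ ∀ l ∈ Icc l₀ L, ChartBound A (sphericalCut (g l) l) i c := by
  obtain ⟨c, hc, h1⟩ := exists_uniform (ι := Fin m × Fin m)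
    (P := fun k c => ∀ l ∈ Icc l₀ L, C2Bound (stdVec m) (closure (A.dom i))
      (pullCoeff (stdVec m) (sphericalCut (g l) l) (A.ψ i) k.1 k.2) c)
    (fun _ _ _ hab h l hl => (h l hl).mono hab) fun k => by
      obtain ⟨K, -, hK⟩ := exists_c2Bound_family (b := stdVec m) (L := L) (A.isOpen_ext i)
        (hg.contDiffOn_cut hξ A i k.1 k.2) (A.isCompact_closure i) (A.closure_subset i)
      exact ⟨K, hK⟩
  -- Inverting the determinant turns its lower bound into an upper bound for a continuous function
  -- on a compact set.
  have hdet : ContinuousOn (fun q : ℝ × Eu m =>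
      ((gram (sphericalCut (g q.1) q.1) (A.ψ i) q.2).det)⁻¹) (Icc l₀ L ×ˢ closure (A.dom i)) := by
    have hsub : Icc l₀ L ×ˢ closure (A.dom i) ⊆ Ici l₀ ×ˢ A.ext i :=
      prod_mono Icc_subset_Ici_self (A.closure_subset i)
    have hgr : ContinuousOn (fun q : ℝ × Eu m => gram (sphericalCut (g q.1) q.1) (A.ψ i) q.2)
        (Icc l₀ L ×ˢ closure (A.dom i)) :=
      continuousOn_pi.2 fun k => continuousOn_pi.2 fun j =>
        ((hg.contDiffOn_cut hξ A i k j).continuousOn.mono hsub)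
    refine ContinuousOn.inv₀ ?_ fun q hq =>
      (hg.posDef_gram hξ A i hq.1.1 (A.closure_subset i hq.2)).det_pos.ne'
    exact (continuous_id.matrix_det).comp_continuousOn hgr
  obtain ⟨c', h2⟩ := (isCompact_Icc.prod (A.isCompact_closure i)).exists_abs_le hdet
  refine ⟨c + |c'|, by positivity, fun l hl => ⟨by positivity, fun k j =>
    ((h1 (k, j) l hl).subset subset_closure).mono (by linarith [abs_nonneg c']), fun z hz => ?_⟩⟩
  have hd := (hg.posDef_gram hξ A i hl.1 (A.dom_subset_ext i hz)).det_pos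
  have := h2 (l, z) ⟨hl, subset_closure hz⟩
  rw [abs_inv] at this
  rw [div_le_comm₀ (by positivity) (abs_pos.2 hd.ne'), one_div]
  linarith [le_abs_self c']

/-- Beyond some `L` the cuts are so close to the limit that its `C²` and determinant bounds persist;
on `[l₀, L]` joint smoothness and compactness suffice. -/
theorem IsOdotFamily.exists_cBounded (hg : IsOdotFamily ξ l₀ inn g) (hξ : 0 < ξ)
    (A : SphereAtlas m) {ginf : FormField m} (hlim : HasCutLimit A g 0 ginf) :
    ∃ c > 1, ∀ l ≥ l₀, CBounded A c (sphericalCut (g l) l) := by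
  obtain ⟨hinf, hlim⟩ := hlim
  simp only [add_zero] at hlim
  have key : ∀ i, ∃ c, 0 < c ∧ ∀ l ≥ l₀, ChartBound A (sphericalCut (g l) l) i c := fun i => by
    obtain ⟨c₁, hc₁, hB⟩ := hinf.exists_c2Bound A i
    obtain ⟨c₂, hc₂, ε, hε, hdet⟩ := hinf.exists_det_bound A i
    have hev := hlim.eventually (gt_mem_nhds (ENNReal.ofReal_pos.2 (half_pos hε)))
    obtain ⟨L, hL⟩ := eventually_atTop.1 hev
    obtain ⟨c₃, hc₃, hI⟩ := hg.exists_chartBound_Icc hξ A i L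
    have hc₂' : 0 < 1 / c₂ := by positivity
    -- `c₃` serves `l ≤ L`; for larger `l`, `c₁ + ε` dominates the limit plus its deviation, and `1
    -- / c₂` handles the determinants.
    refine ⟨c₃ + c₁ + ε + 1 / c₂, by positivity, fun l hl => ?_⟩
    rcases le_total l L with hlL | hlL
    · exact (hI l ⟨hl, hlL⟩).mono (by linarith)
    · have hcut := fun k j => (hg.contDiffOn_pullCoeff_cut hξ A i k j hl).mono (A.dom_subset_ext i)
      have hinf' := fun k j => (hB k j).contDiffOn
      have hsub : ∀ k j z, pullCoeff (stdVec m) (sphericalCut (g l) l - ginf) (A.ψ i) k j z =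
          pullCoeff (stdVec m) (sphericalCut (g l) l) (A.ψ i) k j z -
            pullCoeff (stdVec m) ginf (A.ψ i) k j z := fun k j z => by
        simp [pullCoeff]
      have hdiff : ∀ k j, C2Bound (stdVec m) (A.dom i)
          (pullCoeff (stdVec m) (sphericalCut (g l) l - ginf) (A.ψ i) k j) (ε / 2) := fun k j =>
        C2Bound.of_c2NormMat_le (((hcut k j).sub (hinf' k j)).congr fun z _ => hsub k j z)
          (half_pos hε).le ((le_iSup (fun i => c2NormMat (stdVec m) (A.dom i)
            (pullCoeff (stdVec m) (sphericalCut (g l) l - ginf) (A.ψ i))) i).trans (hL l hlL).le)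
      refine ⟨by positivity, fun k j => ?_, fun z hz => ?_⟩
      · refine (((hdiff k j).add (A.isOpen_dom i) (hB k j)).congr (A.isOpen_dom i)
          fun z _ => ?_).mono (by linarith)
        rw [hsub]; ring
      · refine le_trans ?_ (hdet z hz _ fun k j => ?_)
        · rw [div_le_comm₀ (by positivity) hc₂]; linarith
        · have := (hdiff k j).val z hz
          rw [hsub] at this
          exact this.trans_lt (half_lt_self hε)
  obtain ⟨c, hc, h⟩ := exists_uniform
    (P := fun i c => 0 < c ∧ ∀ l ≥ l₀, ChartBound A (sphericalCut (g l) l) i c)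
    (fun i a b hab h => ⟨h.1.trans_le hab, fun l hl => (h.2 l hl).mono hab⟩) key
  exact ⟨c + 1, by linarith, fun l hl => ChartBound.cBounded hc (by linarith) fun i => (h i).2 l hl⟩

end Cuts

/-! ### Estimates in the radial variable -/

section OneVariable

/-- The basis of `ℝ`. -/
def unitBasis : Unit → ℝ := fun _ => 1

theorem IsWarpCutoff.isTrickCutoff {ρ : ℝ → ℝ} (h : IsWarpCutoff ρ) : IsTrickCutoff ρ := by
  obtain ⟨h1, h2, δ, hδ, h3, h4⟩ := h
  exact ⟨h1, h2, fun t ht => h3 t (ht.trans hδ.le), fun t ht => h4 t (by linarith)⟩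

theorem IsTrickCutoff.exists_c2Bound {ρ : ℝ → ℝ} (h : IsTrickCutoff ρ) :
    ∃ K, 0 < K ∧ C2Bound unitBasis univ ρ K := by
  have hs : ContDiff ℝ 2 ρ := h.1.of_le (by norm_cast)
  obtain ⟨K, hK, hb⟩ := HypForcing.exists_c2Bound (b := unitBasis) isOpen_univ hs.contDiffOn
    (isCompact_Icc (a := (-1 : ℝ)) (b := 2)) (subset_univ _)
  -- Outside `[0, 1]` the cutoff is constant. The half-lines are open, so derivatives can be
  -- compared there, and together with `[-1, 2]` they cover the line; `K + 1` leaves room for the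
  -- value `1`.
  have h0 : C2Bound unitBasis (Iio 0) ρ (K + 1) :=
    (C2Bound.const (c := 0) (by rw [abs_zero]; positivity)).congr isOpen_Iio
      fun t ht => h.2.2.1 t (le_of_lt ht)
  have h1 : C2Bound unitBasis (Ioi 1) ρ (K + 1) :=
    (C2Bound.const (c := 1) (by rw [abs_one]; linarith)).congr isOpen_Ioi
      fun t ht => h.2.2.2 t (le_of_lt ht)
  have h2 : C2Bound unitBasis (Icc (-1) 2) ρ (K + 1) := hb.mono (by linarith)
  have hcov : ∀ t : ℝ, t ∈ Iio (0 : ℝ) ∨ t ∈ Ioi (1 : ℝ) ∨ t ∈ Icc (-1 : ℝ) 2 := fun t => by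
    rcases lt_or_ge t 0 with h | h
    · exact Or.inl h
    · rcases lt_or_ge 1 t with h' | h'
      · exact Or.inr (Or.inl h')
      · exact Or.inr (Or.inr ⟨by linarith, by linarith⟩)
  refine ⟨K + 1, by positivity, hs.contDiffOn, fun t _ => ?_, fun t _ => ?_, fun t _ => ?_⟩ <;>
    rcases hcov t with h | h | h
  exacts [h0.val t h, h1.val t h, h2.val t h, h0.d1 t h, h1.d1 t h, h2.d1 t h, h0.d2 t h,
    h1.d2 t h, h2.d2 t h]

theorem exists_c2Bound_Ioo (R : ℝ) {u : ℝ → ℝ} (hu : ContDiff ℝ ∞ u) :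
    ∃ K, 0 < K ∧ C2Bound unitBasis (Ioo (-R) R) u K := by
  obtain ⟨K, hK, hb⟩ := HypForcing.exists_c2Bound (b := unitBasis) isOpen_univ
    (hu.of_le (m := 2) (by norm_cast)).contDiffOn (isCompact_Icc (a := -R) (b := R)) (subset_univ _)
  exact ⟨K, hK, hb.subset Ioo_subset_Icc_self⟩

/-- The square of `sinh (r + t) / sinh r = exp t + β sinh t`, `β = exp (-r) / sinh r`, is
`β`-close to `exp (2 t)`. -/
theorem exists_c2Bound_sinh_ratio (R : ℝ) : ∃ K, 0 < K ∧ ∀ β ∈ Icc (0 : ℝ) 1,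
    C2Bound unitBasis (Ioo (-R) R) (fun t => (Real.exp t + β * Real.sinh t) ^ 2) K ∧
    C2Bound unitBasis (Ioo (-R) R)
      (fun t => (Real.exp t + β * Real.sinh t) ^ 2 - Real.exp (2 * t)) (β * K) := by
  obtain ⟨K1, hK1, h1⟩ := exists_c2Bound_Ioo R (u := fun t => Real.exp (2 * t))
    (Real.contDiff_exp.comp (contDiff_const.mul contDiff_id))
  obtain ⟨K2, hK2, h2⟩ := exists_c2Bound_Ioo R (u := fun t => 2 * Real.exp t * Real.sinh t)
    ((contDiff_const.mul Real.contDiff_exp).mul Real.contDiff_sinh)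
  obtain ⟨K3, hK3, h3⟩ := exists_c2Bound_Ioo R (u := fun t => Real.sinh t ^ 2)
    (Real.contDiff_sinh.pow 2)
  refine ⟨K1 + K2 + K3, by positivity, fun β hβ => ?_⟩
  have hexp : ∀ t, Real.exp (2 * t) = Real.exp t ^ 2 := fun t => by rw [← Real.exp_nat_mul]; simp
  -- The difference of squares is `β (2 exp t sinh t + β sinh² t)`, which shows the factor `β`.
  have hb := (h2.add isOpen_Ioo (h3.const_mul isOpen_Ioo β)).const_mul isOpen_Ioo β
  rw [abs_of_nonneg hβ.1] at hb
  have hle : K2 + β * K3 ≤ K2 + K3 := by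
    have := mul_le_of_le_one_left hK3.le hβ.2
    linarith
  have h4 : C2Bound unitBasis (Ioo (-R) R)
      (fun t => (Real.exp t + β * Real.sinh t) ^ 2 - Real.exp (2 * t)) (β * (K2 + K3)) :=
    (hb.mono (mul_le_mul_of_nonneg_left hle hβ.1)).congr isOpen_Ioo fun t _ => by
      simp only [hexp]; ring
  refine ⟨((h4.add isOpen_Ioo h1).mono ?_).congr isOpen_Ioo fun t _ => by ring,
    h4.mono (mul_le_mul_of_nonneg_left (by linarith) hβ.1)⟩
  have := mul_le_of_le_one_left (add_pos hK2 hK3).le hβ.2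
  linarith

/-- Use the addition formula with `cosh r = sinh r + exp (-r)` and `cosh t + sinh t = exp t`. It
isolates the deviation of the ratio from `exp t` in a single small parameter. -/
theorem sinh_add_eq {r : ℝ} (hr : 0 < r) (t : ℝ) : Real.sinh (r + t) =
    Real.sinh r * (Real.exp t + Real.exp (-r) / Real.sinh r * Real.sinh t) := by
  have h := (Real.sinh_pos_iff.2 hr).ne'
  have h1 : Real.sinh r * (Real.exp (-r) / Real.sinh r) = Real.exp (-r) := by field_simp
  rw [mul_add, ← mul_assoc, h1, Real.sinh_add, ← Real.cosh_sub_sinh r, ← Real.cosh_add_sinh t]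
  ring

theorem one_le_sinh {r : ℝ} (hr : 1 ≤ r) : 1 ≤ Real.sinh r :=
  hr.trans (Real.self_le_sinh_iff.2 (by linarith))

theorem exp_neg_div_sinh_mem {r : ℝ} (hr : 1 ≤ r) :
    Real.exp (-r) / Real.sinh r ∈ Icc (0 : ℝ) 1 ∧
      Real.exp (-r) / Real.sinh r ≤ Real.exp (-r) := by
  have h1 := one_le_sinh hr
  have h2 : Real.exp (-r) ≤ 1 := Real.exp_le_one_iff.2 (by linarith)
  have h3 : Real.exp (-r) / Real.sinh r ≤ Real.exp (-r) :=
    div_le_self (Real.exp_pos _).le h1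
  exact ⟨⟨by positivity, h3.trans h2⟩, h3⟩

end OneVariable

/-! ### `C²` bounds on the model space. -/

section Model

variable {m : ℕ} {ξ K : ℝ}

/-- A function of the radial variable. -/
theorem C2Bound.comp_snd {S' : Set ℝ} (hS' : IsOpen S') {u : ℝ → ℝ}
    (hu : C2Bound unitBasis S' u K) (t₀ : ℝ)
    (hS : ∀ t ∈ Ioo (-(1 + ξ)) (1 + ξ), t - t₀ ∈ S') :
    C2Bound (modelBasis m) (modelSet m ξ) (fun z => u (z.2 - t₀)) K := by
  refine (hu.comp_affine (isOpen_modelSet m ξ) hS' (-t₀) (ContinuousLinearMap.snd ℝ (Eu m) ℝ)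
    (fun z hz => ?_) (fun k _ => (modelBasis m k).2) (fun k => ?_) fun k => ?_).congr
      (isOpen_modelSet m ξ) fun z _ => ?_
  · have := hS z.2 hz.2
    simpa [neg_add_eq_sub] using this
  · simp [unitBasis]
  · cases k <;> simp [modelBasis]
  · simp [neg_add_eq_sub]

/-- Restriction to a slice of constant radial variable. -/
theorem C2Bound.comp_slice {ξ' : ℝ} {f : Model m → ℝ}
    (hf : C2Bound (modelBasis m) (modelSet m ξ) f K) {t₀ : ℝ}
    (ht₀ : t₀ ∈ Ioo (-(1 + ξ)) (1 + ξ)) :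
    C2Bound (modelBasis m) (modelSet m ξ') (fun z => f (z.1, t₀)) K := by
  classical
  refine (hf.comp_affine (isOpen_modelSet m ξ') (isOpen_modelSet m ξ) (0, t₀)
    ((ContinuousLinearMap.inl ℝ (Eu m) ℝ).comp (ContinuousLinearMap.fst ℝ (Eu m) ℝ))
    (fun z hz => ?_) (fun k j => if k = none then 0 else if j = k then 1 else 0) (fun k => ?_)
      fun k => ?_).congr (isOpen_modelSet m ξ') fun z _ => ?_
  · refine ⟨?_, ?_⟩
    · simpa using hz.1
    · simpa using ht₀
  · cases k <;> simp [modelBasis, -Fintype.sum_option]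
  · cases k <;> simp [apply_ite abs, -Fintype.sum_option]
  · simp

theorem modelCoeff_some_some (i j : Fin m) (z : Model m) :
    modelCoeff m (some i) (some j) z = Real.exp (2 * z.2) * (if i = j then 1 else 0) := by
  simp [modelCoeff, modelBasis, EuclideanSpace.inner_single_left]

theorem contDiff_modelCoeff (i j : Option (Fin m)) : ContDiff ℝ ∞ (modelCoeff m i j) :=
  ((Real.contDiff_exp.comp (contDiff_const.mul contDiff_snd)).mul contDiff_const).add
    contDiff_const

/-- For polar metrics only the spherical coefficients have to be estimated. -/
theorem IsRadialMap.c2NormMat_le {a : ℝ} {φ : Model m → Eu (m + 1)} {φ₁ : Eu m → Eu (m + 1)}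
    (h : IsRadialMap ξ a φ φ₁) {g : FormField m} (hg : IsMetricOn {0}ᶜ g)
    (hpol : IsPolarOn {0}ᶜ g) (hK : 0 ≤ K)
    (hb : ∀ i j : Fin m, C2Bound (modelBasis m) (modelSet m ξ)
      (fun z => pullCoeff (modelBasis m) g φ (some i) (some j) z -
        modelCoeff m (some i) (some j) z) K) :
    c2NormMat (modelBasis m) (modelSet m ξ)
      (fun i j z => pullCoeff (modelBasis m) g φ i j z - modelCoeff m i j z) ≤
        ENNReal.ofReal K := by
  have hU : MapsTo φ (modelSet m ξ) {0}ᶜ := fun z hz => by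
    have := h.norm (x := z.1) (t := z.2) hz
    exact norm_pos_iff.1 (this.symm ▸ h.pos _ hz.2)
  have h0 : ∀ {i j : Option (Fin m)}, i = none ∨ j = none → C2Bound (modelBasis m) (modelSet m ξ)
      (fun z => pullCoeff (modelBasis m) g φ i j z - modelCoeff m i j z) K := fun hij =>
    (C2Bound.const (c := 0) (by simpa using hK)).congr (isOpen_modelSet m ξ) fun z hz =>
      sub_eq_zero.2 (h.pullCoeff_eq_modelCoeff hU hpol hg.2.1 hij hz)
  refine HypForcing.c2NormMat_le fun i j => ?_
  rcases i with _ | i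
  · exact h0 (Or.inl rfl)
  · rcases j with _ | j
    · exact h0 (Or.inr rfl)
    · exact hb i j

end Model

/-! ### The region of warp forcing -/

section Warp

variable {m : ℕ} {ξ : ℝ} {ρW ρT : ℝ → ℝ}

theorem c2Bound_chart {U : Set (Eu (m + 1))} {g : FormField m} (hg : ContDiffOn ℝ ∞ g U)
    {p : Eu (m + 1)} {φ : Model m → Eu (m + 1)} (hφ : IsRadialChart U ξ p φ) {ε : ℝ} (hε : 0 ≤ ε)
    (hc : c2NormMat (modelBasis m) (modelSet m ξ)
      (fun i j z => pullCoeff (modelBasis m) g φ i j z - modelCoeff m i j z) ≤ ENNReal.ofReal ε)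
    (i j : Option (Fin m)) : C2Bound (modelBasis m) (modelSet m ξ)
      (fun z => pullCoeff (modelBasis m) g φ i j z - modelCoeff m i j z) ε :=
  C2Bound.of_c2NormMat_le (F := fun i j z => pullCoeff (modelBasis m) g φ i j z - modelCoeff m i j z)
    (((contDiffOn_pullCoeff (isOpen_modelSet m ξ) hg hφ.1 hφ.2.2.2.1 i j).sub
      (contDiff_modelCoeff i j).contDiffOn).of_le (by norm_cast)) hε hc

/-- The cut at `l` is visible in the chart itself, as the slice `t = l - a`. The warped part of the
metric is this slice times `sinh² (t + a) / sinh² l`, so no other chart of the sphere is needed. -/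
theorem IsRadialMap.pullCoeff_warpForcing {ξ' a l : ℝ} {φ : Model m → Eu (m + 1)}
    {φ₁ : Eu m → Eu (m + 1)} (h : IsRadialMap ξ a φ φ₁) (hl : 0 < l) (g : FormField m)
    (hal : l - a ∈ Ioo (-(1 + ξ)) (1 + ξ)) (hξ : ξ' ≤ ξ) (i j : Fin m) {x : Eu m} {t : ℝ}
    (hz : (x, t) ∈ modelSet m ξ') :
    pullCoeff (modelBasis m) (warpForcing ρW l g) φ (some i) (some j) (x, t) =
      (1 - ρW (t - (l - a))) *
        ((Real.exp (t - (l - a)) + Real.exp (-l) / Real.sinh l * Real.sinh (t - (l - a))) ^ 2 *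
          pullCoeff (modelBasis m) g φ (some i) (some j) (x, l - a)) +
      ρW (t - (l - a)) * pullCoeff (modelBasis m) g φ (some i) (some j) (x, t) := by
  have hz' := modelSet_mono m hξ hz
  have h1 := h.pullCoeff_warpedMetric (sphericalCut g l) hz' i j
  rw [h.pullCoeff_sphericalCut g ⟨hz.1, hal⟩ i j, show t + a = l + (t - (l - a)) by ring,
    sinh_add_eq hl] at h1
  have hn : ‖φ (x, t)‖ - l = t - (l - a) := by rw [h.norm hz']; ring
  have hs := (Real.sinh_pos_iff.2 hl).ne'
  rw [mul_pow, mul_assoc, mul_left_comm, mul_inv_cancel_left₀ (pow_ne_zero 2 hs)] at h1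
  have h2 : pullCoeff (modelBasis m) (warpForcing ρW l g) φ (some i) (some j) (x, t) =
      (1 - ρW (t - (l - a))) *
        pullCoeff (modelBasis m) (warpedMetric (sphericalCut g l)) φ (some i) (some j) (x, t) +
      ρW (t - (l - a)) * pullCoeff (modelBasis m) g φ (some i) (some j) (x, t) := by
    simp only [pullCoeff, warpForcing, hn, add_apply, smul_apply, smul_eq_mul]
  rw [h2, h1]

/-- In a chart in which `g` is close to hyperbolic, hyperbolic forcing produces a metric that is
close to hyperbolic. -/
theorem exists_warp_bound (hρW : IsWarpCutoff ρW) (hρT : IsTrickCutoff ρT) (hξ : 1 < ξ) :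
    ∃ C₁ C₂ : ℝ, 0 < C₁ ∧ 1 ≤ C₂ ∧ ∀ (m : ℕ) (b l d ε : ℝ) (g : FormField m) (p : Eu (m + 1))
      (φ : Model m → Eu (m + 1)), 0 ≤ ε → 1 ≤ l → b < l → 4 * (1 + ξ) ≤ d →
      |l - ‖p‖| ≤ ξ + 1 / 2 → IsMetricOn (outerRegion m b) g → IsPolarOn (outerRegion m b) g →
      IsRadialChart (outerRegion m b) ξ p φ →
      c2NormMat (modelBasis m) (modelSet m ξ)
        (fun i j z => pullCoeff (modelBasis m) g φ i j z - modelCoeff m i j z) ≤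
          ENNReal.ofReal ε →
      c2NormMat (modelBasis m) (modelSet m (ξ - 1))
        (fun i j z => pullCoeff (modelBasis m) (hyperbolicForcing ρW ρT l d g) φ i j z -
          modelCoeff m i j z) ≤ ENNReal.ofReal (C₁ * Real.exp (-l) + C₂ * ε) := by
  -- The reduced chart has `|t| < ξ` and the level has `|t₀| ≤ ξ + 1 / 2`, so `t - t₀` stays within
  -- `2 * ξ + 1`.
  obtain ⟨K, hK, hq⟩ := exists_c2Bound_sinh_ratio (2 * ξ + 1)
  obtain ⟨Kρ, hKρ, hρ⟩ := hρW.isTrickCutoff.exists_c2Bound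
  -- The first constant comes from the `sinh` ratio, with `exp (2 t₀) ≤ exp (2 (1 + ξ))`. The second
  -- collects the error on the slice, weighted by `1 - ρW` and the ratio, and the error of `g`
  -- weighted by `ρW`; the final `1` ensures that it is at least one.
  refine ⟨4 * ((1 + Kρ) * (Real.exp (2 * (1 + ξ)) * K)), 4 * ((1 + Kρ) * (4 * K)) + 4 * Kρ + 1,
    by positivity, by have : 0 ≤ 4 * ((1 + Kρ) * (4 * K)) + 4 * Kρ := by positivity
                      linarith, ?_⟩
  intro m b l d ε g p φ hε hl hbl hd hlp hg hpol hφ hc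
  obtain ⟨φ₁, hr⟩ := hφ.exists_isRadialMap (by linarith)
  have hl0 : 0 < l := by linarith
  obtain ⟨hH, hHp⟩ := isMetricOn_hyperbolicForcing (d := d) hρW hρT hl0 hbl hg hpol
  rw [abs_le] at hlp
  have ht₀ : l - ‖p‖ ∈ Ioo (-(1 + ξ)) (1 + ξ) := ⟨by linarith, by linarith⟩
  refine (hr.mono (ξ' := ξ - 1) (by linarith)).c2NormMat_le hH hHp (by positivity) fun i j => ?_
  have hE := c2Bound_chart hg.1 hφ hε hc (some i) (some j)
  obtain ⟨hβ, hβ'⟩ := exp_neg_div_sinh_mem hl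
  set β := Real.exp (-l) / Real.sinh l
  set t₀ := l - ‖p‖ with ht₀_def
  have hS := isOpen_modelSet m (ξ - 1)
  have hR : ∀ t ∈ Ioo (-(1 + (ξ - 1))) (1 + (ξ - 1)),
      t - t₀ ∈ Ioo (-(2 * ξ + 1)) (2 * ξ + 1) := fun t ht =>
    ⟨by linarith [ht.1, hlp.2], by linarith [ht.2, hlp.1]⟩
  have bρ := hρ.comp_snd (m := m) (ξ := ξ - 1) isOpen_univ t₀ fun _ _ => mem_univ _
  have bρ' := (C2Bound.const (b := modelBasis m) (S := modelSet m (ξ - 1)) (c := (1 : ℝ))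
    (K := 1) (by simp)).sub hS bρ
  have bq := (hq β hβ).1.comp_snd (m := m) isOpen_Ioo t₀ hR
  have bq' := ((hq β hβ).2.comp_snd (m := m) isOpen_Ioo t₀ hR).const_mul hS
    (Real.exp (2 * t₀) * (if i = j then 1 else 0))
  have bE₀ := hE.comp_slice (ξ' := ξ - 1) ht₀
  have bE := hE.subset (modelSet_mono m (show ξ - 1 ≤ ξ by linarith))
  have hcoef : |Real.exp (2 * t₀) * (if i = j then 1 else 0)| ≤ Real.exp (2 * (1 + ξ)) := by
    rw [abs_mul, abs_of_pos (Real.exp_pos _)]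
    have h1 : |(if i = j then 1 else 0 : ℝ)| ≤ 1 := by split_ifs <;> simp
    have h2 : Real.exp (2 * t₀) ≤ Real.exp (2 * (1 + ξ)) := Real.exp_le_exp.2 (by linarith [ht₀.2])
    calc _ ≤ Real.exp (2 * (1 + ξ)) * 1 :=
          mul_le_mul h2 h1 (abs_nonneg _) (Real.exp_pos _).le
      _ = _ := mul_one _
  have total := (bρ'.mul hS (bq'.add hS (bq.mul hS bE₀))).add hS (bρ.mul hS bE)
  refine (total.mono ?_).congr hS fun z hz => ?_
  · have h1 : |Real.exp (2 * t₀) * (if i = j then 1 else 0)| * (β * K) ≤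
        Real.exp (2 * (1 + ξ)) * (Real.exp (-l) * K) :=
      mul_le_mul hcoef (mul_le_mul_of_nonneg_right hβ' hK.le) (mul_nonneg hβ.1 hK.le)
        (Real.exp_pos _).le
    have h2 := mul_le_mul_of_nonneg_left h1 (show 0 ≤ 4 * (1 + Kρ) by positivity)
    nlinarith
  · obtain ⟨x, t⟩ := z
    have hz' := modelSet_mono m (show ξ - 1 ≤ ξ by linarith) hz
    have hH' : hyperbolicForcing ρW ρT l d g (φ (x, t)) = warpForcing ρW l g (φ (x, t)) := by
      -- Radii in the chart exceed `l - 2 ξ - 1 / 2`, hence `l - d / 2`, because `d ≥ 4 (1 + ξ)`.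
      refine warpingTrick_of_ge hρT (by linarith) ?_
      rw [hr.norm hz']
      linarith [hz.2.1, hlp.2]
    rw [pullCoeff_congr hH', hr.pullCoeff_warpForcing hl0 g ht₀ (show ξ - 1 ≤ ξ by linarith) i j hz]
    simp only [modelCoeff_some_some]
    have hexp : Real.exp (2 * (t - t₀)) * Real.exp (2 * t₀) = Real.exp (2 * t) := by
      rw [← Real.exp_add]; ring_nf
    rw [← hexp]
    ring

end Warp

/-! ### Linear reparametrizations of charts -/

section Linear

variable {m : ℕ}

/-- The linear endomorphism of `ℝᵐ` with matrix `N`. -/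
noncomputable def matrixCLM (N : Matrix (Fin m) (Fin m) ℝ) : Eu m →L[ℝ] Eu m :=
  LinearMap.toContinuousLinearMap
    ((WithLp.linearEquiv 2 ℝ (Fin m → ℝ)).symm.toLinearMap ∘ₗ N.mulVecLin ∘ₗ
      (WithLp.linearEquiv 2 ℝ (Fin m → ℝ)).toLinearMap)

theorem matrixCLM_apply (N : Matrix (Fin m) (Fin m) ℝ) (x : Eu m) :
    matrixCLM N x = WithLp.toLp 2 (N.mulVec x.ofLp) := rfl

theorem matrixCLM_stdVec (N : Matrix (Fin m) (Fin m) ℝ) (i : Fin m) :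
    matrixCLM N (stdVec m i) = ∑ k, N k i • stdVec m k := by
  rw [← toLp_eq_sum, matrixCLM_apply]
  congr 1
  ext k
  simp [stdVec]

theorem matrixCLM_injective {N : Matrix (Fin m) (Fin m) ℝ} (hN : IsUnit N) :
    Function.Injective (matrixCLM N) := fun x y h => by
  have := Matrix.mulVec_injective_of_isUnit hN (WithLp.toLp_injective 2 h)
  exact WithLp.ofLp_injective 2 this

theorem norm_stdVec (i : Fin m) : ‖stdVec m i‖ = 1 := by simp [stdVec]

theorem abs_apply_lt_one {x : Eu m} (hx : x ∈ Metric.ball (0 : Eu m) 1) (i : Fin m) :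
    |x i| < 1 := by
  rw [mem_ball_zero_iff] at hx
  exact (PiLp.norm_apply_le x i).trans_lt hx

theorem eq_sum_stdVec (x : Eu m) : x = ∑ k, x k • stdVec m k := by
  rw [← toLp_eq_sum]

theorem norm_matrixCLM_le {N : Matrix (Fin m) (Fin m) ℝ} {ν : ℝ} (hN : ∀ i j, |N i j| ≤ ν)
    {x : Eu m} (hx : x ∈ Metric.ball (0 : Eu m) 1) : ‖matrixCLM N x‖ ≤ m * (m * ν) := by
  have h1 : ∀ i, ‖matrixCLM N (stdVec m i)‖ ≤ m * ν := fun i => by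
    rw [matrixCLM_stdVec]
    refine (norm_sum_le_of_le Finset.univ (n := fun _ => ν) fun k _ => ?_).trans (by simp)
    rw [norm_smul, norm_stdVec, mul_one]
    exact hN k i
  rw [eq_sum_stdVec x, map_sum]
  refine (norm_sum_le_of_le Finset.univ (n := fun _ => m * ν) fun k _ => ?_).trans (by simp)
  rw [map_smul, norm_smul]
  calc ‖x k‖ * ‖matrixCLM N (stdVec m k)‖ ≤ 1 * (m * ν) :=
        mul_le_mul (abs_apply_lt_one hx k).le (h1 k) (norm_nonneg _) zero_le_one
    _ = _ := one_mul _

theorem modelSet_smul_mem {ξ : ℝ} {z : Model m} (hz : z ∈ modelSet m ξ) {s : ℝ}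
    (hs : s ∈ Icc (0 : ℝ) 1) : s • z ∈ modelSet m ξ := by
  have hc : Convex ℝ (modelSet m ξ) := (convex_ball _ _).prod (convex_Ioo _ _)
  have hpos : 0 < 1 + ξ := by linarith [hz.2.1.trans hz.2.2]
  have h0 : (0 : Model m) ∈ modelSet m ξ :=
    ⟨Metric.mem_ball_self one_pos, by change -(1 + ξ) < 0; linarith, hpos⟩
  exact hc.smul_mem_of_zero_mem h0 hz hs

/-- This supplies the `ℓ¹` constant of the mean value estimate in `C2Bound.comp_affine_sub_const`:
at most one for each of the `m` coordinates in the ball, and `ξ` for the radial one. -/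
theorem modelSet_coordinates {ξ : ℝ} {z : Model m} (hz : z ∈ modelSet m (ξ - 1)) :
    ∃ a : Option (Fin m) → ℝ, z = ∑ k, a k • modelBasis m k ∧ ∑ k, |a k| ≤ m + ξ := by
  refine ⟨fun k => k.elim z.2 fun i => z.1 i, ?_, ?_⟩
  · rw [Fintype.sum_option]
    refine Prod.ext ?_ ?_
    · have h1 : (∑ i, z.1 i • modelBasis m (some i)).1 = ∑ i, z.1 i • stdVec m i := by
        rw [Prod.fst_sum]; rfl
      simp only [Option.elim, Prod.fst_add, h1]
      rw [← eq_sum_stdVec]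
      simp [modelBasis]
    · have h1 : (∑ i, z.1 i • modelBasis m (some i)).2 = 0 := by
        rw [Prod.snd_sum]; simp [modelBasis]
      simp only [Option.elim, Prod.snd_add, h1]
      simp [modelBasis]
  · rw [Fintype.sum_option]
    have h1 : |z.2| ≤ ξ := abs_le.2 ⟨by linarith [hz.2.1], by linarith [hz.2.2]⟩
    have h2 : ∑ i, |z.1 i| ≤ m := (Finset.sum_le_card_nsmul Finset.univ _ 1 fun i _ =>
      (abs_apply_lt_one hz.1 i).le).trans (by simp)
    simp only [Option.elim]
    linarith

/-- A function on a chart domain is nearly constant in a contracted chart. -/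
theorem C2Bound.comp_contraction {ξ K ν : ℝ} (hξ : 1 < ξ) {D : Set (Eu m)} (hD : IsOpen D)
    {f : Eu m → ℝ} (hf : C2Bound (stdVec m) D f K) {N : Matrix (Fin m) (Fin m) ℝ}
    (hν : 0 ≤ ν) (hN : ∀ i j, |N i j| ≤ ν) (hmν : m * ν ≤ 1) {z₀ : Eu m}
    (hz₀ : ∀ x ∈ Metric.ball (0 : Eu m) 1, z₀ + matrixCLM N x ∈ D) :
    C2Bound (modelBasis m) (modelSet m (ξ - 1)) (fun z => f (z₀ + matrixCLM N z.1) - f z₀)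
      ((m + ξ) * (m * ν * K)) := by
  have hmξ : 1 ≤ m + ξ := by
    have : (0 : ℝ) ≤ m := Nat.cast_nonneg m
    linarith
  refine hf.comp_affine_sub_const (isOpen_modelSet m (ξ - 1)) hD z₀
    ((matrixCLM N).comp (ContinuousLinearMap.fst ℝ (Eu m) ℝ)) (fun z hz => hz₀ z.1 hz.1)
    (fun k j => k.elim 0 fun i => N j i) (fun k => ?_) (fun k => ?_) hmν (by positivity) hmξ
    (fun z hz s hs => modelSet_smul_mem hz hs) fun z hz => modelSet_coordinates hz
  · cases k with
    | none => simp [modelBasis]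
    | some i => exact matrixCLM_stdVec N i
  · cases k with
    | none => simp; positivity
    | some i =>
      refine (Finset.sum_le_card_nsmul Finset.univ _ ν fun j _ => hN j i).trans (by simp)

/-- The transformation of the radial variable in the two variable warping trick. -/
theorem IsTrickCutoff.c2Bound_scaled {ρ : ℝ → ℝ} {ξ K : ℝ} (hξ : 1 < ξ)
    (hρ : C2Bound unitBasis univ ρ K) {d : ℝ} (hd : 2 ≤ d) (w₀ : ℝ) :
    C2Bound (modelBasis m) (modelSet m (ξ - 1)) (fun z => ρ (w₀ + 2 / d * z.2)) K ∧
    C2Bound (modelBasis m) (modelSet m (ξ - 1)) (fun z => ρ (w₀ + 2 / d * z.2) - ρ w₀)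
      ((m + ξ) * (2 / d * K)) := by
  have hmξ : 1 ≤ m + ξ := by
    have : (0 : ℝ) ≤ m := Nat.cast_nonneg m
    linarith
  have hd0 : 0 < d := by linarith
  have hd1 : 2 / d ≤ 1 := (div_le_one hd0).2 hd
  have hd2 : 0 ≤ 2 / d := by positivity
  have hM : ∀ k, ((2 / d) • ContinuousLinearMap.snd ℝ (Eu m) ℝ) (modelBasis m k) =
      ∑ j : Unit, (2 / d * (modelBasis m k).2) • unitBasis j := fun k => by simp [unitBasis]
  have hθ : ∀ k, ∑ _j : Unit, |2 / d * (modelBasis m k).2| ≤ 2 / d := fun k => by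
    cases k with
    | none => simp [modelBasis, abs_of_nonneg hd2]
    | some i => simpa [modelBasis] using hd2
  exact ⟨hρ.comp_affine (isOpen_modelSet m (ξ - 1)) isOpen_univ w₀
      ((2 / d) • ContinuousLinearMap.snd ℝ (Eu m) ℝ) (fun _ _ => mem_univ _) _ hM
      fun k => (hθ k).trans hd1,
    hρ.comp_affine_sub_const (isOpen_modelSet m (ξ - 1)) isOpen_univ w₀
      ((2 / d) • ContinuousLinearMap.snd ℝ (Eu m) ℝ) (fun _ _ => mem_univ _) _ hM
      hθ hd1 hd2 hmξ (fun z hz s hs => modelSet_smul_mem hz hs) fun z hz => modelSet_coordinates hz⟩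

end Linear

/-! ### Radial charts obtained from charts of the sphere. -/

section Chart

variable {m : ℕ} {ξ : ℝ}

/-- The coefficients of a pull-back in a linear reparametrization of a chart. -/
theorem pullCoeff_comp_matrixCLM (k : FormField m) {ψ : Eu m → Eu (m + 1)} {z₀ x : Eu m}
    {S : Matrix (Fin m) (Fin m) ℝ} {τ : ℝ}
    (hψ : DifferentiableAt ℝ ψ (z₀ + matrixCLM (τ • S) x)) (i j : Fin m) :
    pullCoeff (stdVec m) k (fun x => ψ (z₀ + matrixCLM (τ • S) x)) i j x =
      τ ^ 2 * ∑ a, ∑ b, S a i * S b j *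
        pullCoeff (stdVec m) k ψ a b (z₀ + matrixCLM (τ • S) x) := by
  have h1 : HasFDerivAt (fun x => ψ (z₀ + matrixCLM (τ • S) x))
      ((fderiv ℝ ψ (z₀ + matrixCLM (τ • S) x)).comp (matrixCLM (τ • S))) x :=
    HasFDerivAt.comp (f := fun x => z₀ + matrixCLM (τ • S) x) x hψ.hasFDerivAt
      ((matrixCLM (τ • S)).hasFDerivAt.const_add z₀)
  have h2 : ∀ i, fderiv ℝ (fun x => ψ (z₀ + matrixCLM (τ • S) x)) x (stdVec m i) =
      τ • ∑ a, S a i • fderiv ℝ ψ (z₀ + matrixCLM (τ • S) x) (stdVec m a) := fun i => by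
    rw [h1.fderiv, ContinuousLinearMap.comp_apply, matrixCLM_stdVec, map_sum, Finset.smul_sum]
    simp [mul_smul]
  simp only [pullCoeff, h2, map_smul, smul_apply, map_sum, sum_apply, smul_eq_mul, pow_two,
    Finset.mul_sum]
  rw [Finset.sum_comm]
  exact Finset.sum_congr rfl fun a _ => Finset.sum_congr rfl fun b _ => by ring

/-- Radial charts that are built from charts of the sphere. -/
theorem isRadialChart_of_sphere {D : Set (Eu m)} (hD : IsOpen D) {ψ : Eu m → Eu (m + 1)}
    (hψ : ContDiffOn ℝ ∞ ψ D) (hinj : InjOn ψ D)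
    (himm : ∀ z ∈ D, Function.Injective (fderiv ℝ ψ z)) (hsph : ∀ z ∈ D, ‖ψ z‖ = 1)
    {z₀ : Eu m} {T : Eu m →L[ℝ] Eu m} (hT : Function.Injective T)
    (hTD : ∀ x ∈ Metric.ball (0 : Eu m) 1, z₀ + T x ∈ D) {r : ℝ} (hr : 1 + ξ ≤ r)
    {p : Eu (m + 1)} (hp : r • ψ z₀ = p) :
    IsRadialMap ξ r (fun z : Model m => (z.2 + r) • ψ (z₀ + T z.1)) (fun x => ψ (z₀ + T x)) ∧
      IsRadialChart {0}ᶜ ξ p (fun z : Model m => (z.2 + r) • ψ (z₀ + T z.1)) := by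
  have hφ₁ : ContDiffOn ℝ ∞ (fun x => ψ (z₀ + T x)) (Metric.ball 0 1) :=
    hψ.comp (contDiff_const.add T.contDiff).contDiffOn hTD
  have hR : IsRadialMap ξ r (fun z : Model m => (z.2 + r) • ψ (z₀ + T z.1))
      (fun x => ψ (z₀ + T x)) :=
    ⟨hφ₁, fun x hx => hsph _ (hTD x hx), fun t ht => by linarith [ht.1], fun x t _ => rfl⟩
  refine ⟨hR, ?_, ?_, ?_, ?_, ?_, fun x => ψ (z₀ + T x), r, ?_⟩
  · exact (contDiff_snd.add contDiff_const).contDiffOn.fun_smul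
      (hφ₁.comp contDiffOn_fst fun z hz => hz.1)
  · rintro ⟨x, t⟩ hz ⟨x', t'⟩ hz' h
    have h1 : t + r = t' + r := by
      rw [← hR.norm hz, ← hR.norm hz']
      exact congrArg norm h
    have h2 : t = t' := by linarith
    subst h2
    have h3 := smul_right_injective _ (hR.pos t hz.2).ne' h
    have h4 := hT (add_left_cancel (hinj (hTD x hz.1) (hTD x' hz'.1) h3))
    rw [h4]
  · rintro ⟨x, t⟩ hz
    rw [(hR.hasFDerivAt hz).fderiv, injective_iff_map_eq_zero]
    rintro ⟨v, s⟩ hv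
    have hx := hTD x hz.1
    have hd := (hψ.differentiableOn (by simp)).differentiableAt (hD.mem_nhds hx)
    have h1 : HasFDerivAt (fun x => ψ (z₀ + T x)) ((fderiv ℝ ψ (z₀ + T x)).comp T) x :=
      HasFDerivAt.comp (f := fun x => z₀ + T x) x hd.hasFDerivAt (T.hasFDerivAt.const_add z₀)
    have h2 : (t + r) • fderiv ℝ (fun x => ψ (z₀ + T x)) x v + s • ψ (z₀ + T x) = 0 := by
      simpa using hv
    -- Pairing with the unit normal kills the tangential part and isolates `s`.
    have h3 := congrArg (inner ℝ (ψ (z₀ + T x))) h2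
    rw [inner_add_right, inner_smul_right, inner_smul_right, hR.inner_fderiv hz.1,
      real_inner_self_eq_norm_sq, hsph _ hx] at h3
    have hs : s = 0 := by simpa using h3
    rw [hs, zero_smul, add_zero, h1.fderiv] at h2
    have h4 := (smul_eq_zero.1 h2).resolve_left (hR.pos t hz.2).ne'
    have h5 : T v = 0 := himm _ hx (by simpa using h4)
    have h6 : v = 0 := hT (by simpa using h5)
    rw [hs, h6]; rfl
  · rintro ⟨x, t⟩ hz
    exact norm_pos_iff.1 (by rw [hR.norm hz]; exact hR.pos t hz.2)
  · simpa using hp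
  · exact fun x t hz => ⟨hsph _ (hTD x hz.1), hR.pos t hz.2, rfl⟩

end Chart

/-! ### The region of the two variable warping trick -/

section Trick

variable {m : ℕ} {ξ : ℝ} {ρW ρT : ℝ → ℝ}

theorem inv_sinh_le {r : ℝ} (hr : 1 ≤ r) : (Real.sinh r)⁻¹ ≤ 4 * Real.exp (-r) := by
  have h1 := one_le_sinh hr
  rw [inv_le_iff_one_le_mul₀ (by linarith), Real.sinh_eq]
  have h2 : Real.exp (-r) * Real.exp r = 1 := by rw [← Real.exp_add]; simp
  have h3 : Real.exp (-r) ≤ 1 / 2 := by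
    rw [Real.exp_neg, inv_le_comm₀ (Real.exp_pos _) (by norm_num)]
    linarith [Real.add_one_le_exp r]
  have h4 := Real.exp_pos (-r)
  nlinarith

/-- The scale `min (1 / sinh r) δ` of a chart. -/
theorem scale_bounds {r δ : ℝ} (hr : 1 ≤ r) (hδ : 0 < δ) :
    let τ := min (Real.sinh r)⁻¹ δ
    0 < τ ∧ τ ≤ δ ∧ τ ≤ 4 * Real.exp (-r) ∧ |τ ^ 2 * Real.sinh r ^ 2| ≤ 1 ∧
      |τ ^ 2 * Real.sinh r ^ 2 - 1| ≤ 4 / δ * Real.exp (-r) := by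
  intro τ
  have hs : 0 < Real.sinh r := by linarith [one_le_sinh hr]
  have hτ : 0 < τ := lt_min (inv_pos.2 hs) hδ
  have h1 : τ * Real.sinh r ≤ 1 := by
    rw [← le_div_iff₀ hs, one_div]; exact min_le_left _ _
  have h0 : 0 ≤ τ * Real.sinh r := by positivity
  have h2 : τ ^ 2 * Real.sinh r ^ 2 ≤ 1 := by
    rw [← mul_pow]; exact pow_le_one₀ h0 h1
  have h3 : 0 ≤ τ ^ 2 * Real.sinh r ^ 2 := by positivity
  have he := Real.exp_pos (-r)
  refine ⟨hτ, min_le_right _ _, (min_le_left _ _).trans (inv_sinh_le hr),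
    by rw [abs_of_nonneg h3]; exact h2, ?_⟩
  rcases le_total (Real.sinh r)⁻¹ δ with h | h
  · have h4 : τ = (Real.sinh r)⁻¹ := min_eq_left h
    rw [h4, ← mul_pow, inv_mul_cancel₀ hs.ne', one_pow, sub_self, abs_zero]
    positivity
  -- Here the scale is capped at `δ`, so `exp (-r)` is bounded below by `δ / 4`; the error, at most
  -- `1`, is absorbed in the constant.
  · have h5 : 1 ≤ 4 / δ * Real.exp (-r) := by
      rw [div_mul_eq_mul_div, le_div_iff₀ hδ, one_mul]
      exact h.trans (inv_sinh_le hr)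
    rw [abs_le]
    constructor <;> linarith

-- Coercivity passes to convex combinations with the same constant. The determinant bounds are
-- therefore first converted into coercivity of `M` and `N`, and the combination is then
-- orthonormalized with entries bounded uniformly in `s`.
open Matrix in
theorem exists_frame (m : ℕ) {c : ℝ} (hc : 0 < c) : ∃ s₀, 0 < s₀ ∧
    ∀ M N : Matrix (Fin m) (Fin m) ℝ, M.PosDef → N.PosDef → (∀ i j, |M i j| ≤ c) →
      (∀ i j, |N i j| ≤ c) → 1 / c ≤ |M.det| → 1 / c ≤ |N.det| → ∀ s ∈ Icc (0 : ℝ) 1,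
      ∃ S : Matrix (Fin m) (Fin m) ℝ, IsUnit S ∧ (∀ i j, |S i j| ≤ s₀) ∧
        ∀ i j, (1 - s) * (∑ a, ∑ b, S a i * S b j * M a b) + s * (∑ a, ∑ b, S a i * S b j * N a b) =
          if i = j then 1 else 0 := by
  obtain ⟨κ, hκ, h⟩ := exists_coercive m hc
  refine ⟨(Real.sqrt κ)⁻¹, by positivity, fun M N hM hN hMc hNc hMd hNd s hs => ?_⟩
  have h1 : ∀ x : Fin m → ℝ, κ * (x ⬝ᵥ x) ≤ x ⬝ᵥ (((1 - s) • M + s • N) *ᵥ x) := fun x => by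
    have e1 := mul_le_mul_of_nonneg_left (h M hM.posSemidef hMc hMd x) (sub_nonneg.2 hs.2)
    have e2 := mul_le_mul_of_nonneg_left (h N hN.posSemidef hNc hNd x) hs.1
    rw [Matrix.add_mulVec, dotProduct_add, Matrix.smul_mulVec, Matrix.smul_mulVec, dotProduct_smul,
      dotProduct_smul, smul_eq_mul, smul_eq_mul]
    linarith
  have hpd : ((1 - s) • M + s • N).PosDef := by
    refine Matrix.PosDef.of_dotProduct_mulVec_pos ?_ fun x hx => ?_
    · ext i j
      have e1 := hM.1.apply i j
      have e2 := hN.1.apply i j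
      simp only [star_trivial] at e1 e2
      simp [e1, e2]
    · refine lt_of_lt_of_le (mul_pos hκ ?_) (h1 x)
      obtain ⟨i, hi⟩ := Function.ne_iff.1 hx
      exact Finset.sum_pos' (fun i _ => mul_self_nonneg _) ⟨i, Finset.mem_univ i, mul_self_pos.2 hi⟩
  obtain ⟨S, hS, hS1, hS2⟩ := exists_orthonormalizing hpd hκ h1
  refine ⟨S, hS, hS2, fun i j => ?_⟩
  have := congrFun (congrFun hS1 i) j
  rw [Matrix.one_apply] at this
  rw [← this]
  simp only [Matrix.mul_apply, Matrix.transpose_apply, Matrix.add_apply, Matrix.smul_apply,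
    smul_eq_mul, Finset.mul_sum, Finset.sum_mul]
  rw [← Finset.sum_add_distrib, Finset.sum_comm]
  simp only [← Finset.sum_add_distrib]
  exact Finset.sum_congr rfl fun b _ => Finset.sum_congr rfl fun a _ => by ring

theorem abs_double_sum_le {S M : Matrix (Fin m) (Fin m) ℝ} {s₀ c : ℝ} (hS : ∀ i j, |S i j| ≤ s₀)
    (hM : ∀ i j, |M i j| ≤ c) (i j : Fin m) :
    |∑ a, ∑ b, S a i * S b j * M a b| ≤ m * (m * (s₀ * s₀ * c)) := by
  refine (Finset.abs_sum_le_sum_abs _ _).trans ((Finset.sum_le_card_nsmul Finset.univ _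
    (m * (s₀ * s₀ * c)) fun a _ => ?_).trans (by simp))
  refine (Finset.abs_sum_le_sum_abs _ _).trans ((Finset.sum_le_card_nsmul Finset.univ _
    (s₀ * s₀ * c) fun b _ => ?_).trans (by simp))
  have h0 : 0 ≤ s₀ := (abs_nonneg _).trans (hS a i)
  rw [abs_mul, abs_mul]
  exact mul_le_mul (mul_le_mul (hS a i) (hS b j) (abs_nonneg _) h0) (hM a b) (abs_nonneg _)
    (by positivity)

theorem C2Bound.double_sum {V κ : Type*} [NormedAddCommGroup V] [NormedSpace ℝ V] {b : κ → V}
    {U : Set V} (hU : IsOpen U) {f : Fin m → Fin m → V → ℝ} {K s₀ : ℝ} (hK : 0 ≤ K)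
    (hf : ∀ a c, C2Bound b U (f a c) K) {S : Matrix (Fin m) (Fin m) ℝ}
    (hS : ∀ i j, |S i j| ≤ s₀) (i j : Fin m) :
    C2Bound b U (fun z => ∑ a, ∑ c, S a i * S c j * f a c z) (m * (m * (s₀ * s₀ * K))) := by
  have h1 : ∀ a c, C2Bound b U (fun z => S a i * S c j * f a c z) (s₀ * s₀ * K) := fun a c => by
    refine ((hf a c).const_mul hU _).mono (mul_le_mul_of_nonneg_right ?_ hK)
    rw [abs_mul]
    exact mul_le_mul (hS a i) (hS c j) (abs_nonneg _) ((abs_nonneg _).trans (hS a i))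
  simpa using C2Bound.sum hU Finset.univ fun a _ => C2Bound.sum hU Finset.univ fun c _ => h1 a c

/-- Below the level `l`, warp forcing leaves only the warped metric over the cut, so both terms of
the trick have the common factor `sinh²`. -/
theorem IsRadialMap.pullCoeff_hyperbolicForcing {a l d : ℝ} {φ : Model m → Eu (m + 1)}
    {φ₁ : Eu m → Eu (m + 1)} (h : IsRadialMap ξ a φ φ₁) (hρW : IsWarpCutoff ρW) (g : FormField m)
    {x : Eu m} {t : ℝ} (hz : (x, t) ∈ modelSet m ξ) (hl : t + a ≤ l) (i j : Fin m) :
    pullCoeff (modelBasis m) (hyperbolicForcing ρW ρT l d g) φ (some i) (some j) (x, t) =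
      (1 - ρT (2 * ((t + a - (l - d)) / d))) *
        (Real.sinh (t + a) ^ 2 * pullCoeff (stdVec m) (roundMetric m) φ₁ i j x) +
      ρT (2 * ((t + a - (l - d)) / d)) *
        (Real.sinh (t + a) ^ 2 * pullCoeff (stdVec m) (sphericalCut g l) φ₁ i j x) := by
  have hn := h.norm hz
  have hne : φ (x, t) ≠ 0 := norm_pos_iff.1 (by rw [hn]; exact h.pos t hz.2)
  have h1 : warpForcing ρW l g (φ (x, t)) = warpedMetric (sphericalCut g l) (φ (x, t)) :=
    warpForcing_of_le hρW (by rw [hn]; exact hl)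
  rw [← h.pullCoeff_warpedMetric _ hz, ← h.pullCoeff_warpedMetric _ hz]
  simp only [pullCoeff, hyperbolicForcing, warpingTrick, h1, hyperbolicMetric_of_ne hne, hn,
    add_apply, smul_apply, smul_eq_mul]

/-- Small charts of the sphere in which a convex combination of the round metric and of a bounded
metric `h` is `τ²` times the standard metric at the center. -/
theorem SphereAtlas.exists_adapted_chart (A : SphereAtlas m) {c : ℝ} (hc : 0 < c) :
    ∃ s₀ δ₁ : ℝ, 0 < s₀ ∧ 0 < δ₁ ∧ ∀ h : FormField m, (∀ x, ‖x‖ = 1 → IsTangentForm x (h x)) →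
      (∀ i, ChartBound A (roundMetric m) i c) → (∀ i, ChartBound A h i c) →
      ∀ x : Eu (m + 1), ‖x‖ = 1 → ∀ s ∈ Icc (0 : ℝ) 1, ∀ τ, 0 < τ → τ ≤ δ₁ →
      ∃ (i₀ : Fin A.N) (z₀ : Eu m) (S : Matrix (Fin m) (Fin m) ℝ), A.ψ i₀ z₀ = x ∧
        z₀ ∈ A.dom i₀ ∧ (∀ i j, |S i j| ≤ s₀) ∧ IsUnit (τ • S) ∧ (∀ i j, |(τ • S) i j| ≤ τ * s₀) ∧
        m * (τ * s₀) ≤ 1 ∧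
        (∀ y ∈ Metric.ball (0 : Eu m) 1, z₀ + matrixCLM (τ • S) y ∈ A.dom i₀) ∧
        ∀ i j, (1 - s) * (∑ a, ∑ b, S a i * S b j *
            pullCoeff (stdVec m) (roundMetric m) (A.ψ i₀) a b z₀) +
          s * (∑ a, ∑ b, S a i * S b j * pullCoeff (stdVec m) h (A.ψ i₀) a b z₀) =
            if i = j then 1 else 0 := by
  obtain ⟨s₀, hs₀, hframe⟩ := exists_frame m hc
  obtain ⟨δ, hδ, hleb⟩ := A.exists_lebesgue
  have hm0 : (0 : ℝ) ≤ m := Nat.cast_nonneg m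
  have hmin : 0 < min δ 1 := lt_min hδ one_pos
  have hden : 0 < 1 + m * s₀ + m * (m * s₀) := by positivity
  have hδ₁0 : 0 < min δ 1 / (1 + m * s₀ + m * (m * s₀)) := by positivity
  have hδ₁' : min δ 1 / (1 + m * s₀ + m * (m * s₀)) * (1 + m * s₀ + m * (m * s₀)) = min δ 1 :=
    div_mul_cancel₀ _ hden.ne'
  -- With `τ` below this bound, `m * τ * s₀ ≤ 1` makes the reparametrization a contraction in the
  -- `ℓ¹` sense, and `m² * τ * s₀ < δ` keeps the unit ball inside the chart domain.
  refine ⟨s₀, min δ 1 / (1 + m * s₀ + m * (m * s₀)), hs₀, hδ₁0,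
    fun h hh bσ bh x hx s hs τ hτ hτδ => ?_⟩
  generalize min δ 1 / (1 + m * s₀ + m * (m * s₀)) = δ₁ at *
  obtain ⟨i₀, z₀, hz₀, hball⟩ := hleb x hx
  have hz₀D : z₀ ∈ A.dom i₀ := hball (Metric.mem_ball_self hδ)
  have hz₀E := A.dom_subset_ext i₀ hz₀D
  have pd : ∀ k : FormField m, (∀ x, ‖x‖ = 1 → IsTangentForm x (k x)) →
      (gram k (A.ψ i₀) z₀).PosDef := fun k hk =>
    posDef_gram (A.isOpen_ext i₀) (A.smooth i₀) (A.mapsTo i₀) hz₀E (A.immersion i₀ z₀ hz₀E)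
      (hk _ (A.norm_ψ hz₀E))
  obtain ⟨S, hS, hSs, hS1⟩ := hframe _ _ (pd _ fun x _ => isTangentForm_round x) (pd h hh)
    (fun k j => ((bσ i₀).2.1 k j).val z₀ hz₀D) (fun k j => ((bh i₀).2.1 k j).val z₀ hz₀D)
    ((bσ i₀).2.2 z₀ hz₀D) ((bh i₀).2.2 z₀ hz₀D) s hs
  have hNs : ∀ i j, |(τ • S) i j| ≤ τ * s₀ := fun i j => by
    rw [Matrix.smul_apply, smul_eq_mul, abs_mul, abs_of_pos hτ]
    exact mul_le_mul_of_nonneg_left (hSs i j) hτ.le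
  refine ⟨i₀, z₀, S, hz₀, hz₀D, hSs, ?_, hNs, ?_, fun y hy => hball ?_, hS1⟩
  · have := hS.smul (Units.mk0 τ hτ.ne')
    simpa [Units.smul_def] using this
  · have h1 : τ * (m * s₀) ≤ δ₁ * (1 + m * s₀ + m * (m * s₀)) :=
      mul_le_mul hτδ (by nlinarith [mul_nonneg hm0 (mul_nonneg hm0 hs₀.le)]) (by positivity)
        hδ₁0.le
    rw [hδ₁'] at h1
    calc m * (τ * s₀) = τ * (m * s₀) := by ring
      _ ≤ 1 := h1.trans (min_le_right _ _)
  · rw [Metric.mem_ball, dist_self_add_left]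
    refine (norm_matrixCLM_le hNs hy).trans_lt ?_
    have h1 : τ * (m * (m * s₀)) ≤ δ₁ * (m * (m * s₀)) :=
      mul_le_mul_of_nonneg_right hτδ (by positivity)
    have h2 : δ₁ * (m * (m * s₀)) < δ₁ * (1 + m * s₀ + m * (m * s₀)) :=
      mul_lt_mul_of_pos_left (by nlinarith [mul_nonneg hm0 hs₀.le]) hδ₁0
    rw [hδ₁'] at h2
    calc m * (m * (τ * s₀)) = τ * (m * (m * s₀)) := by ring
      _ < δ := (h1.trans_lt h2).trans_le (min_le_left _ _)

/-- Uniform `C²` estimate of the error for a metric that is warped with slowly varying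
coefficients. -/
theorem c2Bound_error {U : Set (Model m)} (hU : IsOpen U) {Q q P X Y : Model m → ℝ}
    {KQ Kq KP KP' KX μ Kμ e D D' ρ₀ : ℝ} (hQ : C2Bound (modelBasis m) U Q KQ)
    (hq : C2Bound (modelBasis m) U (fun z => Q z - q z) Kq) (hP : C2Bound (modelBasis m) U P KP)
    (hP' : C2Bound (modelBasis m) U (fun z => P z - ρ₀) KP')
    (hX : C2Bound (modelBasis m) U X KX) (hY : C2Bound (modelBasis m) U Y KX)
    (h0 : 0 ≤ KQ) (h1 : 0 ≤ Kq) (h2 : 0 ≤ KP) (h3 : 0 ≤ KP') (h4 : 0 ≤ KX)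
    (hμ : |μ| ≤ 1) (hμ1 : |μ - 1| ≤ Kμ) (he : |e| ≤ 1) (hD : |D| ≤ D') :
    C2Bound (modelBasis m) U
      (fun z => e * ((μ - 1) * Q z + (Q z - q z)) +
        μ * (Q z * (D * (P z - ρ₀) + (X z + P z * (Y z - X z)))))
      (Kμ * KQ + Kq + 4 * KQ * (D' * KP' + (1 + 8 * KP) * KX)) := by
  have hKμ : 0 ≤ Kμ := (abs_nonneg _).trans hμ1
  have hD' : 0 ≤ D' := (abs_nonneg _).trans hD
  refine ((((hQ.const_mul hU (μ - 1)).add hU hq).const_mul hU e).add hU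
    ((hQ.mul hU ((hP'.const_mul hU D).add hU
      (hX.add hU (hP.mul hU (hY.sub hU hX))))).const_mul hU μ)).mono ?_
  have e1 : |e| * (|μ - 1| * KQ + Kq) ≤ 1 * (Kμ * KQ + Kq) := by gcongr
  have e2 : |μ| * (4 * (KQ * (|D| * KP' + (KX + 4 * (KP * (KX + KX)))))) ≤
      1 * (4 * (KQ * (D' * KP' + (KX + 4 * (KP * (KX + KX)))))) := by gcongr
  refine (add_le_add e1 e2).trans (le_of_eq (by ring))

/-- Below the region of warp forcing, hyperbolic forcing produces a metric that is close to
hyperbolic. -/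
theorem exists_trick_bound (hρW : IsWarpCutoff ρW) (hρT : IsTrickCutoff ρT) (hξ : 1 < ξ)
    (A : SphereAtlas m) {c : ℝ} (hc : 0 < c) :
    ∃ C₁ : ℝ, 0 < C₁ ∧ ∀ (b l d : ℝ) (g : FormField m) (p : Eu (m + 1)), 2 * ξ ≤ l - d →
      4 * (1 + ξ) ≤ d → b < l → IsMetricOn (outerRegion m b) g → IsPolarOn (outerRegion m b) g →
      (∀ i, ChartBound A (sphericalCut g l) i c) → l - d - ξ ≤ ‖p‖ → ‖p‖ ≤ l - ξ →
      ∃ φ, IsRadialChart {0}ᶜ (ξ - 1) p φ ∧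
        c2NormMat (modelBasis m) (modelSet m (ξ - 1))
          (fun i j z => pullCoeff (modelBasis m) (hyperbolicForcing ρW ρT l d g) φ i j z -
            modelCoeff m i j z) ≤ ENNReal.ofReal (C₁ * (Real.exp (-(l - d)) + 1 / d)) := by
  obtain ⟨cσ, hcσ, hσ⟩ := (isC2SphereMetric_round (m := m)).exists_chartBound A
  have hcc0 : 0 < cσ + c := by positivity
  obtain ⟨s₀, δ₁, hs₀, hδ₁, hadapt⟩ := A.exists_adapted_chart hcc0
  obtain ⟨KQ, hKQ, hQ⟩ := exists_c2Bound_sinh_ratio ξ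
  obtain ⟨Kρ, hKρ, hρ⟩ := hρT.exists_c2Bound
  have bσ := fun i => (hσ i).mono (show cσ ≤ cσ + c by linarith)
  have hcle : c ≤ cσ + c := by linarith
  generalize cσ + c = cc at *
  have hm0 : (0 : ℝ) ≤ m := Nat.cast_nonneg m
  have hξ0 : 0 < ξ := by linarith
  -- The bound of `c2Bound_error` is made linear in `u = exp (-r)` and `v = 1 / d` beforehand, so
  -- that `C₀` depends on neither the point nor the family.
  obtain ⟨C₀, hC₀, hC⟩ : ∃ C₀ : ℝ, 0 < C₀ ∧ ∀ u v τ : ℝ, 0 ≤ u → 0 ≤ v → τ ≤ 4 * u →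
      4 / δ₁ * u * KQ + u * KQ + 4 * KQ * (2 * (m * (m * (s₀ * s₀ * cc))) *
        ((m + ξ) * (2 * v * Kρ)) +
          (1 + 8 * Kρ) * (m * (m * (s₀ * s₀ * ((m + ξ) * (m * (τ * s₀) * cc)))))) ≤
        C₀ * (u + v) := by
    refine ⟨(4 / δ₁ + 1) * KQ + 4 * KQ * (2 * (m * (m * (s₀ * s₀ * cc))) * ((m + ξ) * (2 * Kρ)) +
      (1 + 8 * Kρ) * (m * (m * (s₀ * s₀ * ((m + ξ) * (m * (4 * s₀) * cc)))))), by positivity,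
      fun u v τ hu hv hτ => ?_⟩
    have h1 : 4 * KQ * ((1 + 8 * Kρ) * (m * (m * (s₀ * s₀ * ((m + ξ) * (m * (τ * s₀) * cc)))))) ≤
        4 * KQ * ((1 + 8 * Kρ) * (m * (m * (s₀ * s₀ * ((m + ξ) * (m * ((4 * u) * s₀) * cc)))))) := by
      gcongr
    have h2 : 0 ≤ ((4 / δ₁ + 1) * KQ + 4 * KQ *
      ((1 + 8 * Kρ) * (m * (m * (s₀ * s₀ * ((m + ξ) * (m * (4 * s₀) * cc))))))) * v := by positivity
    have h3 : 0 ≤ 4 * KQ * (2 * (m * (m * (s₀ * s₀ * cc))) * ((m + ξ) * (2 * Kρ))) * u := by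
      positivity
    linarith
  -- The factor `exp ξ` pays for the passage from `exp (-r)` to `exp (-(l - d))`, as `r ≥ l - d -
  -- ξ`.
  refine ⟨C₀ * Real.exp ξ, by positivity, fun b l d g p hld hd hbl hg hpol hcut hp₁ hp₂ => ?_⟩
  -- Since `l - d ≥ 2 ξ`, one even has `‖p‖ ≥ ξ`; this is what keeps the chart of half-length `ξ`
  -- away from the center.
  have hr : 1 ≤ ‖p‖ := by linarith
  have hxn : ‖‖p‖⁻¹ • p‖ = 1 := by
    rw [norm_smul, norm_inv, norm_norm, inv_mul_cancel₀ (by linarith)]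
  have hrx : ‖p‖ • ‖p‖⁻¹ • p = p := by
    rw [smul_smul, mul_inv_cancel₀ (by linarith), one_smul]
  generalize hr_def : ‖p‖ = r at *
  have hr0 : 0 < r := by linarith
  have hl0 : 0 < l := by linarith
  have hd0 : 0 < d := by linarith
  obtain ⟨hτ, hτδ, hτu, hμ, hμ1⟩ := scale_bounds hr hδ₁
  generalize min (Real.sinh r)⁻¹ δ₁ = τ at *
  have bh := fun i => (hcut i).mono hcle
  obtain ⟨i₀, z₀, S, hz₀, hz₀D, hSs, hNU, hNs, hθ, hTD, hS1⟩ := hadapt (sphericalCut g l)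
    (fun x hx => hg.isTangentForm_sphericalCut hl0 hbl hx) bσ bh (r⁻¹ • p) hxn
    (ρT (2 * ((r - (l - d)) / d))) (hρT.2.1 _) τ hτ hτδ
  obtain ⟨hR, hchart⟩ := isRadialChart_of_sphere (ξ := ξ - 1) (r := r) (p := p) (A.isOpen_dom i₀)
    ((A.smooth i₀).mono (A.dom_subset_ext i₀)) ((A.injOn i₀).mono (A.dom_subset_ext i₀))
    (fun z hz => A.immersion i₀ z (A.dom_subset_ext i₀ hz))
    (fun z hz => A.norm_ψ (A.dom_subset_ext i₀ hz)) (matrixCLM_injective hNU) hTD (by linarith)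
    (by rw [hz₀, hrx])
  refine ⟨_, hchart, ?_⟩
  obtain ⟨hH, hHp⟩ := isMetricOn_hyperbolicForcing (d := d) hρW hρT hl0 hbl hg hpol
  refine hR.c2NormMat_le hH hHp (by positivity) fun i j => ?_
  have hU := isOpen_modelSet m (ξ - 1)
  obtain ⟨hβ, hβ'⟩ := exp_neg_div_sinh_mem hr
  have hRt : ∀ t ∈ Ioo (-(1 + (ξ - 1))) (1 + (ξ - 1)), t - 0 ∈ Ioo (-ξ) ξ := fun t ht =>
    ⟨by linarith [ht.1], by linarith [ht.2]⟩
  have bQ := (hQ _ hβ).1.comp_snd (m := m) isOpen_Ioo 0 hRt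
  have bQe := (hQ _ hβ).2.comp_snd (m := m) isOpen_Ioo 0 hRt
  simp only [sub_zero] at bQ bQe
  obtain ⟨bρ, bρ'⟩ := IsTrickCutoff.c2Bound_scaled (m := m) hξ hρ (show 2 ≤ d by linarith)
    (2 * ((r - (l - d)) / d))
  have hkA0 : 0 ≤ (m + ξ) * (m * (τ * s₀) * cc) := by positivity
  have bX : ∀ k : FormField m, ChartBound A k i₀ cc → C2Bound (modelBasis m) (modelSet m (ξ - 1))
      (fun z => ∑ a, ∑ b, S a i * S b j *
        (pullCoeff (stdVec m) k (A.ψ i₀) a b (z₀ + matrixCLM (τ • S) z.1) -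
          pullCoeff (stdVec m) k (A.ψ i₀) a b z₀))
      (m * (m * (s₀ * s₀ * ((m + ξ) * (m * (τ * s₀) * cc))))) := fun k hk =>
    C2Bound.double_sum hU hkA0 (fun a b => (hk.2.1 a b).comp_contraction hξ (A.isOpen_dom i₀)
      (by positivity) hNs hθ hTD) hSs i j
  have hX0 : ∀ k : FormField m, ChartBound A k i₀ cc → |∑ a, ∑ b, S a i * S b j *
      pullCoeff (stdVec m) k (A.ψ i₀) a b z₀| ≤ m * (m * (s₀ * s₀ * cc)) := fun k hk =>
    abs_double_sum_le (M := gram k (A.ψ i₀) z₀) hSs (fun a b => (hk.2.1 a b).val z₀ hz₀D) i j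
  have he : |(if i = j then 1 else 0 : ℝ)| ≤ 1 := by split_ifs <;> simp
  have total := c2Bound_error hU bQ bQe bρ bρ' (bX _ (bσ i₀)) (bX _ (bh i₀)) hKQ.le
    (mul_nonneg hβ.1 hKQ.le) hKρ.le (by positivity) (by positivity) hμ hμ1 he
    ((abs_sub _ _).trans (add_le_add (hX0 _ (bh i₀)) (hX0 _ (bσ i₀))))
  refine (total.mono ?_).congr hU fun z hz => ?_
  · have h1 := hC (Real.exp (-r)) (1 / d) τ (Real.exp_pos _).le (by positivity) hτu
    have h2 : Real.exp (-r) ≤ Real.exp ξ * Real.exp (-(l - d)) := by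
      rw [← Real.exp_add]; exact Real.exp_le_exp.2 (by linarith)
    have h3 : 1 / d ≤ Real.exp ξ * (1 / d) :=
      le_mul_of_one_le_left (by positivity) (Real.one_le_exp hξ0.le)
    have h4 := mul_le_mul_of_nonneg_right hβ' hKQ.le
    have h5 := mul_le_mul_of_nonneg_left (add_le_add h2 h3) hC₀.le
    rw [show 2 / d = 2 * (1 / d) by ring]
    linarith
  · obtain ⟨x, t⟩ := z
    have hdiff := ((A.smooth i₀).differentiableOn (by simp)).differentiableAt
      ((A.isOpen_ext i₀).mem_nhds (A.dom_subset_ext i₀ (hTD x hz.1)))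
    have hw : 2 * ((t + r - (l - d)) / d) = 2 * ((r - (l - d)) / d) + 2 / d * t := by ring
    rw [hR.pullCoeff_hyperbolicForcing hρW g hz (by linarith [hz.2.2]) i j,
      pullCoeff_comp_matrixCLM _ hdiff, pullCoeff_comp_matrixCLM _ hdiff, hw, modelCoeff_some_some,
      add_comm t r, sinh_add_eq hr0]
    simp only [mul_sub, Finset.sum_sub_distrib]
    -- With `μ = τ² sinh² r`, the bracket multiplying `μ Q` is the central value of the convex
    -- combination, which `hS1` replaces by the identity entry, plus the variation of the cutoff
    -- times the difference of the two tensors at the center, plus the variations of the tensors.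
    linear_combination (τ ^ 2 * Real.sinh r ^ 2 *
      (Real.exp t + Real.exp (-r) / Real.sinh r * Real.sinh t) ^ 2) * hS1 i j

end Trick

/-! ### Hyperbolic forcing -/

section Main

variable {m : ℕ} {ξ : ℝ} {ρW ρT : ℝ → ℝ}

/-- Charts that avoid the region where the metric is changed. -/
theorem c2NormMat_hyperbolicForcing_of_far (hρW : IsWarpCutoff ρW) (hρT : IsTrickCutoff ρT)
    (hξ : 1 < ξ) {b l d ε : ℝ} {g : FormField m} {p : Eu (m + 1)} {φ : Model m → Eu (m + 1)}
    (hε : 0 ≤ ε) (hd : 0 < d) (hp : l + ξ + 1 / 2 ≤ ‖p‖) (hg : IsMetricOn (outerRegion m b) g)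
    (hφ : IsRadialChart (outerRegion m b) ξ p φ)
    (hc : c2NormMat (modelBasis m) (modelSet m ξ)
      (fun i j z => pullCoeff (modelBasis m) g φ i j z - modelCoeff m i j z) ≤ ENNReal.ofReal ε) :
    c2NormMat (modelBasis m) (modelSet m (ξ - 1))
      (fun i j z => pullCoeff (modelBasis m) (hyperbolicForcing ρW ρT l d g) φ i j z -
        modelCoeff m i j z) ≤ ENNReal.ofReal ε := by
  obtain ⟨φ₁, hr⟩ := hφ.exists_isRadialMap (by linarith)
  have hsub := modelSet_mono m (show ξ - 1 ≤ ξ by linarith)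
  refine c2NormMat_le fun i j => ((c2Bound_chart hg.1 hφ hε hc i j).subset hsub).congr
    (isOpen_modelSet m (ξ - 1)) fun z hz => ?_
  obtain ⟨x, t⟩ := z
  have hn := hr.norm (hsub hz)
  have ht := hz.2.1
  simp only at ht
  have h1 : warpForcing ρW l g (φ (x, t)) = g (φ (x, t)) :=
    warpForcing_of_ge hρW (by rw [hn]; linarith)
  have h2 : hyperbolicForcing ρW ρT l d g (φ (x, t)) = g (φ (x, t)) := by
    rw [← h1]
    exact warpingTrick_of_ge hρT hd (by rw [hn]; linarith)
  simp only [pullCoeff_congr h2]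

/-- The strict norm inequality at any one point forces `ε > 0`; a point of norm `l₀` exists because
the space has dimension `m + 1`. -/
theorem OdotRadiallyClose.pos {l₀ ε : ℝ} {inn : ℝ → ℝ} {g : ℝ → FormField m} (hξ : 0 < ξ)
    (hl₀ : 0 < l₀) (h : OdotRadiallyClose l₀ inn g ε ξ) : 0 < ε := by
  obtain ⟨φ, -, hφ⟩ := h l₀ le_rfl (EuclideanSpace.single 0 l₀) (by
    simp only [mem_compl_iff, mem_ball_zero_iff, PiLp.norm_single, Real.norm_eq_abs,
      abs_of_pos hl₀]
    linarith)
  exact ENNReal.ofReal_pos.1 (lt_of_le_of_lt zero_le hφ)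

end Main

end HypForcing

open HypForcing in
theorem theorem2
    (ρW ρT : ℝ → ℝ) (hρW : HypForcing.IsWarpCutoff ρW) (hρT : HypForcing.IsTrickCutoff ρT)
    (ξ : ℝ) (hξ : 1 < ξ) :
    ∃ C₂ : ℝ, 0 < C₂ ∧
      ∀ (m : ℕ) (A : HypForcing.SphereAtlas m),
        ∃ C₁ : ℝ → ℝ, (∀ c, 0 < C₁ c) ∧
          ∀ (l₀ : ℝ) (inn : ℝ → ℝ) (g : ℝ → HypForcing.FormField m),
            HypForcing.IsOdotFamily ξ l₀ inn g →
            (∃ ginf : HypForcing.FormField m, HypForcing.HasCutLimit A g 0 ginf) →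
            ∀ ε : ℝ, HypForcing.OdotRadiallyClose l₀ inn g ε ξ →
              (∃ c > 1, ∀ l ≥ l₀, HypForcing.CBounded A c (HypForcing.sphericalCut (g l) l)) ∧
              ∀ c > 1, (∀ l ≥ l₀, HypForcing.CBounded A c (HypForcing.sphericalCut (g l) l)) →
                ∀ l ≥ l₀, ∀ d ≥ 4 * (1 + ξ), 2 * ξ ≤ l - d →
                  ∀ η ≥ C₁ c * (Real.exp (-(l - d)) + 1 / d) + C₂ * ε,
                    HypForcing.BallCloseToHyperbolic
                      (HypForcing.hyperbolicForcing ρW ρT l d (g l)) (l - d) η (ξ - 1) := by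
  obtain ⟨Cw, C₂, hCw, hC₂, hwarp⟩ := exists_warp_bound hρW hρT hξ
  refine ⟨C₂, by linarith, fun m A => ?_⟩
  have htrick := fun c : {c : ℝ // 0 < c} => exists_trick_bound hρW hρT hξ A c.2
  choose Ct hCt htrick using htrick
  -- The value `1` for `c ≤ 0` only serves positivity; the estimate is used for `c > 1`.
  refine ⟨fun c => if h : 0 < c then Ct ⟨c, h⟩ + Cw else 1, fun c => ?_, ?_⟩
  · dsimp only
    split_ifs with h
    · exact add_pos (hCt ⟨c, h⟩) hCw
    · exact one_pos
  intro l₀ inn g hg ⟨ginf, hlim⟩ ε hε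
  have hξ0 : 0 < ξ := by linarith
  refine ⟨hg.exists_cBounded hξ0 A hlim, fun c hc hcut l hl d hd hld η hη => ?_⟩
  have hc0 : 0 < c := by linarith
  simp only [dif_pos hc0] at hη
  have hε0 := hε.pos hξ0 (hg.pos hξ0 le_rfl)
  have hl0 := hg.pos hξ0 hl
  have hbl := hg.inn_lt hξ0 hl
  have hd0 : 0 < d := by linarith
  have hgm := hg.metric l hl
  have hgp := hg.polar l hl
  obtain ⟨hH, hHp⟩ := isMetricOn_hyperbolicForcing (d := d) hρW hρT hl0 hbl hgm hgp
  have hu : 0 < Real.exp (-(l - d)) := Real.exp_pos _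
  have hv : 0 < 1 / d := by positivity
  have hC₂ε : ε ≤ C₂ * ε := le_mul_of_one_le_left hε0.le hC₂
  have hCtu := mul_pos (hCt ⟨c, hc0⟩) (add_pos hu hv)
  have hCwu := mul_pos hCw (add_pos hu hv)
  have hη0 : 0 < η := by linarith
  refine ⟨hH, hHp, fun y hy => ?_, fun p hp => ?_⟩
  · exact warpingTrick_of_le hρT hd0 (mem_ball_zero_iff.1 hy).le
  · have hp' : l - d - ξ ≤ ‖p‖ := by
      have := not_lt.1 fun h => hp (mem_ball_zero_iff.2 h)
      linarith
    -- Constructed charts may be centered up to `l - ξ`, and given charts exist from `l - 1 - ξ` on;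
    -- the threshold is the midpoint of this overlap.
    rcases le_or_gt ‖p‖ (l - ξ - 1 / 2) with h1 | h1
    · obtain ⟨φ, hφ, hb⟩ := htrick ⟨c, hc0⟩ (inn l) l d (g l) p hld hd hbl hgm hgp
        (fun i => (hcut l hl).chartBound hc0 (fun i k j =>
          (hg.contDiffOn_pullCoeff_cut hξ0 A i k j hl).mono (A.dom_subset_ext i)) i)
        hp' (by linarith)
      exact ⟨φ, hφ, hb.trans_lt ((ENNReal.ofReal_lt_ofReal_iff hη0).2 (by linarith))⟩
    · obtain ⟨φ, hφ, hb⟩ := hε l hl p fun h => by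
        have := mem_ball_zero_iff.1 h
        linarith
      have hsub : outerRegion m (inn l) ⊆ {0}ᶜ := fun y hy => hy.1
      refine ⟨φ, hφ.restrict (by linarith) hsub, ?_⟩
      -- Warp forcing ends at `l + 1 / 2`, and charts of half-length `ξ` centered higher than this
      -- threshold lie entirely beyond it.
      rcases le_or_gt ‖p‖ (l + ξ + 1 / 2) with h2 | h2
      · refine (hwarp m (inn l) l d ε (g l) p φ hε0.le (by linarith) hbl hd
          (abs_le.2 ⟨by linarith, by linarith⟩) hgm hgp hφ hb.le).trans_lt
            ((ENNReal.ofReal_lt_ofReal_iff hη0).2 ?_)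
        have h3 : Real.exp (-l) ≤ Real.exp (-(l - d)) := Real.exp_le_exp.2 (by linarith)
        have h4 := mul_le_mul_of_nonneg_left h3 hCw.le
        have h5 := mul_pos hCw hv
        linarith
      · exact (c2NormMat_hyperbolicForcing_of_far hρW hρT hξ hε0.le hd0 h2.le hgm hφ hb.le).trans_lt
          ((ENNReal.ofReal_lt_ofReal_iff hη0).2 (by linarith))
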